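/- **Setting.** A linear dynamical system (LDS) $(A,B,C,D)$ with $A\in\mathbb R^{d\times d}$, $B\in\mathbb R^{d\times n}$, $C\in\mathbb R^{m\times d}$, $D\in\mathbb R^{m\times n}$ maps inputs $x_1,x_2,\dots\in\mathbb R^n$ to outputs $y_t=Ch_t+Dx_t\in\mathbb R^m$, where $h_0=0$ and $h_t=Ah_{t-1}+Bx_t$. For $R_\Theta,R_\Psi,R_1\ge 1$ and $\tau\in\mathbb N$ call it *admissible* if: $A$ has spectral radius at most $1$; $A=\Psi\Lambda\Psi^{-1}$ over $\mathbb C$ with $\Lambda$ diagonal and $\|\Psi\|_F\|\Psi^{-1}\|_F\le R_\Psi$; the spectral norms of $B,C,D$ are at most $R_\Theta$; and there is a monic real polynomial $p$ of degree $\tau$ whose coefficients have absolute values summing to at most $R_1$, such that every eigenvalue $\alpha$ of $A$ can be written $\alpha=|\alpha|\omega$ with $|\omega|=1$ and $p(\omega)=0$. Let $Z_T$ be the $T\times T$ matrix with entries $\frac{2}{(i+j)^3-(i+j)}$, and let $(\sigma_h,\phi_h)_{h\le k}$ be its top $k$ eigenpairs ($\sigma_1\ge\sigma_2\ge\cdots$,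 $\phi_h$ orthonormal). A *pseudo-LDS* $\hat\Theta=(M,N,\beta,P)$ with $W$ phases, $k\le T$ filters and order $L$ consists of matrices $M(p,h),N(p,h)\in\mathbb R^{m\times n}$ ($0\le p<W$, $1\le h\le k$), $\beta\in\mathbb R^L$ and $P_0,\dots,P_L\in\mathbb R^{m\times n}$. With $x_s=0$, $y_s=0$ for $s\le 0$, its prediction at time $t$ is $$\hat y_t(\hat\Theta)=\sum_{u=1}^{L}\beta_uy_{t-u}+\sum_{j=0}^{L}P_jx_{t-j}+\sum_{p=0}^{W-1}\sum_{h=1}^{k}\sum_{u=1}^{T}\sigma_h^{1/4}\phi_h(u)\Big(\cos\tfrac{2\pi up}{W}\,M(p,h)+\sin\tfrac{2\pi up}{W}\,N(p,h)\Big)x_{t-L-u}.$$ Let $\|M\|_{2,q}=\big(\sum_p(\sum_h\|M(p,h)\|_F^2)^{q/2}\big)^{1/q}$, let $$\mathcal K=\Big\{\hat\Theta:\ \|M\|_{2,1}+\|N\|_{2,1}+\|\beta\|_1+\big(\textstyle\sum_j\|P_j\|_F^2\big)^{1/2}\le\rho\Big\},$$ and let $\mathcal R(\hat\Theta)=\|M\|_{2,q}^2+\|N\|_{2,q}^2+\|\beta\|_{q'}^2+\sum_j\|P_j\|_F^2$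 with $q=\frac{\ln W}{\ln W-1}$ and $q'=\frac{\ln L}{\ln L-1}$. Put $f_t(\hat\Theta)=\|\hat y_t(\hat\Theta)-y_t\|_2^2$. The FTRL algorithm with weight $\eta>0$ plays an arbitrary $\hat\Theta_1\in\mathcal K$ and then, for $1\le t<T$, $\hat\Theta_{t+1}\in\arg\min_{\hat\Theta\in\mathcal K}\ \sum_{u=1}^{t}f_u(\hat\Theta)+\frac1\eta\mathcal R(\hat\Theta)$. **Theorem.** For all $\kappa,s\in\mathbb R$ there are constants $c\in\mathbb R$ and $a\in\mathbb N$ such that the following holds for all integers $n,m,d\ge1$, $T\ge2$, $0\le\tau\le\kappa d$ and all reals $R_\Theta,R_x,R_y,R_\Psi,R_1\ge1$ and $R\ge R_1^3R_x^2R_\Theta^4R_\Psi^2R_y^2$. There are parameters $W,L\ge3$, $k\le T$, $\rho,\eta>0$ with $L\le c\,d$, depending only on the quantities above, such that for every choice of eigenpairs of $Z_T$: 1. *(The decision set contains every admissible LDS, up to error $T^{-s}$.)* For every admissible LDS there is $\hat\Theta\in\mathcal K$ such that, for all inputs with $\|x_t\|_2\le R_x$ ($1\le t\le T$) and with $y_t$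 the outputs of the LDS, $\|\hat y_t(\hat\Theta)-y_t\|_2\le T^{-s}$ for all $1\le t\le T$. 2. *(Regret.)* For all sequences with $\|x_t\|_2\le R_x$ and $\|y_t\|_2\le R_y$ ($1\le t\le T$), FTRL has a run, and for every run $\hat\Theta_1,\dots,\hat\Theta_T$ and every fixed $\hat\Theta^*\in\mathcal K$ (in particular the best one in hindsight), $$\sum_{t=1}^{T}\|\hat y_t(\hat\Theta_t)-y_t\|_2^2-\sum_{t=1}^{T}\|\hat y_t(\hat\Theta^*)-y_t\|_2^2\ \le\ c\,\ln^a(n+m+d+R_\Theta+R_x+R_y)\; R\,d^{5/2}\,n\,\ln^7T\,\sqrt T .$$ -/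

import Mathlib

noncomputable section

namespace SpectralFiltering

/-- A linear dynamical system with inputs in `ℝⁿ`, hidden states in `ℝᵈ`, outputs in `ℝᵐ`:
`h₀ = 0`, `h_t = A h_{t-1} + B x_t`, `y_t = C h_t + D x_t`. -/
structure LDS (n m d : ℕ) where
  A : Matrix (Fin d) (Fin d) ℝ
  B : Matrix (Fin d) (Fin n) ℝ
  C : Matrix (Fin m) (Fin d) ℝ
  D : Matrix (Fin m) (Fin n) ℝ

/-- The matrix-vector product on Euclidean spaces. -/
def mulE {a b : ℕ} (X : Matrix (Fin a) (Fin b) ℝ) (v : EuclideanSpace ℝ (Fin b)) :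
    EuclideanSpace ℝ (Fin a) :=
  WithLp.toLp 2 (X.mulVec v.ofLp)

/-- The hidden state at time `t`; the input `x 0` is never used. -/
def LDS.state {n m d : ℕ} (S : LDS n m d) (x : ℕ → EuclideanSpace ℝ (Fin n)) :
    ℕ → EuclideanSpace ℝ (Fin d)
  | 0 => 0
  | t + 1 => mulE S.A (S.state x t) + mulE S.B (x (t + 1))

/-- The (noiseless) output at time `t ≥ 1`. -/
def LDS.output {n m d : ℕ} (S : LDS n m d) (x : ℕ → EuclideanSpace ℝ (Fin n)) (t : ℕ) :
    EuclideanSpace ℝ (Fin m) :=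
  mulE S.C (S.state x t) + mulE S.D (x t)

/-- The spectral (operator `ℓ² → ℓ²`) norm of a real matrix. -/
def specNorm {a b : ℕ} (X : Matrix (Fin a) (Fin b) ℝ) : ℝ :=
  ‖LinearMap.toContinuousLinearMap (Matrix.toEuclideanLin X)‖

/-- The Frobenius norm of a complex matrix. -/
def frobC {a b : ℕ} (X : Matrix (Fin a) (Fin b) ℂ) : ℝ :=
  √(∑ i, ∑ j, ‖X i j‖ ^ 2)

/-- The size assumptions on a linear dynamical system. In `phases`, the unit number `ω` is the
phase of the eigenvalue `α`; it is `α / |α|` if `α ≠ 0`, and any unit number is a phase of `0`. -/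
structure LDS.Obeys {n m d : ℕ} (S : LDS n m d) (RTheta RPsi R1 : ℝ) (τ : ℕ) : Prop where
  stable : spectralRadius ℂ (S.A.map (algebraMap ℝ ℂ)) ≤ 1
  diagonalizable : ∃ (Psi PsiInv : Matrix (Fin d) (Fin d) ℂ) (lam : Fin d → ℂ),
    Psi * PsiInv = 1 ∧ PsiInv * Psi = 1 ∧
    S.A.map (algebraMap ℝ ℂ) = Psi * Matrix.diagonal lam * PsiInv ∧
    frobC Psi * frobC PsiInv ≤ RPsi
  normB : specNorm S.B ≤ RTheta
  normC : specNorm S.C ≤ RTheta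
  normD : specNorm S.D ≤ RTheta
  phases : ∃ p : Polynomial ℝ, p.Monic ∧ p.natDegree = τ ∧
    ∑ i ∈ Finset.range (τ + 1), |p.coeff i| ≤ R1 ∧
    ∀ α ∈ spectrum ℂ (S.A.map (algebraMap ℝ ℂ)),
      ∃ ω : ℂ, ‖ω‖ = 1 ∧ α = (‖α‖ : ℂ) * ω ∧ Polynomial.aeval ω p = 0

/-- The `T × T` Hankel matrix with entries `2 / ((i + j)³ - (i + j))`, `1 ≤ i, j ≤ T`. -/
def hankel (T : ℕ) : Matrix (Fin T) (Fin T) ℝ := fun i j =>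
  2 / ((((i : ℕ) + 1 + ((j : ℕ) + 1) : ℕ) : ℝ) ^ 3 - (((i : ℕ) + 1 + ((j : ℕ) + 1) : ℕ) : ℝ))

/-- `φ 0, …, φ (T - 1)` is an orthonormal basis of eigenvectors of `hankel T`, with eigenvalues
`σ 0 ≥ … ≥ σ (T - 1)`; the entry of `φ h` at time lag `u + 1` is `φ h u`. -/
structure IsHankelEigensystem (T : ℕ) (σ : Fin T → ℝ) (φ : Fin T → Fin T → ℝ) : Prop where
  antitone : Antitone σ
  orthonormal : ∀ h h', ∑ u, φ h u * φ h' u = if h = h' then 1 else 0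
  eigen : ∀ h, (hankel T).mulVec (φ h) = σ h • φ h

/-- A pseudo-LDS `(M, N, β, P)` with `W` phases, `k` filters and autoregressive order `L`. -/
structure PseudoLDS (n m W k L : ℕ) where
  M : Fin W → Fin k → Matrix (Fin m) (Fin n) ℝ
  N : Fin W → Fin k → Matrix (Fin m) (Fin n) ℝ
  β : Fin L → ℝ
  P : Fin (L + 1) → Matrix (Fin m) (Fin n) ℝ

/-- The value `z_{t-j}` of a sequence `z₁, z₂, …` that is continued by zero to times `≤ 0`. -/
def lag {a : ℕ} (z : ℕ → EuclideanSpace ℝ (Fin a)) (t j : ℕ) : EuclideanSpace ℝ (Fin a) :=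
  if j < t then z (t - j) else 0

/-- The prediction of a pseudo-LDS at time `t`:
`∑_{u=1}^{L} β_u y_{t-u} + ∑_{j=0}^{L} P_j x_{t-j}
  + ∑_{p=0}^{W-1} ∑_{h=1}^{k} ∑_{u=1}^{T} σ_h^{1/4} φ_h(u)
      (cos(2πup/W) M(p,h) + sin(2πup/W) N(p,h)) x_{t-L-u}`. -/
def PseudoLDS.predict {n m W k L T : ℕ} (hk : k ≤ T) (σ : Fin T → ℝ) (φ : Fin T → Fin T → ℝ)
    (Q : PseudoLDS n m W k L) (x : ℕ → EuclideanSpace ℝ (Fin n))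
    (y : ℕ → EuclideanSpace ℝ (Fin m)) (t : ℕ) : EuclideanSpace ℝ (Fin m) :=
  ∑ u : Fin L, Q.β u • lag y t ((u : ℕ) + 1) +
  ∑ j : Fin (L + 1), mulE (Q.P j) (lag x t (j : ℕ)) +
  ∑ p : Fin W, ∑ h : Fin k, ∑ u : Fin T,
    (σ (Fin.castLE hk h) ^ (1 / 4 : ℝ) * φ (Fin.castLE hk h) u) •
      mulE (Real.cos (2 * Real.pi * ((u : ℕ) + 1 : ℝ) * (p : ℕ) / W) • Q.M p h +
            Real.sin (2 * Real.pi * ((u : ℕ) + 1 : ℝ) * (p : ℕ) / W) • Q.N p h)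
        (lag x t (L + ((u : ℕ) + 1)))

/-- The `ℓ^q` norm of a vector. -/
def lqNorm {ι : Type*} [Fintype ι] (q : ℝ) (v : ι → ℝ) : ℝ :=
  (∑ i, |v i| ^ q) ^ (1 / q)

/-- The mixed norm `‖M‖_{2,q}`: the `ℓ^q` norm, over the phases, of the Euclidean norms of the
tensors `M(p, ·, ·, ·)`. -/
def mixedNorm {n m W k : ℕ} (q : ℝ) (M : Fin W → Fin k → Matrix (Fin m) (Fin n) ℝ) : ℝ :=
  lqNorm q (fun p => √(∑ h, ∑ i, ∑ j, M p h i j ^ 2))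

/-- The squared Frobenius norm of a real matrix. -/
def frobSq {a b : ℕ} (X : Matrix (Fin a) (Fin b) ℝ) : ℝ := ∑ i, ∑ j, X i j ^ 2

/-- The exponent `ln N / (ln N - 1)`; it is larger than `1` for `N ≥ 3`. -/
def expo (N : ℕ) : ℝ := Real.log N / (Real.log N - 1)

/-- The regularizer `‖M‖²_{2,q} + ‖N‖²_{2,q} + ‖β‖²_{q'} + ∑_j ‖P_j‖²_F`. -/
def PseudoLDS.reg {n m W k L : ℕ} (Q : PseudoLDS n m W k L) : ℝ :=
  mixedNorm (expo W) Q.M ^ 2 + mixedNorm (expo W) Q.N ^ 2 + lqNorm (expo L) Q.β ^ 2 +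
    ∑ j, frobSq (Q.P j)

/-- The composite norm `‖M‖_{2,1} + ‖N‖_{2,1} + ‖β‖₁ + (∑_j ‖P_j‖²_F)^{1/2}`. -/
def PseudoLDS.compNorm {n m W k L : ℕ} (Q : PseudoLDS n m W k L) : ℝ :=
  mixedNorm 1 Q.M + mixedNorm 1 Q.N + lqNorm 1 Q.β + √(∑ j, frobSq (Q.P j))

/-- The decision set: the ball of radius `ρ` in the composite norm. -/
def decisionSet (n m W k L : ℕ) (ρ : ℝ) : Set (PseudoLDS n m W k L) :=
  {Q | Q.compNorm ≤ ρ}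

/-- The squared loss of a pseudo-LDS at time `t`. -/
def PseudoLDS.loss {n m W k L T : ℕ} (hk : k ≤ T) (σ : Fin T → ℝ) (φ : Fin T → Fin T → ℝ)
    (x : ℕ → EuclideanSpace ℝ (Fin n)) (y : ℕ → EuclideanSpace ℝ (Fin m)) (t : ℕ)
    (Q : PseudoLDS n m W k L) : ℝ :=
  ‖Q.predict hk σ φ x y t - y t‖ ^ 2

/-- `Q 1, …, Q T` is a run of the follow-the-regularized-leader algorithm over the decision set:
`Q 1` is an arbitrary element, and `Q (t + 1)` minimizes the sum of the losses up to time `t`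
plus `1 / η` times the regularizer. -/
def IsFTRLRun {n m W k L T : ℕ} (hk : k ≤ T) (σ : Fin T → ℝ) (φ : Fin T → Fin T → ℝ)
    (ρ η : ℝ) (x : ℕ → EuclideanSpace ℝ (Fin n)) (y : ℕ → EuclideanSpace ℝ (Fin m))
    (Q : ℕ → PseudoLDS n m W k L) : Prop :=
  Q 1 ∈ decisionSet n m W k L ρ ∧
  ∀ t, 1 ≤ t → t < T → Q (t + 1) ∈ decisionSet n m W k L ρ ∧
    IsMinOn (fun Q' => ∑ u ∈ Finset.Icc 1 t, Q'.loss hk σ φ x y u + Q'.reg / η)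
      (decisionSet n m W k L ρ) (Q (t + 1))

end SpectralFiltering

end

namespace SpectralFiltering

open Finset

/-! ### Two-uniform convexity of the mixed norms -/

/-! Predictions are linear in the parameters and the losses are squares. It therefore suffices to
represent every admissible system in a small ball of the composite norm, to bound predictions by
that norm, and to use a regularizer that is strongly convex with respect to it up to logarithms.

Representation (`LDS.Obeys.exists_pseudoLDS`). Diagonalization writes the responses `C A^i B` as
sums over eigenvalues `z = r ω` of `z^i` times rank-one matrices. Autoregression with a monic
polynomial `g` vanishing at all phases replaces `z^v` by `z^v g(z)`. Since `g(ω) = 0`, the factor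
`g(r ω)` is of order `1 - r`, so a mode becomes a bounded multiple of `ω^v (1 - r) r^(v-1)`. Two
bounds that do not depend on `T` finish the argument. The powers `ω^v`, `v ≤ T`, are combinations of
equidistant phases with bounded `ℓ¹` norm (`exists_phase_combination`, a de la Vallée Poussin
kernel). The real filter, expanded in the Hankel eigenbasis with weights `σ^(1/4)`, has coordinates
of norm at most 10 (`norm_filterCoord_decay_le`). All `T` filters are kept, so the representation is
exact.

The Hankel matrix `Z` is the Gram matrix of the filters in `L²(0,1)`. The coordinate bound
interpolates: `⟨w, Z^(-1/2) w⟩²` is at most `‖w‖² ⟨w, Z⁻¹ w⟩`, applied to differences of averages of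
filters over shrinking intervals of eigenvalues. Conversely, `Z² ≤ D⁴`-type bounds are not needed:
`Z ≤ diag(1/u²)` and monotonicity of the square root give `Z^(1/2) ≤ diag(1/u)`, so the filtered
inputs have squared size at most `(1 + ln T) Rx²` (`sum_sqrt_mul_sq_le`).

Regret (`ftrl_regret`). Two-uniform convexity of `ℓ^q` with Hilbert space values
(`lqNorm_sq_add_le`), at `q - 1` of order `1 / ln W`, makes the regularizer strongly convex, and at
this exponent the `ℓ^q` and `ℓ¹` norms agree up to a factor 3. Comparing two consecutive leaders
with their midpoint bounds the change of the current loss by a small multiple of that loss.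
Comparison with the zero predictor bounds the total loss by the energy of the outputs, so no
Lipschitz constant on the ball enters. The weight `η` then balances the remaining terms. -/

lemma two_le_rpow_add_rpow_of_nonpos {e x : ℝ} (he : e ≤ 0) (hx0 : 0 ≤ x) (hx1 : x < 1) :
    2 ≤ (1 + x) ^ e + (1 - x) ^ e := by
  have h1 : 0 < (1 + x) ^ e := Real.rpow_pos_of_pos (by linarith) _
  have h2 : 0 < (1 - x) ^ e := Real.rpow_pos_of_pos (by linarith) _
  -- The product is `(1 - x²)^e` with `e ≤ 0`; the claim follows by the arithmetic-geometric mean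
  -- inequality.
  have h3 : 1 ≤ (1 + x) ^ e * (1 - x) ^ e := by
    rw [← Real.mul_rpow (by linarith) (by linarith)]
    exact Real.one_le_rpow_of_pos_of_le_one_of_nonpos (by nlinarith) (by nlinarith) he
  nlinarith [sq_nonneg ((1 + x) ^ e - (1 - x) ^ e)]

/-- Both sides vanish at `x = 0`, and the derivatives compare by `two_le_rpow_add_rpow_of_nonpos`
with `e = s - 1`. -/
lemma two_mul_le_rpow_sub_rpow {s x : ℝ} (hs : 0 < s) (hs1 : s ≤ 1) (hx0 : 0 ≤ x) (hx1 : x ≤ 1) :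
    2 * s * x ≤ (1 + x) ^ s - (1 - x) ^ s := by
  have key : MonotoneOn (fun x : ℝ => (1 + x) ^ s - (1 - x) ^ s - 2 * s * x) (Set.Icc 0 1) := by
    have hd : ∀ y ∈ interior (Set.Icc (0 : ℝ) 1),
        HasDerivAt (fun x : ℝ => (1 + x) ^ s - (1 - x) ^ s - 2 * s * x)
          (1 * s * (1 + y) ^ (s - 1) - (-1) * s * (1 - y) ^ (s - 1) - 2 * s * 1) y := by
      intro y hy
      rw [interior_Icc] at hy
      exact ((((hasDerivAt_id y).const_add 1).rpow_const (Or.inl (by simp; linarith [hy.1]))).sub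
        (((hasDerivAt_id y).const_sub 1).rpow_const (Or.inl (by simp; linarith [hy.2])))).sub
        ((hasDerivAt_id y).const_mul (2 * s))
    refine monotoneOn_of_deriv_nonneg (convex_Icc 0 1) ?_
      (fun y hy => (hd y hy).differentiableAt.differentiableWithinAt) ?_
    · refine ContinuousOn.sub (ContinuousOn.sub ?_ ?_) (by fun_prop)
      · exact ContinuousOn.rpow_const (by fun_prop) (fun _ _ => Or.inr hs.le)
      · exact ContinuousOn.rpow_const (by fun_prop) (fun _ _ => Or.inr hs.le)
    · intro y hy
      rw [(hd y hy).deriv]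
      rw [interior_Icc] at hy
      nlinarith [two_le_rpow_add_rpow_of_nonpos (e := s - 1) (by linarith) hy.1.le hy.2]
  have := key (Set.left_mem_Icc.2 zero_le_one) ⟨hx0, hx1⟩ hx0
  norm_num at this
  linarith

/-- One integration further: the derivatives compare by `two_mul_le_rpow_sub_rpow` with `s = q - 1`.
-/
lemma two_add_mul_sq_le_rpow_add_rpow {q x : ℝ} (hq : 1 < q) (hq2 : q ≤ 2) (hx0 : 0 ≤ x)
    (hx1 : x ≤ 1) : 2 + q * (q - 1) * x ^ 2 ≤ (1 + x) ^ q + (1 - x) ^ q := by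
  have key : MonotoneOn (fun x : ℝ => (1 + x) ^ q + (1 - x) ^ q - q * (q - 1) * x ^ 2)
      (Set.Icc 0 1) := by
    have hd : ∀ y : ℝ,
        HasDerivAt (fun x : ℝ => (1 + x) ^ q + (1 - x) ^ q - q * (q - 1) * x ^ 2)
          (1 * q * (1 + y) ^ (q - 1) + (-1) * q * (1 - y) ^ (q - 1) -
            q * (q - 1) * ((2 : ℕ) * y ^ (2 - 1) * 1)) y := by
      intro y
      exact ((((hasDerivAt_id y).const_add 1).rpow_const (Or.inr hq.le)).add
        (((hasDerivAt_id y).const_sub 1).rpow_const (Or.inr hq.le))).sub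
        (((hasDerivAt_id y).pow 2).const_mul (q * (q - 1)))
    refine monotoneOn_of_deriv_nonneg (convex_Icc 0 1)
      (fun y _ => (hd y).continuousAt.continuousWithinAt)
      (fun y _ => (hd y).differentiableAt.differentiableWithinAt) ?_
    intro y hy
    rw [(hd y).deriv]
    rw [interior_Icc] at hy
    have := two_mul_le_rpow_sub_rpow (s := q - 1) (by linarith) (by linarith) hy.1.le hy.2.le
    norm_num
    nlinarith
  have := key (Set.left_mem_Icc.2 zero_le_one) ⟨hx0, hx1⟩ hx0
  norm_num at this
  linarith

/-- Bernoulli's inequality for the exponent `q / 2 ≤ 1` linearizes the left side, leaving half of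
the preceding bound. -/
lemma rpow_one_add_sq_le {q x : ℝ} (hq : 1 < q) (hq2 : q ≤ 2) (hx0 : 0 ≤ x) (hx1 : x ≤ 1) :
    (1 + (q - 1) * x ^ 2) ^ (q / 2) ≤ ((1 + x) ^ q + (1 - x) ^ q) / 2 := by
  have h1 := rpow_one_add_le_one_add_mul_self (s := (q - 1) * x ^ 2)
    (by nlinarith [sq_nonneg x]) (p := q / 2) (by linarith) (by linarith)
  have h2 := two_add_mul_sq_le_rpow_add_rpow hq hq2 hx0 hx1
  linarith

lemma rpow_sq_add_sq_le_of_le {q a b : ℝ} (hq : 1 < q) (hq2 : q ≤ 2) (hb : 0 ≤ b) (hab : b ≤ a) :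
    (a ^ 2 + (q - 1) * b ^ 2) ^ (q / 2) ≤ ((a + b) ^ q + (a - b) ^ q) / 2 := by
  rcases (hb.trans hab).eq_or_lt with h | ha
  · obtain rfl : b = 0 := by linarith
    subst h
    simp [Real.zero_rpow (by linarith : q / 2 ≠ 0), Real.zero_rpow (by linarith : q ≠ 0)]
  have h := rpow_one_add_sq_le hq hq2 (div_nonneg hb ha.le) ((div_le_one ha).2 hab)
  have e1 : a ^ 2 + (q - 1) * b ^ 2 = a ^ 2 * (1 + (q - 1) * (b / a) ^ 2) := by
    field_simp
  have e2 : a + b = a * (1 + b / a) := by field_simp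
  have e3 : a - b = a * (1 - b / a) := by field_simp
  have hx1 : b / a ≤ 1 := (div_le_one ha).2 hab
  have hx0 : 0 ≤ b / a := div_nonneg hb ha.le
  rw [e1, e2, e3, Real.mul_rpow (by positivity) (by nlinarith [sq_nonneg (b / a)]),
    Real.mul_rpow ha.le (by linarith), Real.mul_rpow ha.le (by linarith), ← Real.rpow_natCast,
    ← Real.rpow_mul ha.le]
  have e4 : ((2 : ℕ) : ℝ) * (q / 2) = q := by push_cast; ring
  rw [e4]
  have := Real.rpow_nonneg ha.le q
  nlinarith

/-- For `a < b`, exchanging `a` and `b` only increases the left side, because `(2 - q) (b² - a²) ≥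
0`. -/
lemma rpow_sq_add_sq_le {q a b : ℝ} (hq : 1 < q) (hq2 : q ≤ 2) (ha : 0 ≤ a) (hb : 0 ≤ b) :
    (a ^ 2 + (q - 1) * b ^ 2) ^ (q / 2) ≤ ((a + b) ^ q + |a - b| ^ q) / 2 := by
  rcases le_total b a with h | h
  · rw [abs_of_nonneg (sub_nonneg.2 h)]
    exact rpow_sq_add_sq_le_of_le hq hq2 hb h
  · rw [abs_of_nonpos (sub_nonpos.2 h), neg_sub, add_comm a b]
    refine le_trans ?_ (rpow_sq_add_sq_le_of_le hq hq2 ha h)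
    refine Real.rpow_le_rpow (by nlinarith [sq_nonneg a, sq_nonneg b]) ?_ (by linarith)
    nlinarith [mul_nonneg (by linarith : 0 ≤ 2 - q) (by nlinarith : 0 ≤ b ^ 2 - a ^ 2)]

/-- Concavity of `x ↦ x ^ s`: symmetric sums decrease with the spread. -/
lemma rpow_add_rpow_anti {s c x y : ℝ} (hs0 : 0 ≤ s) (hs1 : s ≤ 1) (hx : |x| ≤ y) (hy : y ≤ c) :
    (c + y) ^ s + (c - y) ^ s ≤ (c + x) ^ s + (c - x) ^ s := by
  obtain ⟨hx1, hx2⟩ := abs_le.1 hx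
  rcases (by linarith : (0 : ℝ) ≤ y).eq_or_lt with h | hy0
  · have : x = 0 := by linarith
    simp [this, ← h]
  have hc := Real.concaveOn_rpow hs0 hs1
  have m1 : c + y ∈ Set.Ici (0 : ℝ) := by simp; linarith
  have m2 : c - y ∈ Set.Ici (0 : ℝ) := by simp; linarith
  have w1 : 0 ≤ (y + x) / (2 * y) := div_nonneg (by linarith) (by linarith)
  have w2 : 0 ≤ (y - x) / (2 * y) := div_nonneg (by linarith) (by linarith)
  have ws : (y + x) / (2 * y) + (y - x) / (2 * y) = 1 := by field_simp; ring
  have h1 := hc.2 m1 m2 w1 w2 ws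
  have h2 := hc.2 m2 m1 w1 w2 ws
  simp only [smul_eq_mul] at h1 h2
  have e1 : (y + x) / (2 * y) * (c + y) + (y - x) / (2 * y) * (c - y) = c + x := by
    field_simp; ring
  have e2 : (y + x) / (2 * y) * (c - y) + (y - x) / (2 * y) * (c + y) = c - x := by
    field_simp; ring
  rw [e1] at h1
  rw [e2] at h2
  have e3 : (y - x) / (2 * y) = 1 - (y + x) / (2 * y) := by linarith
  rw [e3] at h1 h2
  linarith

lemma norm_rpow_eq {E : Type*} [NormedAddCommGroup E] (v : E) (q : ℝ) :
    ‖v‖ ^ q = (‖v‖ ^ 2) ^ (q / 2) := by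
  rw [← Real.rpow_natCast, ← Real.rpow_mul (norm_nonneg v)]
  congr 1
  push_cast
  ring

/-- For fixed norms, the right side depends only on the inner product and, by concavity of `z ↦
z^(q/2)`, is smallest for parallel vectors. This reduces the claim to real numbers. -/
lemma rpow_norm_sq_add_norm_sq_le {E : Type*} [NormedAddCommGroup E] [InnerProductSpace ℝ E]
    {q : ℝ} (hq : 1 < q) (hq2 : q ≤ 2) (a b : E) :
    (‖a‖ ^ 2 + (q - 1) * ‖b‖ ^ 2) ^ (q / 2) ≤ (‖a + b‖ ^ q + ‖a - b‖ ^ q) / 2 := by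
  refine (rpow_sq_add_sq_le hq hq2 (norm_nonneg a) (norm_nonneg b)).trans ?_
  have h := rpow_add_rpow_anti (s := q / 2) (c := ‖a‖ ^ 2 + ‖b‖ ^ 2) (x := 2 * inner ℝ a b)
    (y := 2 * (‖a‖ * ‖b‖)) (by linarith) (by linarith)
    (by rw [abs_mul, abs_two]; linarith [abs_real_inner_le_norm a b])
    (by nlinarith [sq_nonneg (‖a‖ - ‖b‖)])
  rw [norm_rpow_eq (a + b), norm_rpow_eq (a - b), norm_add_sq_real, norm_sub_sq_real]
  have e1 : (‖a‖ + ‖b‖) ^ q = (‖a‖ ^ 2 + ‖b‖ ^ 2 + 2 * (‖a‖ * ‖b‖)) ^ (q / 2) := by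
    have := norm_rpow_eq (‖a‖ + ‖b‖) q
    rw [Real.norm_of_nonneg (by positivity)] at this
    rw [this]
    congr 1
    ring
  have e2 : |‖a‖ - ‖b‖| ^ q = (‖a‖ ^ 2 + ‖b‖ ^ 2 - 2 * (‖a‖ * ‖b‖)) ^ (q / 2) := by
    have := norm_rpow_eq (‖a‖ - ‖b‖) q
    rw [Real.norm_eq_abs] at this
    rw [this, sq_abs]
    congr 1
    ring
  rw [e1, e2]
  have e3 : ‖a‖ ^ 2 + 2 * inner ℝ a b + ‖b‖ ^ 2 = ‖a‖ ^ 2 + ‖b‖ ^ 2 + 2 * inner ℝ a b := by ring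
  have e4 : ‖a‖ ^ 2 - 2 * inner ℝ a b + ‖b‖ ^ 2 = ‖a‖ ^ 2 + ‖b‖ ^ 2 - 2 * inner ℝ a b := by ring
  rw [e3, e4]
  linarith

/-- The reverse Minkowski inequality, for two vectors and the exponent `1 / p ≤ 1`. -/
lemma rpow_sum_add_rpow_sum_le {ι : Type*} (S : Finset ι) {p : ℝ} (hp : 1 ≤ p) (s t : ι → ℝ)
    (hs : ∀ i, 0 ≤ s i) (ht : ∀ i, 0 ≤ t i) :
    (∑ i ∈ S, s i ^ (1 / p)) ^ p + (∑ i ∈ S, t i ^ (1 / p)) ^ p ≤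
      (∑ i ∈ S, (s i + t i) ^ (1 / p)) ^ p := by
  classical
  have hp0 : 0 < p := by linarith
  have hpp : ∀ z : ℝ, 0 ≤ z → (z ^ (1 / p)) ^ p = z := fun z hz => by
    rw [← Real.rpow_mul hz, one_div_mul_cancel hp0.ne', Real.rpow_one]
  induction S using Finset.induction_on with
  | empty => simp [Real.zero_rpow hp0.ne']
  | insert i S hi ih =>
    rw [sum_insert hi, sum_insert hi, sum_insert hi]
    have hX : 0 ≤ ∑ i ∈ S, s i ^ (1 / p) := sum_nonneg fun i _ => Real.rpow_nonneg (hs i) _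
    have hY : 0 ≤ ∑ i ∈ S, t i ^ (1 / p) := sum_nonneg fun i _ => Real.rpow_nonneg (ht i) _
    have hU : 0 ≤ ∑ i ∈ S, (s i + t i) ^ (1 / p) :=
      sum_nonneg fun i _ => Real.rpow_nonneg (add_nonneg (hs i) (ht i)) _
    have hx := Real.rpow_nonneg (hs i) (1 / p)
    have hy := Real.rpow_nonneg (ht i) (1 / p)
    -- Ordinary Minkowski in the plane, for the vector of new terms and the vector of partial sums.
    have M := Real.Lp_add_le_of_nonneg (s := (univ : Finset (Fin 2)))
      (f := ![s i ^ (1 / p), t i ^ (1 / p)])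
      (g := ![∑ i ∈ S, s i ^ (1 / p), ∑ i ∈ S, t i ^ (1 / p)]) hp
      (by intro j _; fin_cases j; exacts [hx, hy])
      (by intro j _; fin_cases j; exacts [hX, hY])
    simp only [Fin.sum_univ_two, Matrix.cons_val_zero, Matrix.cons_val_one, hpp _ (hs i),
      hpp _ (ht i)] at M
    have hZ : ((∑ i ∈ S, s i ^ (1 / p)) ^ p + (∑ i ∈ S, t i ^ (1 / p)) ^ p) ^ (1 / p) ≤
        ∑ i ∈ S, (s i + t i) ^ (1 / p) := by
      refine (Real.rpow_le_rpow (by positivity) ih (by positivity)).trans_eq ?_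
      rw [← Real.rpow_mul hU, mul_one_div_cancel hp0.ne', Real.rpow_one]
    have h := Real.rpow_le_rpow (Real.rpow_nonneg (by positivity) _) (M.trans (add_le_add_right hZ _))
      hp0.le
    rwa [hpp _ (by positivity)] at h

lemma lqNorm_nonneg {ι : Type*} [Fintype ι] (q : ℝ) (v : ι → ℝ) : 0 ≤ lqNorm q v :=
  Real.rpow_nonneg (sum_nonneg fun _ _ => Real.rpow_nonneg (abs_nonneg _) _) _

lemma lqNorm_sq_eq {ι : Type*} [Fintype ι] {q : ℝ} (v : ι → ℝ) :
    lqNorm q v ^ 2 = (∑ i, |v i| ^ q) ^ (2 / q) := by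
  rw [lqNorm, ← Real.rpow_natCast, ← Real.rpow_mul
    (sum_nonneg fun _ _ => Real.rpow_nonneg (abs_nonneg _) _)]
  congr 1
  push_cast
  ring

/-- Two-uniform convexity of `ℓ^q(E)` for a Hilbert space `E` and `1 < q ≤ 2`
(Ball, Carlen and Lieb). -/
lemma lqNorm_sq_add_le {ι E : Type*} [Fintype ι] [NormedAddCommGroup E] [InnerProductSpace ℝ E]
    {q : ℝ} (hq : 1 < q) (hq2 : q ≤ 2) (a b : ι → E) :
    lqNorm q (fun i => ‖a i‖) ^ 2 + (q - 1) * lqNorm q (fun i => ‖b i‖) ^ 2 ≤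
      (lqNorm q (fun i => ‖a i + b i‖) ^ 2 + lqNorm q (fun i => ‖a i - b i‖) ^ 2) / 2 := by
  have hq0 : 0 < q := by linarith
  have hp : 1 ≤ 2 / q := by rw [le_div_iff₀ hq0]; linarith
  simp only [lqNorm_sq_eq, abs_norm]
  set X := ∑ i, ‖a i + b i‖ ^ q with hX
  set Y := ∑ i, ‖a i - b i‖ ^ q with hY
  have hX0 : 0 ≤ X := sum_nonneg fun _ _ => by positivity
  have hY0 : 0 ≤ Y := sum_nonneg fun _ _ => by positivity
  -- Convexity of `z^(2/q)` merges the two norms into one power. The pointwise inequality then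
  -- bounds its base from below, and reverse Minkowski with `p = 2 / q` separates `a` from `b`.
  have h1 : ((X + Y) / 2) ^ (2 / q) ≤ (X ^ (2 / q) + Y ^ (2 / q)) / 2 := by
    have := (convexOn_rpow hp).2 (Set.mem_Ici.2 hX0) (Set.mem_Ici.2 hY0)
      (by norm_num : (0 : ℝ) ≤ 1 / 2) (by norm_num : (0 : ℝ) ≤ 1 / 2) (by norm_num)
    simp only [smul_eq_mul] at this
    calc ((X + Y) / 2) ^ (2 / q) = (1 / 2 * X + 1 / 2 * Y) ^ (2 / q) := by congr 1; ring
      _ ≤ _ := this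
      _ = _ := by ring
  refine le_trans ?_ h1
  have h2 : ∑ i, (‖a i‖ ^ 2 + (q - 1) * ‖b i‖ ^ 2) ^ (q / 2) ≤ (X + Y) / 2 := by
    rw [hX, hY, ← sum_add_distrib, sum_div]
    exact sum_le_sum fun i _ => rpow_norm_sq_add_norm_sq_le hq hq2 (a i) (b i)
  have hn : ∀ i, 0 ≤ (q - 1) * ‖b i‖ ^ 2 := fun i =>
    mul_nonneg (by linarith) (sq_nonneg _)
  refine le_trans ?_ (Real.rpow_le_rpow (sum_nonneg fun i _ => Real.rpow_nonneg
    (add_nonneg (sq_nonneg _) (hn i)) _) h2 (by positivity))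
  have h3 := rpow_sum_add_rpow_sum_le univ hp (fun i => ‖a i‖ ^ 2) (fun i => (q - 1) * ‖b i‖ ^ 2)
    (fun i => sq_nonneg _) hn
  rw [one_div_div] at h3
  refine le_trans (le_of_eq ?_) h3
  congr 1
  · congr 1
    exact sum_congr rfl fun i _ => norm_rpow_eq _ _
  · have : ∀ i, ((q - 1) * ‖b i‖ ^ 2) ^ (q / 2) = (q - 1) ^ (q / 2) * ‖b i‖ ^ q := fun i => by
      rw [Real.mul_rpow (by linarith) (sq_nonneg _), ← norm_rpow_eq]
    simp only [this]
    rw [← mul_sum, Real.mul_rpow (Real.rpow_nonneg (by linarith) _)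
      (sum_nonneg fun _ _ => by positivity), ← Real.rpow_mul (by linarith)]
    have : q / 2 * (2 / q) = 1 := by field_simp
    rw [this, Real.rpow_one]

/-! ### Comparison of the `ℓ^q` and `ℓ¹` norms -/

lemma lqNorm_one {ι : Type*} [Fintype ι] (v : ι → ℝ) : lqNorm 1 v = ∑ i, |v i| := by
  simp [lqNorm]

lemma lqNorm_smul {ι : Type*} [Fintype ι] {q : ℝ} (hq : 0 < q) {c : ℝ} (hc : 0 ≤ c) (v : ι → ℝ) :
    lqNorm q (fun i => c * v i) = c * lqNorm q v := by
  have : ∀ i, |c * v i| ^ q = c ^ q * |v i| ^ q := fun i => by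
    rw [abs_mul, abs_of_nonneg hc, Real.mul_rpow hc (abs_nonneg _)]
  simp only [lqNorm, this]
  rw [← mul_sum, Real.mul_rpow (by positivity)
    (sum_nonneg fun _ _ => Real.rpow_nonneg (abs_nonneg _) _), ← Real.rpow_mul hc,
    mul_one_div_cancel hq.ne', Real.rpow_one]

lemma lqNorm_le_lqNorm_one {ι : Type*} [Fintype ι] {q : ℝ} (hq : 1 ≤ q) (v : ι → ℝ) :
    lqNorm q v ≤ lqNorm 1 v := by
  rw [lqNorm_one]
  set s := ∑ i, |v i| with hs
  have hs0 : 0 ≤ s := sum_nonneg fun _ _ => abs_nonneg _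
  have hq0 : 0 < q := by linarith
  have h : ∑ i, |v i| ^ q ≤ s ^ q := by
    calc ∑ i, |v i| ^ q = ∑ i, |v i| * |v i| ^ (q - 1) := by
          refine sum_congr rfl fun i _ => ?_
          rcases (abs_nonneg (v i)).eq_or_lt with h | h
          · rw [← h, Real.zero_rpow hq0.ne', zero_mul]
          · rw [Real.rpow_sub_one h.ne']
            field_simp
      _ ≤ ∑ i, |v i| * s ^ (q - 1) := by
          refine sum_le_sum fun i _ => mul_le_mul_of_nonneg_left ?_ (abs_nonneg _)
          exact Real.rpow_le_rpow (abs_nonneg _)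
            (single_le_sum (f := fun i => |v i|) (fun _ _ => abs_nonneg _) (mem_univ i))
            (by linarith)
      _ = s ^ q := by
          rw [← sum_mul, ← hs]
          rcases hs0.eq_or_lt with h | h
          · rw [← h, Real.zero_rpow hq0.ne', zero_mul]
          · rw [Real.rpow_sub_one h.ne']
            field_simp
  calc lqNorm q v ≤ (s ^ q) ^ (1 / q) :=
        Real.rpow_le_rpow (sum_nonneg fun _ _ => Real.rpow_nonneg (abs_nonneg _) _) h
          (by positivity)
    _ = s := by rw [← Real.rpow_mul hs0, mul_one_div_cancel hq0.ne', Real.rpow_one]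

lemma two_lt_log {N : ℕ} (hN : 8 ≤ N) : 2 < Real.log N := by
  have h8 : Real.log 8 = 3 * Real.log 2 := by
    rw [show (8 : ℝ) = 2 ^ 3 by norm_num, Real.log_pow]; norm_num
  have : Real.log 8 ≤ Real.log N := Real.log_le_log (by norm_num) (by exact_mod_cast hN)
  linarith [Real.log_two_gt_d9]

lemma one_lt_expo {N : ℕ} (hN : 8 ≤ N) : 1 < expo N := by
  have := two_lt_log hN
  rw [expo, lt_div_iff₀ (by linarith)]
  linarith

lemma expo_le_two {N : ℕ} (hN : 8 ≤ N) : expo N ≤ 2 := by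
  have := two_lt_log hN
  rw [expo, div_le_iff₀ (by linarith)]
  linarith

lemma one_div_log_le_expo_sub_one {N : ℕ} (hN : 8 ≤ N) : 1 / Real.log N ≤ expo N - 1 := by
  have := two_lt_log hN
  rw [expo, div_sub_one (by linarith), div_le_div_iff₀ (by linarith) (by linarith)]
  nlinarith

/-- The exponent conjugate to `expo N` is `ln N`, so Hölder's inequality costs the factor `N^(1 / ln
N) = e`. -/
lemma lqNorm_one_le {N : ℕ} (hN : 8 ≤ N) (v : Fin N → ℝ) :
    lqNorm 1 v ≤ 3 * lqNorm (expo N) v := by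
  have hlog := two_lt_log hN
  have hq := one_lt_expo hN
  have hc : (expo N).HolderConjugate (Real.log N) := by
    rw [Real.holderConjugate_iff]
    refine ⟨hq, ?_⟩
    rw [expo]
    field_simp
    ring
  have h := Real.inner_le_Lp_mul_Lq univ (fun i => |v i|) (fun _ => (1 : ℝ)) hc
  simp only [mul_one, abs_abs, abs_one, Real.one_rpow, sum_const, card_univ, Fintype.card_fin,
    nsmul_eq_mul] at h
  rw [lqNorm_one, lqNorm]
  have hN0 : (0 : ℝ) < N := by exact_mod_cast (by omega : 0 < N)
  have e : (N : ℝ) ^ (1 / Real.log N) ≤ 3 := by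
    rw [Real.rpow_def_of_pos hN0, mul_one_div_cancel (by linarith)]
    linarith [Real.exp_one_lt_d9]
  refine h.trans ?_
  rw [mul_comm]
  exact mul_le_mul_of_nonneg_right e
    (Real.rpow_nonneg (sum_nonneg fun _ _ => Real.rpow_nonneg (abs_nonneg _) _) _)

end SpectralFiltering

namespace SpectralFiltering

open Finset

/-! ### Follow the regularized leader for squared losses -/

/-- The leaders, shifted by one step, compete with every fixed point. -/
lemma be_the_leader {V : Type*} {K : Set V} {f : ℕ → V → ℝ} {reg : V → ℝ} (hreg : ∀ v, 0 ≤ reg v) {η : ℝ}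
    (hη : 0 < η) {Q : ℕ → V} (N : ℕ)
    (hQ : ∀ t, 1 ≤ t → t ≤ N → Q (t + 1) ∈ K ∧
      IsMinOn (fun v => ∑ u ∈ Icc 1 t, f u v + reg v / η) K (Q (t + 1))) {v : V} (hv : v ∈ K) :
    ∑ t ∈ Icc 1 N, f t (Q (t + 1)) ≤ ∑ t ∈ Icc 1 N, f t v + reg v / η := by
  induction N generalizing v with
  | zero => simpa using div_nonneg (hreg v) hη.le
  | succ N ih =>
    obtain ⟨h1, h2⟩ := hQ (N + 1) (by omega) le_rfl
    -- The competitor of the induction hypothesis is the newest leader, whose own minimality then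
    -- compares it with `v`.
    have h3 := ih (fun t ht htN => hQ t ht (by omega)) h1
    have h4 := isMinOn_iff.1 h2 v hv
    have e : ∀ w : ℕ → ℝ, ∑ t ∈ Icc 1 (N + 1), w t = ∑ t ∈ Icc 1 N, w t + w (N + 1) := fun w =>
      sum_Icc_succ_top (by omega) w
    rw [e, e]
    simp only [e] at h4
    linarith

section FTRL

variable {V F : Type*} [AddCommGroup V] [Module ℝ V] [NormedAddCommGroup F] [InnerProductSpace ℝ F]

lemma norm_sq_midpoint (a b : F) :
    ‖(1 / 2 : ℝ) • (a + b)‖ ^ 2 ≤ (‖a‖ ^ 2 + ‖b‖ ^ 2) / 2 := by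
  rw [norm_smul, mul_pow, norm_add_sq_real]
  norm_num
  nlinarith [norm_sub_sq_real a b, sq_nonneg ‖a - b‖]

lemma loss_midpoint (g : V →ₗ[ℝ] F) (y : F) (a b : V) :
    ‖g ((1 / 2 : ℝ) • (a + b)) - y‖ ^ 2 ≤ (‖g a - y‖ ^ 2 + ‖g b - y‖ ^ 2) / 2 := by
  have : g ((1 / 2 : ℝ) • (a + b)) - y = (1 / 2 : ℝ) • ((g a - y) + (g b - y)) := by
    rw [map_smul, map_add]
    module
  rw [this]
  exact norm_sq_midpoint _ _

/-- Consecutive leaders have nearly the same current loss. -/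
lemma leader_stability {K : Set V} (hK : ∀ a ∈ K, ∀ b ∈ K, (1 / 2 : ℝ) • (a + b) ∈ K)
    {g : ℕ → V →ₗ[ℝ] F} {y : ℕ → F} {reg : V → ℝ} {lam η : ℝ} (hlam : 0 < lam) (hη : 0 < η)
    {t : ℕ} {I : Finset ℕ} (ht : t ∉ I)
    (hreg : ∀ a b, reg ((1 / 2 : ℝ) • (a + b)) + lam * ‖g t (a - b)‖ ^ 2 ≤ (reg a + reg b) / 2)
    {a b : V} (ha : a ∈ K) (hb : b ∈ K)
    (hma : IsMinOn (fun v => ∑ u ∈ I, ‖g u v - y u‖ ^ 2 + reg v / η) K a)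
    (hmb : IsMinOn (fun v => ∑ u ∈ insert t I, ‖g u v - y u‖ ^ 2 + reg v / η) K b) :
    ‖g t a - y t‖ ^ 2 - ‖g t b - y t‖ ^ 2 ≤ η / lam * ‖g t a - y t‖ ^ 2 := by
  -- Both leaders are tested against their midpoint. In the sum of the two inequalities the losses
  -- in `I` cancel, and the curvature of the regularizer remains.
  have h1 := isMinOn_iff.1 hma _ (hK a ha b hb)
  have h2 := isMinOn_iff.1 hmb _ (hK a ha b hb)
  simp only [sum_insert ht] at h2
  have h3 := loss_midpoint (g t) (y t) a b
  have h4 : ∑ u ∈ I, ‖g u ((1 / 2 : ℝ) • (a + b)) - y u‖ ^ 2 ≤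
      (∑ u ∈ I, ‖g u a - y u‖ ^ 2 + ∑ u ∈ I, ‖g u b - y u‖ ^ 2) / 2 := by
    rw [← sum_add_distrib, sum_div]
    exact sum_le_sum fun u _ => loss_midpoint (g u) (y u) a b
  have h5 := div_le_div_of_nonneg_right (hreg a b) hη.le
  have e5 : (reg ((1 / 2 : ℝ) • (a + b)) + lam * ‖g t (a - b)‖ ^ 2) / η =
      reg ((1 / 2 : ℝ) • (a + b)) / η + lam / η * ‖g t (a - b)‖ ^ 2 := by ring
  have e6 : (reg a + reg b) / 2 / η = (reg a / η + reg b / η) / 2 := by ring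
  rw [e5, e6] at h5
  set z := ‖g t (a - b)‖ with hz
  set X := ‖g t a - y t‖ with hX
  set Y := ‖g t b - y t‖ with hY
  have hXY : X ≤ Y + z := by
    have : g t a - y t = (g t b - y t) + g t (a - b) := by rw [map_sub]; abel
    rw [hX, this]
    exact norm_add_le _ _
  have hz0 : 0 ≤ z := norm_nonneg _
  have hX0 : 0 ≤ X := norm_nonneg _
  have hY0 : 0 ≤ Y := norm_nonneg _
  have k1 : 4 * (lam / η) * z ^ 2 ≤ X ^ 2 - Y ^ 2 := by linarith
  have k2 : X ^ 2 - Y ^ 2 ≤ 2 * X * z := by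
    rcases le_total X Y with h | h
    · nlinarith [mul_nonneg hX0 hz0]
    · nlinarith
  have hr : 0 < lam / η := div_pos hlam hη
  -- Young's inequality, weighted so that its `z²` term is half the left side of `k1` and can be
  -- absorbed.
  have k3 : 2 * X * z ≤ η / lam * X ^ 2 / 2 + 2 * (lam / η) * z ^ 2 := by
    have : 0 ≤ η / lam * (X - 2 * (lam / η) * z) ^ 2 / 2 := by positivity
    have e : η / lam * (X - 2 * (lam / η) * z) ^ 2 / 2 =
      η / lam * X ^ 2 / 2 + 2 * (lam / η) * z ^ 2 - 2 * X * z := by field_simp; ring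
    linarith
  linarith

/-- The regret of follow the regularized leader, where `b` bounds the losses. -/
lemma ftrl_regret {K : Set V} (hK : ∀ a ∈ K, ∀ b ∈ K, (1 / 2 : ℝ) • (a + b) ∈ K) (h0 : 0 ∈ K)
    {T : ℕ} (hT : 2 ≤ T) {g : ℕ → V →ₗ[ℝ] F} {y : ℕ → F} {reg : V → ℝ} (hreg0 : ∀ v, 0 ≤ reg v)
    (hregz : reg 0 = 0) {lam η b Ry D : ℝ} (hlam : 0 < lam) (hη : 0 < η) (hηl : η / lam ≤ 1 / 2)
    (hreg : ∀ t, 1 ≤ t → t ≤ T → ∀ a b,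
      reg ((1 / 2 : ℝ) • (a + b)) + lam * ‖g t (a - b)‖ ^ 2 ≤ (reg a + reg b) / 2)
    (hy : ∀ t, 1 ≤ t → t ≤ T → ‖y t‖ ≤ Ry)
    (hb : ∀ t, 1 ≤ t → t ≤ T → ∀ v ∈ K, ‖g t v - y t‖ ^ 2 ≤ b)
    (hD : ∀ v ∈ K, reg v ≤ D)
    {Q : ℕ → V} (hQ1 : Q 1 ∈ K)
    (hQ : ∀ t, 1 ≤ t → t < T → Q (t + 1) ∈ K ∧
      IsMinOn (fun v => ∑ u ∈ Icc 1 t, ‖g u v - y u‖ ^ 2 + reg v / η) K (Q (t + 1)))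
    {v : V} (hv : v ∈ K) :
    ∑ t ∈ Icc 1 T, ‖g t (Q t) - y t‖ ^ 2 - ∑ t ∈ Icc 1 T, ‖g t v - y t‖ ^ 2 ≤
      4 * b + 2 * (η / lam) * (T * Ry ^ 2) + D / η := by
  obtain ⟨N, rfl⟩ : ∃ N, T = N + 2 := ⟨T - 2, by omega⟩
  set ε := η / lam with hε
  have hε0 : 0 < ε := div_pos hη hlam
  have hQK : ∀ t, 1 ≤ t → t ≤ N + 2 → Q t ∈ K := by
    intro t h1 h2
    rcases h1.eq_or_lt with h | h
    · rwa [← h]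
    · obtain ⟨s, rfl⟩ : ∃ s, t = s + 1 := ⟨t - 1, by omega⟩
      exact (hQ s (by omega) (by omega)).1
  set S := ∑ t ∈ Icc 1 (N + 2), ‖g t (Q t) - y t‖ ^ 2 with hS
  have hbt : ∀ w ∈ K, ∑ t ∈ Icc 1 (N + 1), ‖g t (Q (t + 1)) - y t‖ ^ 2 ≤
      ∑ t ∈ Icc 1 (N + 2), ‖g t w - y t‖ ^ 2 + reg w / η := by
    intro w hw
    refine (be_the_leader (K := K) (f := fun t v => ‖g t v - y t‖ ^ 2) hreg0 hη (N + 1)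
      (fun t h1 h2 => hQ t h1 (by omega)) hw).trans ?_
    rw [sum_Icc_succ_top (b := N + 1) (by omega)]
    have := sq_nonneg ‖g (N + 1 + 1) w - y (N + 1 + 1)‖
    linarith
  -- The first iterate is arbitrary rather than a leader, so round 1 is paid for with `b`. The final
  -- round, which has no successor, costs another `b` below.
  have hstab : ∀ t ∈ Icc 1 (N + 1), ‖g t (Q t) - y t‖ ^ 2 ≤
      ‖g t (Q (t + 1)) - y t‖ ^ 2 + ε * ‖g t (Q t) - y t‖ ^ 2 + if t = 1 then b else 0 := by
    intro t ht
    obtain ⟨h1, h2⟩ := mem_Icc.1 ht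
    rcases h1.eq_or_lt with h | h
    · subst h
      have := hb 1 le_rfl (by omega) _ hQ1
      rw [if_pos rfl]
      have k1 := sq_nonneg ‖g 1 (Q (1 + 1)) - y 1‖
      have k2 := mul_nonneg hε0.le (sq_nonneg ‖g 1 (Q 1) - y 1‖)
      linarith
    · obtain ⟨s, rfl⟩ : ∃ s, t = s + 1 := ⟨t - 1, by omega⟩
      rw [if_neg (by omega), add_zero]
      obtain ⟨ha, hma⟩ := hQ s (by omega) (by omega)
      obtain ⟨hb', hmb⟩ := hQ (s + 1) (by omega) (by omega)
      have hI : Icc 1 (s + 1) = insert (s + 1) (Icc 1 s) := by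
        ext u; simp only [mem_Icc, mem_insert]; omega
      rw [hI] at hmb
      have := leader_stability hK hlam hη (t := s + 1) (I := Icc 1 s) (by simp)
        (hreg (s + 1) (by omega) (by omega)) ha hb' hma hmb
      linarith
  have hb0 : 0 ≤ b := (sq_nonneg _).trans (hb 1 le_rfl (by omega) 0 h0)
  have hsum := sum_le_sum hstab
  rw [sum_add_distrib, sum_add_distrib, ← mul_sum, sum_ite_eq' (Icc 1 (N + 1)) 1 (fun _ => b),
    if_pos (by simp)] at hsum
  have hlast := hb (N + 2) (by omega) le_rfl _ (hQK (N + 2) (by omega) le_rfl)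
  have hSe : S = ∑ t ∈ Icc 1 (N + 1), ‖g t (Q t) - y t‖ ^ 2 +
      ‖g (N + 2) (Q (N + 2)) - y (N + 2)‖ ^ 2 := sum_Icc_succ_top (by omega) _
  have hεl := mul_nonneg hε0.le (sq_nonneg ‖g (N + 2) (Q (N + 2)) - y (N + 2)‖)
  have hmain : ∀ w ∈ K, S ≤ ∑ t ∈ Icc 1 (N + 2), ‖g t w - y t‖ ^ 2 + reg w / η + ε * S + 2 * b := by
    intro w hw
    have := hbt w hw
    rw [hSe, mul_add]
    linarith
  have hz : ∑ t ∈ Icc 1 (N + 2), ‖g t 0 - y t‖ ^ 2 ≤ ((N + 2 : ℕ) : ℝ) * Ry ^ 2 := by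
    refine (sum_le_card_nsmul _ _ (Ry ^ 2) fun t ht => ?_).trans_eq (by simp)
    rw [map_zero, zero_sub, norm_neg]
    exact pow_le_pow_left₀ (norm_nonneg _) (hy t (mem_Icc.1 ht).1 (mem_Icc.1 ht).2) 2
  have m0 := hmain 0 h0
  rw [hregz, zero_div, add_zero] at m0
  have hS0 : 0 ≤ S := sum_nonneg fun _ _ => sq_nonneg _
  -- Self-bounding: the regret against zero, together with `ε ≤ 1/2`, controls the total loss that
  -- occurs in the stability term.
  have hS1 : S ≤ 2 * (((N + 2 : ℕ) : ℝ) * Ry ^ 2) + 4 * b := by nlinarith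
  have m1 := hmain v hv
  have m2 := div_le_div_of_nonneg_right (hD v hv) hη.le
  have m3 := mul_le_mul_of_nonneg_left hS1 hε0.le
  nlinarith

end FTRL

end SpectralFiltering

namespace SpectralFiltering

open Finset

/-! ### The Hankel matrix -/

/-- The entries `(1 - α) α ^ u` of the filter of a real eigenvalue `α`. -/
noncomputable def decay (α : ℝ) (u : ℕ) : ℝ := (1 - α) * α ^ u

lemma continuous_decay (u : ℕ) : Continuous fun α => decay α u := by
  unfold decay
  fun_prop

/-- These are Beta integrals, equal to `2 / ((n+1)(n+2)(n+3))` with `n = i + j` for indices from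
zero. The matrix is thus a Gram matrix in `L²(0,1)`. -/
lemma hankel_eq_integral (T : ℕ) (i j : Fin T) :
    hankel T i j = ∫ α in (0 : ℝ)..1, decay α i * decay α j := by
  have e : ∀ α : ℝ, decay α i * decay α j =
      α ^ ((i : ℕ) + j) - 2 * α ^ ((i : ℕ) + j + 1) + α ^ ((i : ℕ) + j + 2) := fun α => by
    unfold decay
    ring
  simp only [e]
  rw [intervalIntegral.integral_add, intervalIntegral.integral_sub,
    intervalIntegral.integral_const_mul, integral_pow, integral_pow, integral_pow]
  · simp only [hankel]
    push_cast
    set n : ℝ := (i : ℕ) + (j : ℕ) with hn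
    have hn0 : 0 ≤ n := by positivity
    have e1 : ((i : ℕ) + 1 + ((j : ℕ) + 1) : ℝ) = n + 2 := by rw [hn]; ring
    rw [e1]
    have : (n + 2) ^ 3 - (n + 2) = (n + 1) * (n + 2) * (n + 3) := by ring
    rw [this]
    have h1 : n + 1 ≠ 0 := by linarith
    have h2 : n + 1 + 1 ≠ 0 := by linarith
    have h3 : n + 2 + 1 ≠ 0 := by linarith
    have h4 : n + 2 ≠ 0 := by linarith
    have h5 : n + 3 ≠ 0 := by linarith
    simp only [one_pow, zero_pow (Nat.succ_ne_zero _)]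
    field_simp
    ring
  all_goals exact Continuous.intervalIntegrable (by fun_prop) _ _

/-- The quadratic form of the Hankel matrix. -/
noncomputable def hankelForm (T : ℕ) (c : Fin T → ℝ) : ℝ := ∑ i, ∑ j, hankel T i j * (c i * c j)

lemma continuous_sum_decay {T : ℕ} (c : Fin T → ℝ) :
    Continuous fun α => ∑ u : Fin T, c u * decay α u :=
  continuous_finsetSum _ fun u _ => continuous_const.mul (continuous_decay u)

lemma hankelForm_eq_integral {T : ℕ} (c : Fin T → ℝ) :
    hankelForm T c = ∫ α in (0 : ℝ)..1, (∑ u : Fin T, c u * decay α u) ^ 2 := by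
  have e : ∀ α : ℝ, (∑ u : Fin T, c u * decay α u) ^ 2 =
      ∑ i : Fin T, ∑ j : Fin T, c i * c j * (decay α i * decay α j) := fun α => by
    rw [sq, sum_mul_sum]
    exact sum_congr rfl fun i _ => sum_congr rfl fun j _ => by ring
  have hc : ∀ i j : Fin T, Continuous fun α => c i * c j * (decay α i * decay α j) := fun i j =>
    continuous_const.mul ((continuous_decay i).mul (continuous_decay j))
  simp only [e]
  rw [intervalIntegral.integral_finsetSum fun i _ =>
    (continuous_finsetSum _ fun j _ => hc i j).intervalIntegrable _ _]
  refine sum_congr rfl fun i _ => ?_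
  rw [intervalIntegral.integral_finsetSum fun j _ => (hc i j).intervalIntegrable _ _]
  refine sum_congr rfl fun j _ => ?_
  rw [intervalIntegral.integral_const_mul, hankel_eq_integral, mul_comm]

lemma hankelForm_nonneg {T : ℕ} (c : Fin T → ℝ) : 0 ≤ hankelForm T c := by
  rw [hankelForm_eq_integral]
  exact intervalIntegral.integral_nonneg zero_le_one fun _ _ => sq_nonneg _

lemma hankel_nonneg {T : ℕ} (i j : Fin T) : 0 ≤ hankel T i j := by
  rw [hankel]
  refine div_nonneg zero_le_two (sub_nonneg.2 ?_)
  exact le_self_pow₀ (by push_cast; linarith [(Nat.cast_nonneg (i : ℕ) : (0 : ℝ) ≤ (i : ℕ)),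
    (Nat.cast_nonneg (j : ℕ) : (0 : ℝ) ≤ (j : ℕ))]) (by norm_num)

lemma hankel_comm {T : ℕ} (i j : Fin T) : hankel T i j = hankel T j i := by
  simp only [hankel]
  rw [add_comm ((i : ℕ) + 1)]

/-- The row telescopes, since `2 / ((n+1)(n+2)(n+3))` is the difference of `1 / ((n+1)(n+2))` and `1
/ ((n+2)(n+3))`. -/
lemma hankel_row_sum_le {T : ℕ} (i : Fin T) : ∑ j, hankel T i j ≤ (1 / ((i : ℕ) + 1 : ℝ)) ^ 2 := by
  have key : ∀ N : ℕ, ∑ j ∈ range N, 2 / ((((i : ℕ) + 1 + (j + 1) : ℕ) : ℝ) ^ 3 -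
      (((i : ℕ) + 1 + (j + 1) : ℕ) : ℝ)) =
      1 / (((i : ℕ) + 1 : ℝ) * ((i : ℕ) + 2)) - 1 / (((i : ℕ) + N + 1 : ℝ) * ((i : ℕ) + N + 2)) := by
    intro N
    induction N with
    | zero => simp
    | succ N ih =>
      rw [sum_range_succ, ih]
      push_cast
      set n : ℝ := (i : ℕ) + N with hn
      have hn0 : 0 ≤ n := by positivity
      have e1 : ((i : ℕ) + 1 + (N + 1) : ℝ) = n + 2 := by rw [hn]; ring
      have e2 : ((i : ℕ) + (N + 1) + 1 : ℝ) = n + 2 := by rw [hn]; ring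
      have e3 : ((i : ℕ) + (N + 1) + 2 : ℝ) = n + 3 := by rw [hn]; ring
      have : (n + 2) ^ 3 - (n + 2) = (n + 1) * (n + 2) * (n + 3) := by ring
      rw [e1, e2, e3, this]
      have h1 : n + 1 ≠ 0 := by linarith
      have h2 : n + 2 ≠ 0 := by linarith
      have h3 : n + 3 ≠ 0 := by linarith
      field_simp
      ring
  have h := key T
  rw [sum_range] at h
  simp only [hankel]
  rw [h]
  have h1 : 0 ≤ 1 / (((i : ℕ) + T + 1 : ℝ) * ((i : ℕ) + T + 2)) := by positivity
  have h2 : 1 / (((i : ℕ) + 1 : ℝ) * ((i : ℕ) + 2)) ≤ (1 / ((i : ℕ) + 1 : ℝ)) ^ 2 := by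
    rw [div_pow, one_pow]
    exact one_div_le_one_div_of_le (by positivity) (by nlinarith)
  linarith

/-- A Schur test: a symmetric matrix with nonnegative entries is dominated by the diagonal matrix of
its row sums. -/
lemma hankelForm_le {T : ℕ} (c : Fin T → ℝ) :
    hankelForm T c ≤ ∑ u : Fin T, (1 / ((u : ℕ) + 1 : ℝ)) ^ 2 * c u ^ 2 := by
  have h1 : hankelForm T c ≤ ∑ i, ∑ j, hankel T i j * ((c i ^ 2 + c j ^ 2) / 2) :=
    sum_le_sum fun i _ => sum_le_sum fun j _ =>
      mul_le_mul_of_nonneg_left (by nlinarith [sq_nonneg (c i - c j)]) (hankel_nonneg i j)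
  have h2 : ∑ i, ∑ j, hankel T i j * ((c i ^ 2 + c j ^ 2) / 2) =
      ∑ i, (∑ j, hankel T i j) * c i ^ 2 := by
    have e : ∀ i j, hankel T i j * ((c i ^ 2 + c j ^ 2) / 2) =
      hankel T i j * c i ^ 2 / 2 + hankel T i j * c j ^ 2 / 2 := fun i j => by ring
    simp only [e, sum_add_distrib]
    rw [sum_comm (f := fun i j => hankel T i j * c j ^ 2 / 2), ← sum_add_distrib]
    refine sum_congr rfl fun i _ => ?_
    rw [← sum_add_distrib, sum_mul]
    exact sum_congr rfl fun j _ => by rw [hankel_comm j i]; ring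
  rw [h2] at h1
  exact h1.trans (sum_le_sum fun i _ =>
    mul_le_mul_of_nonneg_right (hankel_row_sum_le i) (sq_nonneg _))

/-! ### Expansions in the Hankel eigenbasis -/

section Eigensystem

variable {T : ℕ} {σ : Fin T → ℝ} {φ : Fin T → Fin T → ℝ}

lemma IsHankelEigensystem.sum_apply_mul_apply (H : IsHankelEigensystem T σ φ) (u v : Fin T) :
    ∑ h, φ h u * φ h v = if u = v then 1 else 0 := by
  have h1 : Matrix.of φ * (Matrix.of φ).transpose = 1 := by
    ext h h'
    rw [Matrix.mul_apply, Matrix.one_apply]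
    exact H.orthonormal h h'
  have h2 : (Matrix.of φ).transpose * Matrix.of φ = 1 := mul_eq_one_comm.1 h1
  replace h2 := congrFun (congrFun h2 u) v
  rwa [Matrix.mul_apply, Matrix.one_apply] at h2

lemma IsHankelEigensystem.expand (H : IsHankelEigensystem T σ φ) (c : Fin T → ℝ) (u : Fin T) :
    c u = ∑ h, (∑ v, φ h v * c v) * φ h u := by
  simp only [sum_mul]
  rw [sum_comm]
  have : ∀ v, ∑ h, φ h v * c v * φ h u = if v = u then c v else 0 := fun v => by
    rw [← mul_boole, ← H.sum_apply_mul_apply v u, mul_sum]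
    exact sum_congr rfl fun h _ => by ring
  simp [this]

lemma IsHankelEigensystem.parseval (H : IsHankelEigensystem T σ φ) (c : Fin T → ℝ) :
    ∑ h, (∑ v, φ h v * c v) ^ 2 = ∑ u, c u ^ 2 := by
  have e : ∀ u, c u ^ 2 = ∑ h, (∑ v, φ h v * c v) * (φ h u * c u) := fun u => by
    conv_lhs => rw [sq, H.expand c u, sum_mul]
    rw [← H.expand c u]
    exact sum_congr rfl fun h _ => by ring
  simp only [e]
  rw [sum_comm]
  exact sum_congr rfl fun h _ => by rw [← mul_sum, sq]

lemma IsHankelEigensystem.hankel_eq (H : IsHankelEigensystem T σ φ) (u v : Fin T) :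
    hankel T u v = ∑ h, σ h * (φ h u * φ h v) := by
  have h1 : ∀ h, ∑ w, hankel T u w * φ h w = σ h * φ h u := fun h => by
    have := congrFun (H.eigen h) u
    simpa [Matrix.mulVec, dotProduct] using this
  have h2 : ∑ h, σ h * (φ h u * φ h v) = ∑ h, ∑ w, hankel T u w * (φ h w * φ h v) :=
    sum_congr rfl fun h _ => by
      rw [← mul_assoc, ← h1, sum_mul]
      exact sum_congr rfl fun w _ => by ring
  rw [h2, sum_comm]
  simp only [← mul_sum, H.sum_apply_mul_apply]
  simp

lemma sum_sum_sum_mul (w : Fin T → ℝ) (c : Fin T → ℝ) :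
    ∑ u, ∑ v, (∑ h, w h * (φ h u * φ h v)) * (c u * c v) =
      ∑ h, w h * (∑ u, φ h u * c u) ^ 2 := by
  simp only [sum_mul]
  have : ∀ u, ∑ v, ∑ h, w h * (φ h u * φ h v) * (c u * c v) =
      ∑ h, ∑ v, w h * (φ h u * φ h v) * (c u * c v) := fun u => sum_comm
  simp only [this]
  rw [sum_comm]
  refine sum_congr rfl fun h _ => ?_
  rw [sq, sum_mul_sum, mul_sum]
  refine sum_congr rfl fun u _ => ?_
  rw [mul_sum]
  exact sum_congr rfl fun v _ => by ring

lemma IsHankelEigensystem.form_eq (H : IsHankelEigensystem T σ φ) (c : Fin T → ℝ) :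
    hankelForm T c = ∑ h, σ h * (∑ u, φ h u * c u) ^ 2 := by
  rw [← sum_sum_sum_mul]
  exact sum_congr rfl fun u _ => sum_congr rfl fun v _ => by rw [H.hankel_eq]

lemma IsHankelEigensystem.nonneg (H : IsHankelEigensystem T σ φ) (h : Fin T) : 0 ≤ σ h := by
  have h1 := hankelForm_nonneg (φ h)
  rw [H.form_eq] at h1
  simpa [H.orthonormal] using h1

/-- The square root of the Hankel matrix is dominated by a diagonal matrix. -/
lemma IsHankelEigensystem.sum_sqrt_mul_sq_le (H : IsHankelEigensystem T σ φ) (c : Fin T → ℝ) :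
    ∑ h, √(σ h) * (∑ u, φ h u * c u) ^ 2 ≤ ∑ u : Fin T, 1 / ((u : ℕ) + 1 : ℝ) * c u ^ 2 := by
  set d : Fin T → ℝ := fun u => 1 / ((u : ℕ) + 1 : ℝ) with hd
  have hd0 : ∀ u, 0 < d u := fun u => by simp only [hd]; positivity
  set S : Matrix (Fin T) (Fin T) ℝ := Matrix.of fun u v => ∑ h, √(σ h) * (φ h u * φ h v) with hS
  have hSv : ∀ (v : Fin T → ℝ) (u : Fin T),
      (S.mulVec v) u = ∑ h, √(σ h) * (∑ w, φ h w * v w) * φ h u := fun v u => by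
    simp only [hS, Matrix.mulVec, dotProduct, Matrix.of_apply, sum_mul]
    rw [sum_comm]
    refine sum_congr rfl fun h _ => ?_
    rw [mul_sum, sum_mul]
    exact sum_congr rfl fun w _ => by ring
  have hSn : ∀ v : Fin T → ℝ, ∑ u, (S.mulVec v u) ^ 2 = hankelForm T v := fun v => by
    rw [H.form_eq, ← H.parseval]
    refine sum_congr rfl fun h _ => ?_
    have : ∑ u, φ h u * S.mulVec v u = √(σ h) * ∑ w, φ h w * v w := by
      simp only [hSv]
      rw [sum_congr rfl fun u _ => mul_sum _ _ _, sum_comm]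
      have e : ∀ h', ∑ u, φ h u * (√(σ h') * (∑ w, φ h' w * v w) * φ h' u) =
          if h = h' then √(σ h') * (∑ w, φ h' w * v w) else 0 := fun h' => by
        rw [← mul_boole, ← H.orthonormal h h', mul_sum univ (fun u => φ h u * φ h' u)]
        exact sum_congr rfl fun u _ => by ring
      rw [sum_congr rfl fun h' _ => e h']
      simp
    rw [this, mul_pow, Real.sq_sqrt (H.nonneg h)]
  have hM : (Matrix.diagonal d - S).IsHermitian := by
    refine Matrix.IsHermitian.sub (Matrix.isHermitian_diagonal _) ?_
    ext u v
    simp only [hS, Matrix.conjTranspose_apply, Matrix.of_apply, star_trivial]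
    exact sum_congr rfl fun h _ => by ring
  -- Monotonicity of the square root. If `D - S` had a unit eigenvector `v` with eigenvalue `lam <
  -- 0`, then `S v = (D - lam) v`, so `‖S v‖² ≥ ‖D v‖² + lam²`. But `‖S v‖²` is the Hankel form at
  -- `v`, which is at most `‖D v‖²`.
  have hpos : (Matrix.diagonal d - S).PosSemidef := by
    rw [hM.posSemidef_iff_eigenvalues_nonneg]
    intro i
    by_contra hneg
    have hneg : hM.eigenvalues i < 0 := not_le.1 hneg
    set lam := hM.eigenvalues i with hlam
    set v : Fin T → ℝ := (hM.eigenvectorBasis i).ofLp with hv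
    have hev : (Matrix.diagonal d - S).mulVec v = lam • v := hM.mulVec_eigenvectorBasis i
    have hv1 : ∑ u, v u ^ 2 = 1 := by
      have h1 : ‖hM.eigenvectorBasis i‖ = 1 := hM.eigenvectorBasis.orthonormal.1 i
      have h2 := EuclideanSpace.norm_sq_eq (hM.eigenvectorBasis i)
      rw [h1] at h2
      simpa using h2.symm
    have hSu : ∀ u, S.mulVec v u = (d u - lam) * v u := fun u => by
      have := congrFun hev u
      rw [Matrix.sub_mulVec] at this
      simp only [Pi.sub_apply, Matrix.mulVec_diagonal, Pi.smul_apply, smul_eq_mul] at this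
      linarith
    have h1 := hankelForm_le v
    rw [← hSn v] at h1
    have h2 : ∑ u, (d u ^ 2 * v u ^ 2 + lam ^ 2 * v u ^ 2) ≤ ∑ u, (S.mulVec v u) ^ 2 :=
      sum_le_sum fun u _ => by
        rw [hSu]
        nlinarith [mul_nonneg (mul_nonneg (hd0 u).le (neg_nonneg.2 hneg.le)) (sq_nonneg (v u))]
    rw [sum_add_distrib, ← mul_sum univ (fun u => v u ^ 2) (lam ^ 2), hv1] at h2
    have : 0 < lam ^ 2 := by nlinarith
    linarith
  have h := hpos.dotProduct_mulVec_nonneg c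
  rw [Matrix.sub_mulVec] at h
  simp only [star_trivial, dotProduct, Pi.sub_apply, Matrix.mulVec_diagonal, mul_sub,
    sum_sub_distrib] at h
  rw [← sum_sum_sum_mul]
  have e1 : ∑ u, c u * S.mulVec c u =
      ∑ u, ∑ v, (∑ h, √(σ h) * (φ h u * φ h v)) * (c u * c v) :=
    sum_congr rfl fun u _ => by
      simp only [hS, Matrix.mulVec, dotProduct, Matrix.of_apply]
      rw [mul_sum]
      exact sum_congr rfl fun v _ => by ring
  have e2 : ∑ u, c u * (d u * c u) = ∑ u : Fin T, 1 / ((u : ℕ) + 1 : ℝ) * c u ^ 2 :=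
    sum_congr rfl fun u _ => by simp only [hd]; ring
  linarith

lemma IsHankelEigensystem.sum_sqrt_mul_norm_sq_le (H : IsHankelEigensystem T σ φ) {n : ℕ}
    (c : Fin T → EuclideanSpace ℝ (Fin n)) :
    ∑ h, √(σ h) * ‖∑ u, φ h u • c u‖ ^ 2 ≤ ∑ u : Fin T, 1 / ((u : ℕ) + 1 : ℝ) * ‖c u‖ ^ 2 := by
  have e1 : ∀ h, √(σ h) * ‖∑ u, φ h u • c u‖ ^ 2 =
      ∑ i, √(σ h) * (∑ u, φ h u * c u i) ^ 2 := fun h => by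
    rw [EuclideanSpace.norm_sq_eq, mul_sum]
    simp
  have e2 : ∀ u : Fin T, 1 / ((u : ℕ) + 1 : ℝ) * ‖c u‖ ^ 2 =
      ∑ i, 1 / ((u : ℕ) + 1 : ℝ) * c u i ^ 2 := fun u => by
    rw [EuclideanSpace.norm_sq_eq, mul_sum]
    simp
  simp only [e1, e2]
  rw [sum_comm, sum_comm (s := (univ : Finset (Fin T))) (f := fun u i => _ * c u i ^ 2)]
  exact sum_le_sum fun i _ => H.sum_sqrt_mul_sq_le fun u => c u i

end Eigensystem

end SpectralFiltering

namespace SpectralFiltering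

open Finset

/-! ### The filters of real eigenvalues in the eigenbasis -/

lemma hasSum_decay_mul {α β : ℝ} (hα : 0 ≤ α) (hα1 : α < 1) (hβ : 0 ≤ β) (hβ1 : β < 1) :
    HasSum (fun u => decay α u * decay β u) ((1 - α) * (1 - β) / (1 - α * β)) := by
  have h := (hasSum_geometric_of_lt_one (mul_nonneg hα hβ) (by nlinarith)).mul_left
    ((1 - α) * (1 - β))
  rw [← div_eq_mul_inv] at h
  refine h.congr_fun ?_
  intro u
  simp only [decay, mul_pow]
  ring

/-- Over all `u ≥ 0` the series equals `2 (α - β)² / ((1 + α)(1 + β)(1 - αβ))`, and `1 - αβ ≥ 1 -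
α`. -/
lemma sum_decay_sub_sq_le (T : ℕ) {α β : ℝ} (hα : 0 ≤ α) (hα1 : α < 1) (hβ : 0 ≤ β)
    (hβ1 : β < 1) :
    ∑ u : Fin T, (decay α u - decay β u) ^ 2 ≤ 2 * (α - β) ^ 2 / (1 - α) := by
  have h := ((hasSum_decay_mul hα hα1 hα hα1).add (hasSum_decay_mul hβ hβ1 hβ hβ1)).sub
    ((hasSum_decay_mul hα hα1 hβ hβ1).mul_left 2)
  have h1 : HasSum (fun u => (decay α u - decay β u) ^ 2)
      (2 * (α - β) ^ 2 / ((1 + α) * (1 + β) * (1 - α * β))) := by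
    have e : (1 - α) * (1 - α) / (1 - α * α) + (1 - β) * (1 - β) / (1 - β * β) -
        2 * ((1 - α) * (1 - β) / (1 - α * β)) =
        2 * (α - β) ^ 2 / ((1 + α) * (1 + β) * (1 - α * β)) := by
      have k1 : 1 - α ≠ 0 := by linarith
      have k2 : 1 - β ≠ 0 := by linarith
      have k3 : 1 + α ≠ 0 := by linarith
      have k4 : 1 + β ≠ 0 := by linarith
      have k5 : 1 - α * β ≠ 0 := by nlinarith
      rw [show 1 - α * α = (1 - α) * (1 + α) by ring, show 1 - β * β = (1 - β) * (1 + β) by ring]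
      field_simp
      ring
    rw [← e]
    refine h.congr_fun ?_
    intro u
    ring
  rw [← sum_range fun u => (decay α u - decay β u) ^ 2]
  refine (sum_le_hasSum (range T) (fun u _ => sq_nonneg _) h1).trans ?_
  have hab : α * β ≤ α := by nlinarith
  refine div_le_div_of_nonneg_left (by positivity) (by linarith) ?_
  have : 1 ≤ (1 + α) * (1 + β) := by nlinarith [mul_nonneg hα hβ]
  nlinarith [mul_nonneg hα hβ]

lemma sum_decay_sq_le (T : ℕ) {α : ℝ} (hα : 0 ≤ α) (hα1 : α < 1) :
    ∑ u : Fin T, decay α u ^ 2 ≤ 1 - α := by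
  have h := hasSum_decay_mul hα hα1 hα hα1
  simp only [← sq] at h
  rw [← sum_range fun u => decay α u ^ 2]
  refine (sum_le_hasSum (range T) (fun u _ => sq_nonneg _) h).trans ?_
  rw [div_le_iff₀ (by nlinarith)]
  nlinarith [mul_nonneg hα (sq_nonneg (1 - α)), mul_nonneg hα hα]

/-- The square of a mean is at most the mean of the squares. -/
lemma integral_sq_le {f : ℝ → ℝ} (hf : Continuous f) {a l : ℝ} (hl : 0 < l) :
    (1 / l * ∫ x in a..(a + l), f x) ^ 2 ≤ 1 / l * ∫ x in a..(a + l), f x ^ 2 := by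
  set m := 1 / l * ∫ x in a..(a + l), f x with hm
  have hi : ∀ g : ℝ → ℝ, Continuous g → IntervalIntegrable g MeasureTheory.volume a (a + l) :=
    fun g hg => hg.intervalIntegrable _ _
  have h0 : 0 ≤ ∫ x in a..(a + l), (f x - m) ^ 2 :=
    intervalIntegral.integral_nonneg (by linarith) fun _ _ => sq_nonneg _
  have e : ∀ x, (f x - m) ^ 2 = f x ^ 2 - (2 * m) * f x + m ^ 2 := fun x => by ring
  simp only [e] at h0
  rw [intervalIntegral.integral_add (hi _ (by fun_prop)) (hi _ (by fun_prop)),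
    intervalIntegral.integral_sub (hi _ (by fun_prop)) (hi _ (by fun_prop)),
    intervalIntegral.integral_const_mul, intervalIntegral.integral_const] at h0
  have hI : ∫ x in a..(a + l), f x = l * m := by rw [hm]; field_simp
  rw [hI] at h0
  simp only [add_sub_cancel_left, smul_eq_mul] at h0
  rw [div_mul_eq_mul_div, one_mul, le_div_iff₀ hl]
  nlinarith

/-- The mean of the filters of the eigenvalues in `[r, r + l]`. -/
noncomputable def meanDecay (T : ℕ) (r l : ℝ) : Fin T → ℝ :=
  fun u => 1 / l * ∫ α in r..(r + l), decay α u

lemma sum_mul_meanDecay {T : ℕ} (r l : ℝ) (c : Fin T → ℝ) :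
    ∑ u, c u * meanDecay T r l u = 1 / l * ∫ α in r..(r + l), ∑ u : Fin T, c u * decay α u := by
  have hc : ∀ u : Fin T, Continuous fun α => c u * decay α u := fun u =>
    continuous_const.mul (continuous_decay u)
  rw [intervalIntegral.integral_finsetSum fun u _ => (hc u).intervalIntegrable _ _, mul_sum]
  refine sum_congr rfl fun u _ => ?_
  rw [intervalIntegral.integral_const_mul, meanDecay]
  ring

/-- Jensen on `[r, r + l]`, followed by enlarging the interval to `[0, 1]`. Averaging is essential:
evaluation at one point is not bounded by the `L²` norm uniformly in `T`. -/
lemma sum_mul_meanDecay_sq_le {T : ℕ} {r l : ℝ} (hr : 0 ≤ r) (hl : 0 < l) (hrl : r + l ≤ 1)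
    (c : Fin T → ℝ) :
    (∑ u, c u * meanDecay T r l u) ^ 2 ≤ 1 / l * hankelForm T c := by
  rw [sum_mul_meanDecay, hankelForm_eq_integral]
  refine (integral_sq_le (continuous_sum_decay c) hl).trans
    (mul_le_mul_of_nonneg_left ?_ (by positivity))
  exact intervalIntegral.integral_mono_interval hr (by linarith) hrl
    (Filter.Eventually.of_forall fun _ => sq_nonneg _)
    (((continuous_sum_decay c).pow 2).intervalIntegrable _ _)

lemma sum_meanDecay_sub_sq_le (T : ℕ) {r l : ℝ} (hr : 0 ≤ r) (hl : 0 < l) (hrl : r + l < 1) :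
    ∑ u : Fin T, (meanDecay T r l u - decay r u) ^ 2 ≤ 2 * l ^ 2 / (1 - r) := by
  have hc : ∀ u : ℕ, Continuous fun α => decay α u - decay r u := fun u =>
    (continuous_decay u).sub continuous_const
  have e : ∀ u : Fin T, meanDecay T r l u - decay r u =
      1 / l * ∫ α in r..(r + l), (decay α u - decay r u) := fun u => by
    rw [intervalIntegral.integral_sub ((continuous_decay u).intervalIntegrable _ _)
      (continuous_const.intervalIntegrable _ _), intervalIntegral.integral_const, meanDecay]
    simp only [add_sub_cancel_left, smul_eq_mul]
    field_simp
  have h1 : ∑ u : Fin T, (meanDecay T r l u - decay r u) ^ 2 ≤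
      1 / l * ∫ α in r..(r + l), ∑ u : Fin T, (decay α u - decay r u) ^ 2 := by
    have hc2 : ∀ u : Fin T, Continuous fun α => (decay α u - decay r u) ^ 2 := fun u =>
      (hc u).pow 2
    rw [intervalIntegral.integral_finsetSum fun u _ => (hc2 u).intervalIntegrable _ _, mul_sum]
    refine sum_le_sum fun u _ => ?_
    rw [e]
    exact integral_sq_le (hc u) hl
  have h2 : ∫ α in r..(r + l), ∑ u : Fin T, (decay α u - decay r u) ^ 2 ≤
      ∫ _ in r..(r + l), 2 * l ^ 2 / (1 - r) := by
    refine intervalIntegral.integral_mono_on (by linarith)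
      ((continuous_finsetSum _ fun (u : Fin T) _ => (hc u).pow 2).intervalIntegrable _ _)
      (continuous_const.intervalIntegrable _ _) fun α hα => ?_
    have h := sum_decay_sub_sq_le T hr (by linarith) (hr.trans hα.1) (by linarith [hα.2])
    simp only [sub_sq_comm (decay r _)] at h
    refine h.trans (div_le_div_of_nonneg_right ?_ (by linarith))
    have : (r - α) ^ 2 ≤ l ^ 2 := by nlinarith [hα.1, hα.2]
    linarith
  rw [intervalIntegral.integral_const, add_sub_cancel_left, smul_eq_mul] at h2
  refine h1.trans ((mul_le_mul_of_nonneg_left h2 (by positivity)).trans_eq ?_)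
  field_simp

/-- The map `w ↦ (σ_h ^ (-1/4) ⟨φ_h, w⟩)_h`. -/
noncomputable def filterCoord {T : ℕ} (σ : Fin T → ℝ) (φ : Fin T → Fin T → ℝ) :
    (Fin T → ℝ) →ₗ[ℝ] EuclideanSpace ℝ (Fin T) where
  -- For `σ h = 0` the inverse is 0. Nothing is lost, since such a `φ h` is orthogonal to all
  -- filters by `sum_mul_decay_eq_zero`.
  toFun w := WithLp.toLp 2 fun h => (σ h ^ (1 / 4 : ℝ))⁻¹ * ∑ u, φ h u * w u
  map_add' v w := by
    ext h
    simp [mul_add, sum_add_distrib]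
  map_smul' c w := by
    ext h
    simp only [Pi.smul_apply, smul_eq_mul, RingHom.id_apply, PiLp.smul_apply]
    rw [mul_left_comm c, mul_sum univ _ c]
    congr 1
    exact sum_congr rfl fun u _ => by ring

section Eigensystem

variable {T : ℕ} {σ : Fin T → ℝ} {φ : Fin T → Fin T → ℝ}

/-- Interpolation by Cauchy-Schwarz: `⟨w, Z^(-1/2) w⟩² ≤ ‖w‖² ⟨w, Z⁻¹ w⟩`. The last factor is at
most `B` by duality, testing `hB` on `c = Z⁻¹ w` (with a pseudoinverse). -/
lemma IsHankelEigensystem.norm_filterCoord_le (H : IsHankelEigensystem T σ φ) {w : Fin T → ℝ}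
    {A B : ℝ} (hA : ∑ u, w u ^ 2 ≤ A)
    (hB : ∀ c : Fin T → ℝ, (∑ u, c u * w u) ^ 2 ≤ B * hankelForm T c) {K : ℝ} (hK : 0 ≤ K)
    (hAB : A * B ≤ K ^ 4) : ‖filterCoord σ φ w‖ ≤ K := by
  set a : Fin T → ℝ := fun h => ∑ u, φ h u * w u with ha
  set s := ∑ h, a h ^ 2 / σ h with hs
  have hs0 : 0 ≤ s := sum_nonneg fun h _ => div_nonneg (sq_nonneg _) (H.nonneg h)
  have hA0 : 0 ≤ A := (sum_nonneg fun _ _ => sq_nonneg _).trans hA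
  have hsB : s ^ 2 ≤ B * s := by
    set c : Fin T → ℝ := fun u => ∑ h, a h / σ h * φ h u with hc
    have h1 : ∀ h, ∑ u, φ h u * c u = a h / σ h := fun h => by
      simp only [hc]
      rw [sum_congr rfl fun u _ => mul_sum _ _ _, sum_comm]
      have e : ∀ h', ∑ u, φ h u * (a h' / σ h' * φ h' u) =
          if h = h' then a h' / σ h' else 0 := fun h' => by
        rw [← mul_boole, ← H.orthonormal h h', mul_sum univ (fun u => φ h u * φ h' u)]
        exact sum_congr rfl fun u _ => by ring
      rw [sum_congr rfl fun h' _ => e h']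
      simp
    have h2 : hankelForm T c = s := by
      rw [H.form_eq, hs]
      refine sum_congr rfl fun h _ => ?_
      rw [h1]
      rcases eq_or_ne (σ h) 0 with h0 | h0
      · simp [h0]
      · field_simp
    have h3 : ∑ u, c u * w u = s := by
      simp only [hc, sum_mul]
      rw [sum_comm, hs]
      refine sum_congr rfl fun h _ => ?_
      rw [sq, mul_div_right_comm]
      conv_rhs => rw [ha, mul_sum]
      exact sum_congr rfl fun u _ => by ring
    have := hB c
    rwa [h2, h3] at this
  have hn : ‖filterCoord σ φ w‖ ^ 2 = ∑ h, a h * (a h / √(σ h)) := by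
    rw [EuclideanSpace.norm_sq_eq]
    refine sum_congr rfl fun h _ => ?_
    have e : √(σ h) = (σ h ^ (1 / 4 : ℝ)) ^ 2 := by
      rw [← Real.rpow_natCast, ← Real.rpow_mul (H.nonneg h), Real.sqrt_eq_rpow]
      norm_num
    have e2 : filterCoord σ φ w h = (σ h ^ (1 / 4 : ℝ))⁻¹ * a h := rfl
    rw [e2, Real.norm_eq_abs, sq_abs, e, mul_pow, inv_pow]
    ring
  have hcs := sum_mul_sq_le_sq_mul_sq univ a (fun h => a h / √(σ h))
  rw [← hn] at hcs
  have e1 : ∑ h, (a h / √(σ h)) ^ 2 = s := sum_congr rfl fun h _ => by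
    rw [div_pow, Real.sq_sqrt (H.nonneg h)]
  rw [e1, H.parseval] at hcs
  have hsK : A * s ≤ K ^ 4 := by
    rcases hs0.eq_or_lt with h | h
    · rw [← h, mul_zero]
      positivity
    · refine le_trans (mul_le_mul_of_nonneg_left ?_ hA0) hAB
      nlinarith
  have h4 : ‖filterCoord σ φ w‖ ^ 4 ≤ K ^ 4 := by
    calc ‖filterCoord σ φ w‖ ^ 4 = (‖filterCoord σ φ w‖ ^ 2) ^ 2 := by ring
      _ ≤ _ := hcs
      _ ≤ A * s := mul_le_mul_of_nonneg_right hA hs0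
      _ ≤ _ := hsK
  exact le_of_pow_le_pow_left₀ (by norm_num) hK h4

/-- The filter of every eigenvalue `r ∈ [0, 1)` is bounded in the norm `⟨w, Z ^ (-1/2) w⟩`. -/
lemma IsHankelEigensystem.norm_filterCoord_decay_le (H : IsHankelEigensystem T σ φ) {r : ℝ}
    (hr : 0 ≤ r) (hr1 : r < 1) : ‖filterCoord σ φ fun u => decay r u‖ ≤ 10 := by
  -- Averages over shorter intervals approximate the filter better but have larger `Z⁻¹` form. For
  -- consecutive averages the product `A * B` is of order `l i / (1 - r)`. Shrinking by 16 halves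
  -- its fourth root, so the increments `4 · 2^(-i)` sum to 8, and the first average adds 2.
  set l : ℕ → ℝ := fun i => (1 - r) / 2 * (1 / 16) ^ i with hl
  have h1r : 0 < 1 - r := by linarith
  have hl0 : ∀ i, 0 < l i := fun i => by simp only [hl]; positivity
  have hll : ∀ i, l i ≤ (1 - r) / 2 := fun i =>
    mul_le_of_le_one_right (by linarith) (pow_le_one₀ (by norm_num) (by norm_num))
  have hl1 : ∀ i, r + l i < 1 := fun i => by linarith [hll i]
  have hls : ∀ i, l (i + 1) = l i / 16 := fun i => by simp only [hl, pow_succ]; ring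
  set ν : ℕ → Fin T → ℝ := fun i => meanDecay T r (l i) with hν
  have hB : ∀ i (c : Fin T → ℝ), (∑ u, c u * ν i u) ^ 2 ≤ 1 / l i * hankelForm T c := fun i c =>
    sum_mul_meanDecay_sq_le hr (hl0 i) (hl1 i).le c
  have hA : ∀ i, ∑ u : Fin T, (ν i u - decay r u) ^ 2 ≤ 2 * l i ^ 2 / (1 - r) := fun i =>
    sum_meanDecay_sub_sq_le T hr (hl0 i) (hl1 i)
  have hbase : ‖filterCoord σ φ (ν 0)‖ ≤ 2 := by
    refine H.norm_filterCoord_le (A := 3 * (1 - r)) (B := 2 / (1 - r)) ?_ ?_ (by norm_num) ?_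
    · have h1 : ∑ u, ν 0 u ^ 2 ≤
          2 * ∑ u : Fin T, (ν 0 u - decay r u) ^ 2 + 2 * ∑ u : Fin T, decay r u ^ 2 := by
        rw [mul_sum, mul_sum, ← sum_add_distrib]
        exact sum_le_sum fun u _ => by nlinarith [sq_nonneg (ν 0 u - 2 * decay r u)]
      have h2 := hA 0
      have h3 := sum_decay_sq_le T hr hr1
      have h4 : 2 * l 0 ^ 2 / (1 - r) = (1 - r) / 2 := by
        simp only [hl, pow_zero, mul_one]
        field_simp
      linarith
    · intro c
      have := hB 0 c
      simp only [hl, pow_zero, mul_one, one_div_div] at this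
      exact this
    · have : 3 * (1 - r) * (2 / (1 - r)) = 6 := by field_simp; norm_num
      rw [this]
      norm_num
  have hstep : ∀ i, ‖filterCoord σ φ (ν (i + 1) - ν i)‖ ≤ 4 * (1 / 2) ^ i := by
    intro i
    refine H.norm_filterCoord_le (A := 5 * l i ^ 2 / (1 - r)) (B := 34 / l i) ?_ ?_
      (by positivity) ?_
    · have h1 : ∑ u, (ν (i + 1) - ν i) u ^ 2 ≤ 2 * ∑ u : Fin T, (ν (i + 1) u - decay r u) ^ 2 +
          2 * ∑ u : Fin T, (ν i u - decay r u) ^ 2 := by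
        rw [mul_sum, mul_sum, ← sum_add_distrib]
        refine sum_le_sum fun u _ => ?_
        rw [Pi.sub_apply]
        nlinarith [sq_nonneg ((ν (i + 1) u - decay r u) + (ν i u - decay r u))]
      have h2 := hA i
      have h3 := hA (i + 1)
      rw [hls] at h3
      have h4 : 2 * (2 * (l i / 16) ^ 2 / (1 - r)) + 2 * (2 * l i ^ 2 / (1 - r)) ≤
          5 * l i ^ 2 / (1 - r) := by
        have : 0 ≤ l i ^ 2 / (1 - r) := by positivity
        have e1 : 2 * (2 * (l i / 16) ^ 2 / (1 - r)) = 4 / 256 * (l i ^ 2 / (1 - r)) := by ring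
        have e2 : 2 * (2 * l i ^ 2 / (1 - r)) = 4 * (l i ^ 2 / (1 - r)) := by ring
        have e3 : 5 * l i ^ 2 / (1 - r) = 5 * (l i ^ 2 / (1 - r)) := by ring
        rw [e1, e2, e3]
        linarith
      linarith
    · intro c
      have h1 := hB i c
      have h2 := hB (i + 1) c
      rw [hls] at h2
      have e : ∑ u, c u * (ν (i + 1) - ν i) u = ∑ u, c u * ν (i + 1) u - ∑ u, c u * ν i u := by
        rw [← sum_sub_distrib]
        exact sum_congr rfl fun u _ => by rw [Pi.sub_apply]; ring
      have e2 : 34 / l i * hankelForm T c =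
          2 * (1 / (l i / 16) * hankelForm T c) + 2 * (1 / l i * hankelForm T c) := by
        field_simp
        ring
      rw [e, e2]
      nlinarith [sq_nonneg (∑ u, c u * ν (i + 1) u + ∑ u, c u * ν i u)]
    · have e : 5 * l i ^ 2 / (1 - r) * (34 / l i) = 85 * (1 / 16) ^ i := by
        have : l i = (1 - r) / 2 * (1 / 16) ^ i := rfl
        have hne := (hl0 i).ne'
        field_simp
        rw [this]
        field_simp
        ring
      have e2 : (4 * (1 / 2 : ℝ) ^ i) ^ 4 = 256 * (1 / 16) ^ i := by
        rw [mul_pow, ← pow_mul, mul_comm i 4, pow_mul]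
        norm_num
      rw [e, e2]
      have : (0 : ℝ) ≤ (1 / 16) ^ i := by positivity
      linarith
  have hbound : ∀ i, ‖filterCoord σ φ (ν i)‖ ≤ 10 - 8 * (1 / 2) ^ i := by
    intro i
    induction i with
    | zero => norm_num; exact hbase
    | succ i ih =>
      have e : ν (i + 1) = ν i + (ν (i + 1) - ν i) := by abel
      rw [e, map_add]
      refine (norm_add_le _ _).trans ?_
      have := hstep i
      rw [pow_succ]
      linarith
  have hlim : Filter.Tendsto ν Filter.atTop (nhds fun u : Fin T => decay r u) := by
    rw [tendsto_pi_nhds]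
    intro u
    rw [tendsto_iff_norm_sub_tendsto_zero]
    have hb : ∀ i, ‖ν i u - decay r u‖ ≤ 2 * (1 / 16) ^ i := by
      intro i
      rw [Real.norm_eq_abs]
      refine abs_le_of_sq_le_sq ?_ (by positivity)
      refine (single_le_sum (f := fun u : Fin T => (ν i u - decay r u) ^ 2)
        (fun _ _ => sq_nonneg _) (mem_univ u)).trans ((hA i).trans ?_)
      have e : 2 * l i ^ 2 / (1 - r) = (1 - r) / 2 * ((1 / 16) ^ i) ^ 2 := by
        simp only [hl]
        field_simp
      rw [e, mul_pow]
      have : (0 : ℝ) ≤ ((1 / 16) ^ i) ^ 2 := by positivity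
      nlinarith
    refine squeeze_zero (fun i => norm_nonneg _) hb ?_
    have := (tendsto_pow_atTop_nhds_zero_of_lt_one (r := (1 / 16 : ℝ)) (by norm_num)
      (by norm_num)).const_mul 2
    rwa [mul_zero] at this
  have hcont : Continuous (filterCoord σ φ) := LinearMap.continuous_of_finiteDimensional _
  refine le_of_tendsto ((hcont.norm.tendsto _).comp hlim) (Filter.Eventually.of_forall fun i => ?_)
  have := hbound i
  have h2 : (0 : ℝ) ≤ (1 / 2) ^ i := by positivity
  simp only [Function.comp_apply]
  linarith

/-- The Hankel form at `φ h` vanishes, and it is the integral of the square of a continuous function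
of the eigenvalue. -/
lemma IsHankelEigensystem.sum_mul_decay_eq_zero (H : IsHankelEigensystem T σ φ) {h : Fin T}
    (h0 : σ h = 0) {r : ℝ} (hr : 0 ≤ r) (hr1 : r ≤ 1) : ∑ u : Fin T, φ h u * decay r u = 0 := by
  by_contra hne
  have h1 : hankelForm T (φ h) = 0 := by
    rw [H.form_eq]
    refine sum_eq_zero fun h' _ => ?_
    rw [H.orthonormal]
    split_ifs with e
    · rw [e, h0, zero_mul]
    · simp
  rw [hankelForm_eq_integral] at h1
  refine (intervalIntegral.integral_pos zero_lt_one
    ((continuous_sum_decay (φ h)).pow 2).continuousOn (fun _ _ => sq_nonneg _)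
    ⟨r, ⟨hr, hr1⟩, ?_⟩).ne' h1
  exact lt_of_le_of_ne (sq_nonneg _) (pow_ne_zero 2 hne).symm

/-- The filter of a real eigenvalue in terms of its coordinates. -/
lemma IsHankelEigensystem.decay_eq (H : IsHankelEigensystem T σ φ) {r : ℝ}
    (hr : 0 ≤ r) (hr1 : r ≤ 1) (u : Fin T) :
    decay r u = ∑ h, σ h ^ (1 / 4 : ℝ) * φ h u * filterCoord σ φ (fun u => decay r u) h := by
  refine (H.expand (fun u => decay r u) u).trans (sum_congr rfl fun h _ => ?_)
  have e : filterCoord σ φ (fun u => decay r u) h =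
    (σ h ^ (1 / 4 : ℝ))⁻¹ * ∑ u : Fin T, φ h u * decay r u := rfl
  rw [e]
  rcases eq_or_ne (σ h) 0 with h0 | h0
  · rw [H.sum_mul_decay_eq_zero h0 hr hr1]
    simp
  · have : σ h ^ (1 / 4 : ℝ) ≠ 0 :=
      (Real.rpow_pos_of_pos (lt_of_le_of_ne (H.nonneg h) h0.symm) _).ne'
    field_simp

end Eigensystem

end SpectralFiltering

namespace SpectralFiltering

open Finset Complex

/-! ### Unit numbers as combinations of equidistant phases -/

/-- The discrete Fourier transform, with `W` phases, of the powers `ω ^ (a i)`. -/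
noncomputable def phaseSum (W : ℕ) (ω : ℂ) (N : ℕ) (a : ℕ → ℤ) (p : ℕ) : ℂ :=
  ∑ i ∈ range N, ω ^ a i * exp (-(2 * Real.pi * a i * p / W : ℝ) * I)

lemma sum_exp_phase {W : ℕ} (hW : 0 < W) (j : ℤ) :
    ∑ p ∈ range W, exp ((2 * Real.pi * j * p / W : ℝ) * I) = if (W : ℤ) ∣ j then (W : ℂ) else 0 := by
  have hz := Complex.isPrimitiveRoot_exp W hW.ne'
  set ζ := exp (2 * Real.pi * I / W) with hζ
  have hW0 : (W : ℂ) ≠ 0 := by exact_mod_cast hW.ne'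
  have e : ∀ p : ℕ, exp ((2 * Real.pi * j * p / W : ℝ) * I) = (ζ ^ j) ^ p := fun p => by
    rw [hζ, ← exp_int_mul, ← exp_nat_mul]
    congr 1
    push_cast
    field_simp
  simp only [e]
  split_ifs with h
  · rw [(hz.zpow_eq_one_iff_dvd j).2 h]
    simp
  · have h1 : ζ ^ j ≠ 1 := fun h1 => h ((hz.zpow_eq_one_iff_dvd j).1 h1)
    rw [geom_sum_eq h1]
    have : (ζ ^ j) ^ W = 1 := by
      rw [← zpow_natCast, ← zpow_mul, mul_comm, zpow_mul, zpow_natCast, hz.pow_eq_one, one_zpow]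
    rw [this, sub_self, zero_div]

/-- Parseval on `ℤ / W`: the exponents are distinct modulo `W`, and every coefficient has modulus 1.
-/
lemma sum_phaseSum_mul {W : ℕ} (hW : 0 < W) {ω : ℂ} (hω : ‖ω‖ = 1) {N : ℕ} {a : ℕ → ℤ}
    (ha : ∀ i < N, ∀ j < N, (W : ℤ) ∣ a i - a j → i = j) :
    ∑ p ∈ range W, ‖phaseSum W ω N a p‖ ^ 2 = W * N := by
  have hω0 : ω ≠ 0 := norm_ne_zero_iff.1 (by rw [hω]; exact one_ne_zero)
  have hconj : ∀ k : ℤ, (starRingEnd ℂ) (ω ^ k) = ω ^ (-k) := fun k => by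
    rw [zpow_neg, map_zpow₀, ← inv_zpow, Complex.inv_eq_conj hω]
  have e : ∀ p : ℕ, ((‖phaseSum W ω N a p‖ ^ 2 : ℝ) : ℂ) = ∑ i ∈ range N, ∑ j ∈ range N,
      ω ^ (a i - a j) * exp ((2 * Real.pi * ((a j - a i : ℤ) : ℝ) * p / W : ℝ) * I) := fun p => by
    push_cast
    rw [← Complex.mul_conj', phaseSum, map_sum, sum_mul_sum]
    refine sum_congr rfl fun i _ => sum_congr rfl fun j _ => ?_
    rw [map_mul, hconj, ← exp_conj, mul_mul_mul_comm, ← zpow_add₀ hω0, ← exp_add, ← sub_eq_add_neg]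
    congr 2
    rw [map_mul, conj_I, map_neg, conj_ofReal]
    push_cast
    ring
  have : ((∑ p ∈ range W, ‖phaseSum W ω N a p‖ ^ 2 : ℝ) : ℂ) = ((W * N : ℝ) : ℂ) := by
    rw [ofReal_sum, sum_congr rfl fun p _ => e p, sum_comm]
    have : ∀ i ∈ range N, ∑ p ∈ range W, ∑ j ∈ range N, ω ^ (a i - a j) *
        exp ((2 * Real.pi * ((a j - a i : ℤ) : ℝ) * p / W : ℝ) * I) = W := by
      intro i hi
      rw [sum_comm, sum_eq_single i]
      · rw [← mul_sum, sum_exp_phase hW]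
        simp
      · intro j hj hji
        rw [← mul_sum, sum_exp_phase hW, if_neg, mul_zero]
        exact fun h => hji (ha j (mem_range.1 hj) i (mem_range.1 hi) h)
      · exact fun h => absurd hi h
    rw [sum_congr rfl this]
    simp [mul_comm]
  exact_mod_cast this

/-- The powers `ω ^ v`, `1 ≤ v ≤ T`, of a unit number are combinations, with coefficients of
bounded `ℓ¹` norm, of the powers of `W` equidistant unit numbers. -/
lemma exists_phase_combination {T W : ℕ} (hT : 1 ≤ T) (hW : 3 * T ≤ W) {ω : ℂ} (hω : ‖ω‖ = 1) :
    ∃ c : ℕ → ℂ, ∑ p ∈ range W, ‖c p‖ ≤ 2 ∧ ∀ v : ℕ, 1 ≤ v → v ≤ T →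
      ω ^ v = ∑ p ∈ range W, c p * exp ((2 * Real.pi * v * p / W : ℝ) * I) := by
  have hW0 : 0 < W := by omega
  have hω0 : ω ≠ 0 := norm_ne_zero_iff.1 (by rw [hω]; exact one_ne_zero)
  have hTc : (T : ℂ) ≠ 0 := by exact_mod_cast (by omega : T ≠ 0)
  have hWc : (W : ℂ) ≠ 0 := by exact_mod_cast hW0.ne'
  -- Windows `[2 - T, T + 1]` and `[0, T - 1]`. Their convolution, divided by `T`, is 1 on `[1, T]`,
  -- because `v - b j` always lies in the first window. Differences `v - a i - b j` are smaller than
  -- `W` in modulus, so no aliasing occurs.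
  set a : ℕ → ℤ := fun i => (i : ℤ) + 2 - T with ha
  set b : ℕ → ℤ := fun i => (i : ℤ) with hb
  set A := phaseSum W ω (2 * T) a with hA
  set B := phaseSum W ω T b with hB
  refine ⟨fun p => A p * B p / (T * W), ?_, ?_⟩
  · have h1 := sum_phaseSum_mul hW0 hω (N := 2 * T) (a := a) (by
      intro i hi j hj h
      have h2 : ((i : ℤ) + 2 - T) - ((j : ℤ) + 2 - T) = 0 :=
        Int.eq_zero_of_abs_lt_dvd h (by rw [abs_lt]; omega)
      omega)
    have h2 := sum_phaseSum_mul hW0 hω (N := T) (a := b) (by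
      intro i hi j hj h
      have h2 : (i : ℤ) - (j : ℤ) = 0 :=
        Int.eq_zero_of_abs_lt_dvd h (by rw [abs_lt]; omega)
      omega)
    have h3 := sum_mul_sq_le_sq_mul_sq (range W) (fun p => ‖A p‖) (fun p => ‖B p‖)
    rw [h1, h2] at h3
    have hT0 : (0 : ℝ) < T := by exact_mod_cast hT
    have hW0' : (0 : ℝ) < W := by exact_mod_cast hW0
    -- Cauchy-Schwarz with the two Parseval identities gives `√2 T W`, rounded up.
    have h4 : ∑ p ∈ range W, ‖A p‖ * ‖B p‖ ≤ 2 * (T * W) := by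
      refine abs_le_of_sq_le_sq' (h3.trans ?_) (by positivity) |>.2
      push_cast
      nlinarith [mul_pos hT0 hW0', sq_nonneg ((T : ℝ) * W)]
    have e : ∀ p, ‖A p * B p / (T * W)‖ = ‖A p‖ * ‖B p‖ / (T * W) := fun p => by
      rw [norm_div, norm_mul, norm_mul, Complex.norm_natCast, Complex.norm_natCast]
    simp only [e]
    rw [← sum_div, div_le_iff₀ (by positivity)]
    exact h4
  · intro v hv1 hvT
    have e : ∀ p, A p * B p / (T * W) * exp ((2 * Real.pi * v * p / W : ℝ) * I) =
        ∑ i ∈ range (2 * T), ∑ j ∈ range T, ω ^ (a i + b j) / (T * W) *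
          exp ((2 * Real.pi * ((v - a i - b j : ℤ) : ℝ) * p / W : ℝ) * I) := fun p => by
      rw [div_mul_eq_mul_div, hA, hB, phaseSum, phaseSum, sum_mul_sum, sum_mul, sum_div]
      refine sum_congr rfl fun i _ => ?_
      rw [sum_mul, sum_div]
      refine sum_congr rfl fun j _ => ?_
      rw [zpow_add₀ hω0]
      have : exp ((2 * Real.pi * ((v - a i - b j : ℤ) : ℝ) * p / W : ℝ) * I) =
          exp (-(2 * Real.pi * a i * p / W : ℝ) * I) * exp (-(2 * Real.pi * b j * p / W : ℝ) * I) *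
          exp ((2 * Real.pi * v * p / W : ℝ) * I) := by
        rw [← exp_add, ← exp_add]
        congr 1
        push_cast
        ring
      rw [this]
      ring
    rw [sum_congr rfl fun p _ => e p, sum_comm]
    have h1 : ∀ i ∈ range (2 * T), ∑ p ∈ range W, ∑ j ∈ range T, ω ^ (a i + b j) / (T * W) *
          exp ((2 * Real.pi * ((v - a i - b j : ℤ) : ℝ) * p / W : ℝ) * I) =
        ∑ j ∈ range T, if i = v + T - 2 - j then ω ^ v / T else 0 := by
      intro i hi
      rw [sum_comm]
      refine sum_congr rfl fun j hj => ?_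
      rw [mem_range] at hi hj
      rw [← mul_sum, sum_exp_phase hW0]
      split_ifs with h2 h3 h3
      · have : a i + b j = v := by simp only [ha, hb]; omega
        rw [this, zpow_natCast]
        field_simp
      · exfalso
        have : (v - a i - b j : ℤ) = 0 :=
          Int.eq_zero_of_abs_lt_dvd h2 (by simp only [ha, hb]; rw [abs_lt]; omega)
        simp only [ha, hb] at this
        omega
      · exfalso
        apply h2
        have : (v - a i - b j : ℤ) = 0 := by simp only [ha, hb]; omega
        rw [this]
        exact dvd_zero _
      · rw [mul_zero]
    rw [sum_congr rfl h1, sum_comm]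
    have h2 : ∀ j ∈ range T, ∑ i ∈ range (2 * T), (if i = v + T - 2 - j then ω ^ v / T else 0) =
        ω ^ v / T := by
      intro j hj
      rw [sum_ite_eq', if_pos]
      rw [mem_range] at hj ⊢
      omega
    rw [sum_congr rfl h2, sum_const, card_range, nsmul_eq_mul]
    field_simp

end SpectralFiltering

namespace SpectralFiltering

open Finset

/-! ### Unrolling a linear dynamical system -/

lemma mulE_apply {a b : ℕ} (X : Matrix (Fin a) (Fin b) ℝ) (v : EuclideanSpace ℝ (Fin b))
    (i : Fin a) : mulE X v i = ∑ j, X i j * v j := rfl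

lemma mulE_add {a b : ℕ} (X : Matrix (Fin a) (Fin b) ℝ) (v w : EuclideanSpace ℝ (Fin b)) :
    mulE X (v + w) = mulE X v + mulE X w := by
  ext i
  simp [mulE_apply, mul_add, sum_add_distrib]

lemma mulE_zero {a b : ℕ} (X : Matrix (Fin a) (Fin b) ℝ) : mulE X 0 = 0 := by
  ext i
  simp [mulE_apply]

lemma mulE_sum {a b : ℕ} {ι : Type*} (X : Matrix (Fin a) (Fin b) ℝ) (s : Finset ι)
    (v : ι → EuclideanSpace ℝ (Fin b)) : mulE X (∑ i ∈ s, v i) = ∑ i ∈ s, mulE X (v i) :=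
  map_sum (⟨⟨mulE X, mulE_zero X⟩, mulE_add X⟩ : EuclideanSpace ℝ (Fin b) →+ _) v s

lemma mulE_mul {a b c : ℕ} (X : Matrix (Fin a) (Fin b) ℝ) (Y : Matrix (Fin b) (Fin c) ℝ)
    (v : EuclideanSpace ℝ (Fin c)) : mulE (X * Y) v = mulE X (mulE Y v) := by
  simp [mulE, Matrix.mulVec_mulVec]

lemma add_mulE {a b : ℕ} (X Y : Matrix (Fin a) (Fin b) ℝ) (v : EuclideanSpace ℝ (Fin b)) :
    mulE (X + Y) v = mulE X v + mulE Y v := by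
  simp [mulE, Matrix.add_mulVec]

lemma zero_mulE {a b : ℕ} (v : EuclideanSpace ℝ (Fin b)) :
    mulE (0 : Matrix (Fin a) (Fin b) ℝ) v = 0 := by
  simp [mulE]

lemma smul_mulE {a b : ℕ} (c : ℝ) (X : Matrix (Fin a) (Fin b) ℝ) (v : EuclideanSpace ℝ (Fin b)) :
    mulE (c • X) v = c • mulE X v := by
  simp [mulE, Matrix.smul_mulVec]

lemma sum_mulE {a b : ℕ} {ι : Type*} (s : Finset ι) (X : ι → Matrix (Fin a) (Fin b) ℝ)
    (v : EuclideanSpace ℝ (Fin b)) : mulE (∑ i ∈ s, X i) v = ∑ i ∈ s, mulE (X i) v :=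
  map_sum (⟨⟨fun X => mulE X v, zero_mulE v⟩, fun X Y => add_mulE X Y v⟩ :
    Matrix (Fin a) (Fin b) ℝ →+ EuclideanSpace ℝ (Fin a)) X s

lemma lag_of_le {a : ℕ} (z : ℕ → EuclideanSpace ℝ (Fin a)) {t j : ℕ} (h : t ≤ j) :
    lag z t j = 0 := if_neg (not_lt.2 h)

lemma lag_of_lt {a : ℕ} (z : ℕ → EuclideanSpace ℝ (Fin a)) {t j : ℕ} (h : j < t) :
    lag z t j = z (t - j) := if_pos h

lemma norm_lag_le {a : ℕ} {z : ℕ → EuclideanSpace ℝ (Fin a)} {T : ℕ} {R : ℝ} (hR : 0 ≤ R)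
    (hz : ∀ t, 1 ≤ t → t ≤ T → ‖z t‖ ≤ R) {t : ℕ} (ht : t ≤ T) (j : ℕ) : ‖lag z t j‖ ≤ R := by
  rcases lt_or_ge j t with h | h
  · rw [lag_of_lt z h]
    exact hz _ (by omega) (by omega)
  · rw [lag_of_le z h, norm_zero]
    exact hR

/-- The response of the output to the input `i` steps earlier. -/
def LDS.response {n m d : ℕ} (S : LDS n m d) (i : ℕ) : Matrix (Fin m) (Fin n) ℝ :=
  S.C * S.A ^ i * S.B + if i = 0 then S.D else 0

lemma LDS.state_eq {n m d : ℕ} (S : LDS n m d) (x : ℕ → EuclideanSpace ℝ (Fin n)) (t : ℕ) :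
    S.state x t = ∑ i ∈ range t, mulE (S.A ^ i * S.B) (x (t - i)) := by
  induction t with
  | zero => simp [LDS.state]
  | succ t ih =>
    rw [LDS.state, ih, sum_range_succ', mulE_sum]
    congr 1
    · refine sum_congr rfl fun i _ => ?_
      rw [← mulE_mul, ← Matrix.mul_assoc, ← pow_succ']
      congr 2
      omega
    · simp

lemma LDS.output_eq {n m d : ℕ} (S : LDS n m d) (x : ℕ → EuclideanSpace ℝ (Fin n)) {t N : ℕ}
    (ht : 1 ≤ t) (hN : t ≤ N) :
    S.output x t = ∑ i ∈ range N, mulE (S.response i) (lag x t i) := by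
  have h1 : ∑ i ∈ range N, mulE (S.response i) (lag x t i) =
      ∑ i ∈ range t, mulE (S.response i) (lag x t i) := by
    refine (sum_subset (range_subset_range.2 hN) fun i _ hi => ?_).symm
    rw [lag_of_le x (by simpa using hi), mulE_zero]
  rw [h1, LDS.output, S.state_eq, mulE_sum]
  have h2 : mulE S.D (x t) = ∑ i ∈ range t, mulE (if i = 0 then S.D else 0) (lag x t i) := by
    rw [sum_eq_single 0]
    · rw [if_pos rfl, lag_of_lt x (by omega), Nat.sub_zero]
    · intro i _ hi
      rw [if_neg hi, zero_mulE]
    · intro h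
      exact absurd (mem_range.2 (by omega)) h
  rw [h2, ← sum_add_distrib]
  refine sum_congr rfl fun i hi => ?_
  rw [LDS.response, add_mulE, lag_of_lt x (mem_range.1 hi), ← mulE_mul, Matrix.mul_assoc]

lemma LDS.lag_output_eq {n m d : ℕ} (S : LDS n m d) (x : ℕ → EuclideanSpace ℝ (Fin n)) {t N : ℕ}
    (hN : t ≤ N) (u : ℕ) :
    lag (S.output x) t u =
      ∑ j ∈ range N, mulE (if u ≤ j then S.response (j - u) else 0) (lag x t j) := by
  rcases lt_or_ge u t with h | h
  · obtain ⟨M, rfl⟩ : ∃ M, N = u + M := ⟨N - u, by omega⟩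
    rw [lag_of_lt _ h, S.output_eq x (t := t - u) (N := M) (by omega) (by omega), sum_range_add]
    rw [sum_eq_zero (s := range u), zero_add]
    · refine sum_congr rfl fun i _ => ?_
      rw [if_pos (Nat.le_add_right u i), Nat.add_sub_cancel_left]
      congr 1
      unfold lag
      simp only [Nat.sub_sub, Nat.lt_sub_iff_add_lt']
    · intro j hj
      rw [if_neg (not_le.2 (mem_range.1 hj)), zero_mulE]
  · rw [lag_of_le _ h]
    refine (sum_eq_zero fun j _ => ?_).symm
    split_ifs with hj
    · rw [lag_of_le x (by omega), mulE_zero]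
    · rw [zero_mulE]

/-- The response after the autoregressive part with the coefficients of a monic polynomial `g` of
degree `L` is subtracted. -/
noncomputable def LDS.filtered {n m d : ℕ} (S : LDS n m d) (g : Polynomial ℝ) (L j : ℕ) :
    Matrix (Fin m) (Fin n) ℝ :=
  ∑ u ∈ range (L + 1), g.coeff (L - u) • if u ≤ j then S.response (j - u) else 0

/-- Weighting the lagged outputs by the coefficients of `g` and exchanging sums convolves the
responses with `g`; the leading coefficient 1 isolates the current output. Lags up to `L` are left
to `P`, later ones to the filters. -/
lemma LDS.output_eq_filtered {n m d : ℕ} (S : LDS n m d) {g : Polynomial ℝ} {L : ℕ}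
    (hg : g.coeff L = 1) (x : ℕ → EuclideanSpace ℝ (Fin n)) {t T : ℕ} (ht : 1 ≤ t) (htT : t ≤ T) :
    S.output x t = ∑ u : Fin L, (-g.coeff (L - ((u : ℕ) + 1))) • lag (S.output x) t ((u : ℕ) + 1) +
      ∑ j : Fin (L + 1), mulE (S.filtered g L j) (lag x t j) +
      ∑ u : Fin T, mulE (S.filtered g L (L + ((u : ℕ) + 1))) (lag x t (L + ((u : ℕ) + 1))) := by
  have h1 : ∑ u ∈ range (L + 1), g.coeff (L - u) • lag (S.output x) t u =
      ∑ j ∈ range (L + 1 + T), mulE (S.filtered g L j) (lag x t j) := by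
    simp only [LDS.filtered, sum_mulE, smul_mulE]
    rw [sum_comm]
    refine sum_congr rfl fun u _ => ?_
    rw [S.lag_output_eq x (N := L + 1 + T) (by omega) u, smul_sum]
  rw [sum_range_succ', Nat.sub_zero, hg, one_smul, lag_of_lt _ (by omega : 0 < t), Nat.sub_zero,
    sum_range_add, sum_range, sum_range, sum_range] at h1
  have e : ∀ u : Fin T, L + 1 + (u : ℕ) = L + ((u : ℕ) + 1) := fun u => by omega
  simp only [e] at h1
  rw [add_assoc, ← h1]
  simp only [neg_smul, sum_neg_distrib]
  abel

/-- Beyond lag `L` all shifts are present and none reaches response 0, so `D` drops out and `C A^v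
g(A) B` remains. -/
lemma LDS.filtered_add {n m d : ℕ} (S : LDS n m d) (g : Polynomial ℝ) (L : ℕ) {v : ℕ}
    (hv : 1 ≤ v) : S.filtered g L (L + v) =
      ∑ i ∈ range (L + 1), g.coeff i • (S.C * S.A ^ (v + i) * S.B) := by
  rw [LDS.filtered, ← sum_range_reflect]
  refine sum_congr rfl fun u hu => ?_
  rw [mem_range] at hu
  rw [LDS.response, if_pos (by omega), if_neg (by omega), add_zero]
  congr 3
  · omega
  · congr 1
    omega

end SpectralFiltering

namespace SpectralFiltering

open Finset

/-! ### The modes of a diagonalizable system -/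

lemma specNorm_nonneg {a b : ℕ} (X : Matrix (Fin a) (Fin b) ℝ) : 0 ≤ specNorm X := norm_nonneg _

lemma norm_mulE_le {a b : ℕ} (X : Matrix (Fin a) (Fin b) ℝ) (v : EuclideanSpace ℝ (Fin b)) :
    ‖mulE X v‖ ≤ specNorm X * ‖v‖ :=
  (LinearMap.toContinuousLinearMap (Matrix.toEuclideanLin X)).le_opNorm v

lemma norm_mulE_transpose_le {a b : ℕ} (X : Matrix (Fin a) (Fin b) ℝ)
    (v : EuclideanSpace ℝ (Fin a)) : ‖mulE X.transpose v‖ ≤ specNorm X * ‖v‖ := by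
  set w := mulE X.transpose v with hw
  have h1 : ‖w‖ ^ 2 = inner ℝ v (mulE X w) := by
    rw [EuclideanSpace.norm_sq_eq, PiLp.inner_apply]
    have e1 : ∀ j, ‖w j‖ ^ 2 = ∑ i, X i j * v i * w j := fun j => by
      rw [Real.norm_eq_abs, sq_abs, sq]
      conv_lhs => rw [hw, mulE_apply, sum_mul]
      rfl
    simp only [e1]
    rw [sum_comm]
    refine sum_congr rfl fun i _ => ?_
    simp only [mulE_apply, RCLike.inner_apply, conj_trivial, sum_mul]
    exact sum_congr rfl fun j _ => by ring
  have h2 : ‖w‖ ^ 2 ≤ ‖v‖ * (specNorm X * ‖w‖) :=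
    h1.le.trans ((real_inner_le_norm _ _).trans
      (mul_le_mul_of_nonneg_left (norm_mulE_le X w) (norm_nonneg _)))
  rcases (norm_nonneg w).eq_or_lt with h | h
  · rw [← h]
    exact mul_nonneg (specNorm_nonneg X) (norm_nonneg _)
  · nlinarith

lemma norm_complex_mulVec_le {a b : ℕ} {X : Matrix (Fin a) (Fin b) ℝ} {s : ℝ} (hs : 0 ≤ s)
    (hX : ∀ v, ‖mulE X v‖ ≤ s * ‖v‖) (z : Fin b → ℂ) :
    ‖(WithLp.toLp 2 fun i => ∑ j, (X i j : ℂ) * z j : EuclideanSpace ℂ (Fin a))‖ ≤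
      s * ‖(WithLp.toLp 2 z : EuclideanSpace ℂ (Fin b))‖ := by
  refine abs_le_of_sq_le_sq' ?_ (mul_nonneg hs (norm_nonneg _)) |>.2
  have key : ∀ v : Fin b → ℝ, ∑ i, (∑ j, X i j * v j) ^ 2 ≤ s ^ 2 * ∑ j, v j ^ 2 := fun v => by
    have h := pow_le_pow_left₀ (norm_nonneg _) (hX (WithLp.toLp 2 v)) 2
    rw [mul_pow, EuclideanSpace.norm_sq_eq, EuclideanSpace.norm_sq_eq] at h
    simpa [mulE_apply] using h
  have h1 := key fun j => (z j).re
  have h2 := key fun j => (z j).im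
  rw [mul_pow, EuclideanSpace.norm_sq_eq, EuclideanSpace.norm_sq_eq]
  simp only [Complex.sq_norm, Complex.normSq_apply, Complex.re_sum, Complex.im_sum,
    Complex.re_ofReal_mul, Complex.im_ofReal_mul, ← sq, sum_add_distrib, mul_add]
  linarith

/-- Cauchy-Schwarz over the modes: this is how the Frobenius condition on the diagonalization
becomes an `ℓ¹` bound on the rank-one pieces. -/
lemma sum_norm_col_mul_norm_row_le {d : ℕ} (X Y : Matrix (Fin d) (Fin d) ℂ) :
    ∑ l, ‖(WithLp.toLp 2 fun i => X i l : EuclideanSpace ℂ (Fin d))‖ *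
      ‖(WithLp.toLp 2 fun j => Y l j : EuclideanSpace ℂ (Fin d))‖ ≤ frobC X * frobC Y := by
  have h := sum_mul_sq_le_sq_mul_sq univ
    (fun l => ‖(WithLp.toLp 2 fun i => X i l : EuclideanSpace ℂ (Fin d))‖)
    (fun l => ‖(WithLp.toLp 2 fun j => Y l j : EuclideanSpace ℂ (Fin d))‖)
  have hX : ∑ l, ‖(WithLp.toLp 2 fun i => X i l : EuclideanSpace ℂ (Fin d))‖ ^ 2 =
      frobC X ^ 2 := by
    rw [frobC, Real.sq_sqrt (sum_nonneg fun _ _ => sum_nonneg fun _ _ => sq_nonneg _), sum_comm]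
    exact sum_congr rfl fun l _ => EuclideanSpace.norm_sq_eq _
  have hY : ∑ l, ‖(WithLp.toLp 2 fun j => Y l j : EuclideanSpace ℂ (Fin d))‖ ^ 2 =
      frobC Y ^ 2 := by
    rw [frobC, Real.sq_sqrt (sum_nonneg fun _ _ => sum_nonneg fun _ _ => sq_nonneg _)]
    exact sum_congr rfl fun l _ => EuclideanSpace.norm_sq_eq _
  rw [hX, hY, ← mul_pow] at h
  exact (abs_le_of_sq_le_sq' h (mul_nonneg (Real.sqrt_nonneg _) (Real.sqrt_nonneg _))).2

/-- The responses of an admissible system as sums over its eigenvalues. -/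
lemma LDS.Obeys.exists_modes {n m d : ℕ} {S : LDS n m d} {RTheta RPsi R1 : ℝ} {τ : ℕ}
    (h : S.Obeys RTheta RPsi R1 τ) (hR : 0 ≤ RTheta) :
    ∃ (lam : Fin d → ℂ) (p : Fin d → EuclideanSpace ℂ (Fin m))
      (q : Fin d → EuclideanSpace ℂ (Fin n)),
      (∀ l, lam l ∈ spectrum ℂ (S.A.map (algebraMap ℝ ℂ))) ∧
      ∑ l, ‖p l‖ * ‖q l‖ ≤ RTheta ^ 2 * RPsi ∧
      ∀ i a b, (((S.C * S.A ^ i * S.B) a b : ℝ) : ℂ) = ∑ l, lam l ^ i * (p l a * q l b) := by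
  obtain ⟨Psi, PsiInv, lam, h1, h2, hA, hPsi⟩ := h.diagonalizable
  refine ⟨lam, fun l => WithLp.toLp 2 fun a => ∑ j, (S.C a j : ℂ) * Psi j l,
    fun l => WithLp.toLp 2 fun b => ∑ j, (S.B.transpose b j : ℂ) * PsiInv l j, ?_, ?_, ?_⟩
  · intro l
    have := spectrum.units_conjugate (R := ℂ) (a := Matrix.diagonal lam)
      (u := ⟨Psi, PsiInv, h1, h2⟩)
    simp only [Units.inv_mk] at this
    rw [hA, this, spectrum_diagonal]
    exact Set.mem_range_self l
  · have hp : ∀ l, ‖(WithLp.toLp 2 fun a => ∑ j, (S.C a j : ℂ) * Psi j l :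
        EuclideanSpace ℂ (Fin m))‖ ≤
        RTheta * ‖(WithLp.toLp 2 fun j => Psi j l : EuclideanSpace ℂ (Fin d))‖ := fun l =>
      norm_complex_mulVec_le hR (fun v => (norm_mulE_le S.C v).trans
        (mul_le_mul_of_nonneg_right h.normC (norm_nonneg _))) _
    have hq : ∀ l, ‖(WithLp.toLp 2 fun b => ∑ j, (S.B.transpose b j : ℂ) * PsiInv l j :
        EuclideanSpace ℂ (Fin n))‖ ≤
        RTheta * ‖(WithLp.toLp 2 fun j => PsiInv l j : EuclideanSpace ℂ (Fin d))‖ := fun l =>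
      norm_complex_mulVec_le hR (fun v => (norm_mulE_transpose_le S.B v).trans
        (mul_le_mul_of_nonneg_right h.normB (norm_nonneg _))) _
    calc _ ≤ ∑ l, RTheta ^ 2 * (‖(WithLp.toLp 2 fun j => Psi j l : EuclideanSpace ℂ (Fin d))‖ *
          ‖(WithLp.toLp 2 fun j => PsiInv l j : EuclideanSpace ℂ (Fin d))‖) :=
          sum_le_sum fun l _ => (mul_le_mul (hp l) (hq l) (norm_nonneg _)
            (mul_nonneg hR (norm_nonneg _))).trans_eq (by ring)
      _ ≤ _ := by
          rw [← mul_sum]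
          exact mul_le_mul_of_nonneg_left ((sum_norm_col_mul_norm_row_le _ _).trans hPsi)
            (sq_nonneg _)
  · intro i a b
    have hpow : (S.A ^ i).map (algebraMap ℝ ℂ) =
        Psi * Matrix.diagonal (fun l => lam l ^ i) * PsiInv := by
      rw [Matrix.map_pow, hA]
      have e : Psi * Matrix.diagonal lam * PsiInv =
          ((⟨Psi, PsiInv, h1, h2⟩ : (Matrix (Fin d) (Fin d) ℂ)ˣ) : Matrix (Fin d) (Fin d) ℂ) *
            Matrix.diagonal lam *
            ((⟨Psi, PsiInv, h1, h2⟩ : (Matrix (Fin d) (Fin d) ℂ)ˣ)⁻¹ : (Matrix (Fin d) (Fin d) ℂ)ˣ) :=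
        rfl
      rw [e, Units.conj_pow, Matrix.diagonal_pow]
      rfl
    have hC : (((S.C * S.A ^ i * S.B) a b : ℝ) : ℂ) =
        (S.C.map (algebraMap ℝ ℂ) * (S.A ^ i).map (algebraMap ℝ ℂ) *
          S.B.map (algebraMap ℝ ℂ)) a b := by
      rw [← Matrix.map_mul, ← Matrix.map_mul]
      rfl
    have e2 : S.C.map (algebraMap ℝ ℂ) * (Psi * Matrix.diagonal (fun l => lam l ^ i) * PsiInv) *
        S.B.map (algebraMap ℝ ℂ) = (S.C.map (algebraMap ℝ ℂ) * Psi) *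
          Matrix.diagonal (fun l => lam l ^ i) * (PsiInv * S.B.map (algebraMap ℝ ℂ)) := by
      simp only [Matrix.mul_assoc]
    rw [hC, hpow, e2, Matrix.mul_apply]
    refine sum_congr rfl fun l _ => ?_
    rw [Matrix.mul_diagonal, Matrix.mul_apply, Matrix.mul_apply]
    have e3 : ∑ j, PsiInv l j * S.B.map (algebraMap ℝ ℂ) j b =
        ∑ j, (S.B.transpose b j : ℂ) * PsiInv l j :=
      sum_congr rfl fun j _ => mul_comm _ _
    rw [e3, mul_comm (∑ j, _) (lam l ^ i), mul_assoc]
    rfl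

lemma LDS.Obeys.norm_le_one {n m d : ℕ} {S : LDS n m d} {RTheta RPsi R1 : ℝ} {τ : ℕ}
    (h : S.Obeys RTheta RPsi R1 τ) {z : ℂ} (hz : z ∈ spectrum ℂ (S.A.map (algebraMap ℝ ℂ))) :
    ‖z‖ ≤ 1 := by
  have h1 : (‖z‖₊ : ENNReal) ≤ 1 :=
    (le_iSup₂ (f := fun k (_ : k ∈ spectrum ℂ (S.A.map (algebraMap ℝ ℂ))) =>
      (‖k‖₊ : ENNReal)) z hz).trans h.stable
  exact_mod_cast h1

/-! ### Norms of sums over modes -/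

/-- The triangle inequality in a Hilbert space. Assuming only a bound on `|Y i|` lets it serve for
real and for imaginary parts. -/
lemma sqrt_sum_sq_le_sum {ι : Type*} [Fintype ι] {d : ℕ} (w : Fin d → ℂ)
    (V : Fin d → EuclideanSpace ℂ ι) (Y : ι → ℝ) (hY : ∀ i, |Y i| ≤ ‖∑ l, w l * V l i‖) :
    √(∑ i, Y i ^ 2) ≤ ∑ l, ‖w l‖ * ‖V l‖ := by
  have h1 : √(∑ i, Y i ^ 2) ≤ ‖∑ l, w l • V l‖ := by
    refine Real.sqrt_le_iff.2 ⟨norm_nonneg _, ?_⟩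
    rw [EuclideanSpace.norm_sq_eq]
    refine sum_le_sum fun i _ => ?_
    rw [← sq_abs]
    refine pow_le_pow_left₀ (abs_nonneg _) ((hY i).trans_eq ?_) 2
    simp
  refine h1.trans ((norm_sum_le _ _).trans_eq ?_)
  exact sum_congr rfl fun l _ => norm_smul _ _

lemma norm_tensor {ι ι' : Type*} [Fintype ι] [Fintype ι'] (f : EuclideanSpace ℂ ι)
    (g : EuclideanSpace ℂ ι') :
    ‖(WithLp.toLp 2 fun i => f i.1 * g i.2 : EuclideanSpace ℂ (ι × ι'))‖ = ‖f‖ * ‖g‖ := by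
  have h : ‖(WithLp.toLp 2 fun i => f i.1 * g i.2 : EuclideanSpace ℂ (ι × ι'))‖ ^ 2 =
      (‖f‖ * ‖g‖) ^ 2 := by
    rw [mul_pow, EuclideanSpace.norm_sq_eq, EuclideanSpace.norm_sq_eq, EuclideanSpace.norm_sq_eq,
      sum_mul_sum, Fintype.sum_prod_type]
    exact sum_congr rfl fun i _ => sum_congr rfl fun j _ => by rw [norm_mul, mul_pow]
  exact (pow_left_inj₀ (norm_nonneg _) (by positivity) two_ne_zero).1 h

/-! ### Matrices as Euclidean vectors -/

lemma frobSq_nonneg {a b : ℕ} (X : Matrix (Fin a) (Fin b) ℝ) : 0 ≤ frobSq X :=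
  sum_nonneg fun _ _ => sum_nonneg fun _ _ => sq_nonneg _

/-- The entries of a matrix as a Euclidean vector. -/
def entries {a b : ℕ} (X : Matrix (Fin a) (Fin b) ℝ) : EuclideanSpace ℝ (Fin a × Fin b) :=
  WithLp.toLp 2 fun i => X i.1 i.2

lemma sqrt_frobSq {a b : ℕ} (X : Matrix (Fin a) (Fin b) ℝ) : √(frobSq X) = ‖entries X‖ := by
  rw [EuclideanSpace.norm_eq, Fintype.sum_prod_type, frobSq]
  simp [entries]

lemma entries_add {a b : ℕ} (X Y : Matrix (Fin a) (Fin b) ℝ) :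
    entries (X + Y) = entries X + entries Y := rfl

lemma entries_zero {a b : ℕ} : entries (0 : Matrix (Fin a) (Fin b) ℝ) = 0 := rfl

lemma entries_smul {a b : ℕ} (c : ℝ) (X : Matrix (Fin a) (Fin b) ℝ) :
    entries (c • X) = c • entries X := rfl

lemma norm_entries_sum_le {a b : ℕ} {ι : Type*} (s : Finset ι)
    (X : ι → Matrix (Fin a) (Fin b) ℝ) : ‖entries (∑ i ∈ s, X i)‖ ≤ ∑ i ∈ s, ‖entries (X i)‖ := by
  have : entries (∑ i ∈ s, X i) = ∑ i ∈ s, entries (X i) :=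
    map_sum (⟨⟨entries, entries_zero⟩, entries_add⟩ : _ →+ EuclideanSpace ℝ (Fin a × Fin b)) X s
  rw [this]
  exact norm_sum_le _ _

lemma norm_entries_le_specNorm {a b : ℕ} (X : Matrix (Fin a) (Fin b) ℝ) :
    ‖entries X‖ ≤ √b * specNorm X := by
  rw [← sqrt_frobSq]
  refine Real.sqrt_le_iff.2 ⟨mul_nonneg (Real.sqrt_nonneg _) (specNorm_nonneg X), ?_⟩
  rw [mul_pow, Real.sq_sqrt (Nat.cast_nonneg _), frobSq, sum_comm]
  refine (sum_le_card_nsmul _ _ (specNorm X ^ 2) fun j _ => ?_).trans_eq (by simp)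
  have h := pow_le_pow_left₀ (norm_nonneg _) (norm_mulE_le X (EuclideanSpace.single j 1)) 2
  rw [PiLp.norm_single, norm_one, mul_one, EuclideanSpace.norm_sq_eq] at h
  simpa [mulE_apply, Pi.single_apply] using h

end SpectralFiltering

namespace SpectralFiltering

open Finset

/-! ### Representation of admissible systems -/

lemma one_sub_pow_le {r : ℝ} (hr : 0 ≤ r) (i : ℕ) : 1 - r ^ i ≤ i * (1 - r) := by
  have := one_add_mul_le_pow (a := r - 1) (by linarith) i
  rw [add_sub_cancel] at this
  linarith

/-- Subtracting the vanishing value at `ω` leaves the factors `r^i - 1`, each at most `L (1 - r)` in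
modulus. -/
lemma norm_sum_mul_pow_le {c : ℕ → ℝ} {L : ℕ} {R1 : ℝ}
    (hc : ∑ i ∈ range (L + 1), |c i| ≤ R1) {ω : ℂ} (hω : ‖ω‖ = 1)
    (h0 : ∑ i ∈ range (L + 1), (c i : ℂ) * ω ^ i = 0) {r : ℝ} (hr : 0 ≤ r) (hr1 : r ≤ 1) :
    ‖∑ i ∈ range (L + 1), (c i : ℂ) * (r * ω) ^ i‖ ≤ (1 - r) * (L * R1) := by
  have e : ∑ i ∈ range (L + 1), (c i : ℂ) * (r * ω) ^ i =
      ∑ i ∈ range (L + 1), (c i : ℂ) * ω ^ i * (((r ^ i - 1 : ℝ)) : ℂ) := by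
    rw [← sub_zero (∑ i ∈ range (L + 1), (c i : ℂ) * (r * ω) ^ i), ← h0, ← sum_sub_distrib]
    refine sum_congr rfl fun i _ => ?_
    push_cast
    ring
  rw [e]
  refine (norm_sum_le _ _).trans ?_
  calc _ ≤ ∑ i ∈ range (L + 1), |c i| * (L * (1 - r)) := by
        refine sum_le_sum fun i hi => ?_
        rw [norm_mul, norm_mul, norm_pow, hω, one_pow, mul_one, Complex.norm_real,
          Complex.norm_real, Real.norm_eq_abs, Real.norm_eq_abs]
        refine mul_le_mul_of_nonneg_left ?_ (abs_nonneg _)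
        rw [abs_of_nonpos (sub_nonpos.2 (pow_le_one₀ hr hr1)), neg_sub]
        refine (one_sub_pow_le hr i).trans (mul_le_mul_of_nonneg_right ?_ (by linarith))
        exact_mod_cast Nat.lt_succ_iff.1 (mem_range.1 hi)
    _ = (∑ i ∈ range (L + 1), |c i|) * (L * (1 - r)) := (sum_mul _ _ _).symm
    _ ≤ R1 * (L * (1 - r)) :=
        mul_le_mul_of_nonneg_right hc (mul_nonneg (Nat.cast_nonneg _) (by linarith))
    _ = _ := by ring

/-- The autoregressive part turns the powers of an eigenvalue into a multiple of a filter. -/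
lemma exists_mode_decay {c : ℕ → ℝ} {L : ℕ} {R1 : ℝ}
    (hc : ∑ i ∈ range (L + 1), |c i| ≤ R1) {ω : ℂ} (hω : ‖ω‖ = 1)
    (h0 : ∑ i ∈ range (L + 1), (c i : ℂ) * ω ^ i = 0) {r : ℝ} (hr : 0 ≤ r) (hr1 : r ≤ 1) :
    ∃ w : ℂ, ‖w‖ ≤ L * R1 ∧ ∀ u : ℕ,
      (r * ω) ^ (u + 1) * ∑ i ∈ range (L + 1), (c i : ℂ) * (r * ω) ^ i =
        ω ^ (u + 1) * (w * decay r u) := by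
  have hb := norm_sum_mul_pow_le hc hω h0 hr hr1
  have hR : 0 ≤ (L : ℝ) * R1 :=
    mul_nonneg (Nat.cast_nonneg _) ((sum_nonneg fun _ _ => abs_nonneg _).trans hc)
  set G := ∑ i ∈ range (L + 1), (c i : ℂ) * (r * ω) ^ i with hG
  rcases hr1.eq_or_lt with h | h
  -- For `r = 1` the bound forces `G = 0`, which matches the vanishing filter.
  · refine ⟨0, by simpa using hR, fun u => ?_⟩
    rw [h, sub_self, zero_mul] at hb
    rw [norm_le_zero_iff.1 hb]
    simp
  · have hp : 0 < 1 - r := by linarith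
    have hpc : (1 - r : ℂ) ≠ 0 := by exact_mod_cast hp.ne'
    refine ⟨r * G / (1 - r : ℝ), ?_, fun u => ?_⟩
    · rw [norm_div, norm_mul, Complex.norm_real, Complex.norm_real, Real.norm_of_nonneg hr,
        Real.norm_of_nonneg hp.le, div_le_iff₀ hp]
      calc r * ‖G‖ ≤ 1 * ‖G‖ := mul_le_mul_of_nonneg_right hr1 (norm_nonneg _)
        _ ≤ _ := by linarith
    · simp only [decay]
      push_cast
      field_simp
      ring

/-- The phase combination of `ω^(u+1)` multiplies the eigenbasis expansion of `decay ‖z‖`. The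
coefficients therefore factor as `w p * F h`, which keeps the mixed norm a product of the two
bounds. -/
lemma IsHankelEigensystem.exists_mode_filters {T W : ℕ} {σ : Fin T → ℝ} {φ : Fin T → Fin T → ℝ}
    (H : IsHankelEigensystem T σ φ) (hT : 1 ≤ T) (hW : 3 * T ≤ W) {c : ℕ → ℝ} {L : ℕ} {R1 : ℝ}
    (hc : ∑ i ∈ range (L + 1), |c i| ≤ R1) {ω : ℂ} (hω : ‖ω‖ = 1)
    (h0 : ∑ i ∈ range (L + 1), (c i : ℂ) * ω ^ i = 0) {z : ℂ} (hz : z = (‖z‖ : ℂ) * ω)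
    (hz1 : ‖z‖ ≤ 1) :
    ∃ (w : Fin W → ℂ) (F : EuclideanSpace ℂ (Fin T)), ∑ p, ‖w p‖ ≤ 2 * (L * R1) ∧ ‖F‖ ≤ 10 ∧
      ∀ u : Fin T, z ^ ((u : ℕ) + 1) * ∑ i ∈ range (L + 1), (c i : ℂ) * z ^ i =
        ∑ p : Fin W, ∑ h : Fin T, ((σ h ^ (1 / 4 : ℝ) * φ h u : ℝ) : ℂ) *
          Complex.exp ((2 * Real.pi * ((u : ℕ) + 1 : ℝ) * (p : ℕ) / W : ℝ) * Complex.I) *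
          (w p * F h) := by
  obtain ⟨w0, hw0, hw⟩ := exists_mode_decay hc hω h0 (norm_nonneg z) hz1
  obtain ⟨e, he1, he⟩ := exists_phase_combination hT hW hω
  rw [← hz] at hw
  set F := filterCoord σ φ fun u => decay ‖z‖ u with hF
  have hR : 0 ≤ (L : ℝ) * R1 :=
    mul_nonneg (Nat.cast_nonneg _) ((sum_nonneg fun _ _ => abs_nonneg _).trans hc)
  have hFn : ‖F‖ ≤ 10 := by
    rcases hz1.eq_or_lt with h | h
    · have : (fun u : Fin T => decay ‖z‖ u) = 0 := by
        funext u
        simp [decay, h]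
      rw [hF, this, map_zero, norm_zero]
      norm_num
    · exact H.norm_filterCoord_decay_le (norm_nonneg _) h
  refine ⟨fun p => w0 * e p, WithLp.toLp 2 fun h => (F h : ℂ), ?_, ?_, fun u => ?_⟩
  · simp only [norm_mul]
    rw [← mul_sum, ← sum_range fun p => ‖e p‖, mul_comm]
    exact mul_le_mul he1 hw0 (norm_nonneg _) zero_le_two
  · refine le_trans (le_of_eq ?_) hFn
    rw [EuclideanSpace.norm_eq, EuclideanSpace.norm_eq]
    simp
  · rw [hw u, he ((u : ℕ) + 1) (by omega) (by omega), H.decay_eq (norm_nonneg _) hz1 u,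
      sum_range fun p => e p * _, sum_mul]
    refine sum_congr rfl fun p _ => ?_
    push_cast
    rw [mul_sum, mul_sum]
    refine sum_congr rfl fun h _ => ?_
    ring

lemma sum_abs_coeff_X_pow_mul (p : Polynomial ℝ) (τ k : ℕ) :
    ∑ i ∈ range (τ + k + 1), |(Polynomial.X ^ k * p).coeff i| =
      ∑ i ∈ range (τ + 1), |p.coeff i| := by
  rw [show τ + k + 1 = k + (τ + 1) by ring, sum_range_add]
  rw [sum_eq_zero, zero_add]
  · refine sum_congr rfl fun i _ => ?_
    rw [add_comm k i, Polynomial.coeff_X_pow_mul]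
  · intro i hi
    rw [Polynomial.coeff_X_pow_mul', if_neg (not_le.2 (mem_range.1 hi)), abs_zero]

lemma sum_coeff_mul_pow (p : Polynomial ℝ) {L : ℕ} (hL : p.natDegree ≤ L) (z : ℂ) :
    ∑ i ∈ range (L + 1), (p.coeff i : ℂ) * z ^ i = Polynomial.aeval z p := by
  rw [Polynomial.aeval_eq_sum_range' (Nat.lt_succ_of_le hL)]
  exact sum_congr rfl fun i _ => by rw [Complex.real_smul]

lemma norm_entries_response_le {n m d : ℕ} {S : LDS n m d} {RTheta RPsi R1 : ℝ} {τ : ℕ}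
    (h : S.Obeys RTheta RPsi R1 τ) (hR : 0 ≤ RTheta) (i : ℕ) :
    ‖entries (S.response i)‖ ≤ RTheta ^ 2 * RPsi + √n * RTheta := by
  obtain ⟨lam, p, q, hlam, hpq, hr⟩ := h.exists_modes hR
  rw [LDS.response, entries_add]
  refine (norm_add_le _ _).trans (add_le_add ?_ ?_)
  · refine le_trans ?_ hpq
    have := sqrt_sum_sq_le_sum (fun l => lam l ^ i)
      (fun l => WithLp.toLp 2 fun j : Fin m × Fin n => p l j.1 * q l j.2)
      (fun j => (S.C * S.A ^ i * S.B) j.1 j.2) (fun j => by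
        rw [← hr, Complex.norm_real, Real.norm_eq_abs])
    rw [EuclideanSpace.norm_eq]
    simp only [entries, Real.norm_eq_abs, sq_abs]
    refine this.trans (sum_le_sum fun l _ => ?_)
    rw [norm_tensor, norm_pow]
    exact mul_le_of_le_one_left (by positivity) (pow_le_one₀ (norm_nonneg _) (h.norm_le_one (hlam l)))
  · split_ifs
    · exact (norm_entries_le_specNorm _).trans
        (mul_le_mul_of_nonneg_left h.normD (Real.sqrt_nonneg _))
    · rw [entries_zero, norm_zero]
      positivity

lemma norm_tensor_three {ι ι' ι'' : Type*} [Fintype ι] [Fintype ι'] [Fintype ι'']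
    (f : EuclideanSpace ℂ ι) (g : EuclideanSpace ℂ ι') (e : EuclideanSpace ℂ ι'') :
    ‖(WithLp.toLp 2 fun i => f i.1 * (g i.2.1 * e i.2.2) : EuclideanSpace ℂ (ι × ι' × ι''))‖ =
      ‖f‖ * (‖g‖ * ‖e‖) := by
  set v : EuclideanSpace ℂ (ι' × ι'') := WithLp.toLp 2 fun i => g i.1 * e i.2 with hv
  have hvi : ∀ i, v i = g i.1 * e i.2 := fun _ => rfl
  have h := norm_tensor f v
  simp only [hvi] at h
  rw [h, hv, norm_tensor]

/-- At each phase, the triangle inequality over the modes bounds a sum of rank-one tensors; summing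
over phases first then uses only the `ℓ¹` bound on `w l`. -/
lemma mixedNorm_one_le_of_modes {n m d W k : ℕ} {w : Fin d → Fin W → ℂ}
    {F : Fin d → EuclideanSpace ℂ (Fin k)} {p : Fin d → EuclideanSpace ℂ (Fin m)}
    {q : Fin d → EuclideanSpace ℂ (Fin n)} {A B X : ℝ} (hw : ∀ l, ∑ ph, ‖w l ph‖ ≤ A)
    (hF : ∀ l, ‖F l‖ ≤ B) (hpq : ∑ l, ‖p l‖ * ‖q l‖ ≤ X) (hAB : 0 ≤ A * B)
    {Y : Fin W → Fin k → Matrix (Fin m) (Fin n) ℝ}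
    (hY : ∀ ph h a b, |Y ph h a b| ≤ ‖∑ l, w l ph * (F l h * (p l a * q l b))‖) :
    mixedNorm 1 Y ≤ A * B * X := by
  rw [mixedNorm, lqNorm_one]
  have h1 : ∀ ph, |√(∑ h, ∑ a, ∑ b, Y ph h a b ^ 2)| ≤
      ∑ l, ‖w l ph‖ * (B * (‖p l‖ * ‖q l‖)) := by
    intro ph
    rw [abs_of_nonneg (Real.sqrt_nonneg _)]
    have h2 := sqrt_sum_sq_le_sum (fun l => w l ph)
      (fun l => WithLp.toLp 2 fun j : Fin k × Fin m × Fin n => F l j.1 * (p l j.2.1 * q l j.2.2))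
      (fun j => Y ph j.1 j.2.1 j.2.2) (fun j => hY _ _ _ _)
    simp only [Fintype.sum_prod_type] at h2
    refine h2.trans (sum_le_sum fun l _ => mul_le_mul_of_nonneg_left ?_ (norm_nonneg _))
    rw [norm_tensor_three]
    exact mul_le_mul_of_nonneg_right (hF l) (by positivity)
  refine (sum_le_sum fun ph _ => h1 ph).trans ?_
  rw [sum_comm]
  simp only [← sum_mul]
  calc _ ≤ ∑ l, A * (B * (‖p l‖ * ‖q l‖)) := sum_le_sum fun l _ =>
        mul_le_mul_of_nonneg_right (hw l)
          (mul_nonneg ((norm_nonneg _).trans (hF l)) (by positivity))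
    _ = A * B * ∑ l, ‖p l‖ * ‖q l‖ := by
        rw [mul_sum]
        exact sum_congr rfl fun l _ => by ring
    _ ≤ _ := mul_le_mul_of_nonneg_left hpq hAB

/-- Every admissible system is a pseudo-LDS of bounded norm. -/
theorem LDS.Obeys.exists_pseudoLDS {n m d τ T W : ℕ} {σ : Fin T → ℝ} {φ : Fin T → Fin T → ℝ}
    (H : IsHankelEigensystem T σ φ) (hn : 1 ≤ n) (hT : 1 ≤ T) (hW : 3 * T ≤ W)
    {S : LDS n m d} {RTheta RPsi R1 : ℝ} (h : S.Obeys RTheta RPsi R1 τ) (hR : 1 ≤ RTheta)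
    (hRP : 1 ≤ RPsi) (hR1 : 1 ≤ R1) :
    ∃ Q : PseudoLDS n m W T (τ + 8),
      Q.compNorm ≤ 50 * (τ + 9) * √n * (R1 * RTheta ^ 2 * RPsi) ∧
      ∀ (x : ℕ → EuclideanSpace ℝ (Fin n)) (t : ℕ), 1 ≤ t → t ≤ T →
        Q.predict le_rfl σ φ x (S.output x) t = S.output x t := by
  obtain ⟨f, hf, hfdeg, hfsum, hroot⟩ := h.phases
  set L := τ + 8 with hL
  -- The factor `X^8` preserves the coefficient sum and the roots, and makes the order at least 8,
  -- as needed for `expo L ≤ 2`.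
  set g : Polynomial ℝ := Polynomial.X ^ 8 * f with hg
  have hgm : g.Monic := (Polynomial.monic_X_pow 8).mul hf
  have hgdeg : g.natDegree = L := by
    rw [hg, (Polynomial.monic_X_pow 8).natDegree_mul hf, Polynomial.natDegree_X_pow, hfdeg, hL,
      add_comm]
  have hgL : g.coeff L = 1 := by rw [← hgdeg]; exact hgm.coeff_natDegree
  have hgsum : ∑ i ∈ range (L + 1), |g.coeff i| ≤ R1 := by
    rw [hL, hg, sum_abs_coeff_X_pow_mul]
    exact hfsum
  obtain ⟨lam, p, q, hlam, hpq, hr⟩ := h.exists_modes (zero_le_one.trans hR)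
  have hmode : ∀ l, ∃ (w : Fin W → ℂ) (F : EuclideanSpace ℂ (Fin T)),
      ∑ p, ‖w p‖ ≤ 2 * (L * R1) ∧ ‖F‖ ≤ 10 ∧
      ∀ u : Fin T, lam l ^ ((u : ℕ) + 1) * ∑ i ∈ range (L + 1), (g.coeff i : ℂ) * lam l ^ i =
        ∑ p : Fin W, ∑ h : Fin T, ((σ h ^ (1 / 4 : ℝ) * φ h u : ℝ) : ℂ) *
          Complex.exp ((2 * Real.pi * ((u : ℕ) + 1 : ℝ) * (p : ℕ) / W : ℝ) * Complex.I) *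
          (w p * F h) := by
    intro l
    obtain ⟨ω, hω, hlω, hω0⟩ := hroot _ (hlam l)
    refine H.exists_mode_filters hT hW hgsum hω ?_ hlω (h.norm_le_one (hlam l))
    rw [sum_coeff_mul_pow g hgdeg.le, hg, map_mul, hω0, mul_zero]
  choose w F hw hF hmode using hmode
  set K : Fin W → Fin T → Fin m → Fin n → ℂ := fun ph k a b =>
    ∑ l, w l ph * (F l k * (p l a * q l b)) with hK
  have hfilt : ∀ (u : Fin T) (a : Fin m) (b : Fin n),
      ((S.filtered g L (L + ((u : ℕ) + 1)) a b : ℝ) : ℂ) =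
        ∑ ph : Fin W, ∑ k : Fin T, ((σ k ^ (1 / 4 : ℝ) * φ k u : ℝ) : ℂ) *
          Complex.exp ((2 * Real.pi * ((u : ℕ) + 1 : ℝ) * (ph : ℕ) / W : ℝ) * Complex.I) *
          K ph k a b := by
    intro u a b
    have e1 : ((S.filtered g L (L + ((u : ℕ) + 1)) a b : ℝ) : ℂ) =
        ∑ l, (lam l ^ ((u : ℕ) + 1) * ∑ i ∈ range (L + 1), (g.coeff i : ℂ) * lam l ^ i) *
          (p l a * q l b) := by
      rw [S.filtered_add g L (by omega), Matrix.sum_apply]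
      simp only [Matrix.smul_apply, smul_eq_mul, Complex.ofReal_sum, Complex.ofReal_mul, hr]
      simp only [mul_sum, sum_mul]
      rw [sum_comm]
      refine sum_congr rfl fun l _ => sum_congr rfl fun i _ => ?_
      rw [pow_add _ ((u : ℕ) + 1)]
      ring
    rw [e1, sum_congr rfl fun l _ => by rw [hmode l u]]
    simp only [hK, sum_mul, mul_sum]
    rw [sum_comm]
    refine sum_congr rfl fun ph _ => ?_
    rw [sum_comm]
    exact sum_congr rfl fun k _ => sum_congr rfl fun l _ => by ring
  have hKn : ∀ (Y : Fin W → Fin T → Matrix (Fin m) (Fin n) ℝ),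
      (∀ ph k a b, |Y ph k a b| ≤ ‖K ph k a b‖) →
      mixedNorm 1 Y ≤ 20 * L * (R1 * RTheta ^ 2 * RPsi) := fun Y hY =>
    (mixedNorm_one_le_of_modes hw hF hpq (by positivity) hY).trans_eq (by ring)
  -- The real part of `exp(iθ) K` is `cos θ Re K - sin θ Im K`, whence the sign of the second block.
  -- The autoregressive coefficients change sign on moving to the other side.
  refine ⟨⟨fun ph k => Matrix.of fun a b => (K ph k a b).re,
    fun ph k => Matrix.of fun a b => -(K ph k a b).im,
    fun u => -g.coeff (L - ((u : ℕ) + 1)), fun j => S.filtered g L j⟩, ?_, ?_⟩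
  · have hM := hKn (fun ph k => Matrix.of fun a b => (K ph k a b).re)
      fun ph k a b => Complex.abs_re_le_norm _
    have hN := hKn (fun ph k => Matrix.of fun a b => -(K ph k a b).im) fun ph k a b => by
      rw [Matrix.of_apply, abs_neg]
      exact Complex.abs_im_le_norm _
    have hβ : lqNorm 1 (fun u : Fin L => -g.coeff (L - ((u : ℕ) + 1))) ≤ R1 := by
      rw [lqNorm_one]
      simp only [abs_neg]
      refine le_trans ?_ hgsum
      rw [← sum_range_reflect, sum_range_succ', ← sum_range fun u => |g.coeff (L - (u + 1))|]
      refine le_add_of_le_of_nonneg (le_of_eq (sum_congr rfl fun u hu => ?_)) (abs_nonneg _)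
      congr 2
    have hP : √(∑ j : Fin (L + 1), frobSq (S.filtered g L j)) ≤
        (L + 1) * (2 * √n * (R1 * RTheta ^ 2 * RPsi)) := by
      have h1n : (1 : ℝ) ≤ √n := Real.one_le_sqrt.2 (by exact_mod_cast hn)
      have hb : ∀ j : ℕ, ‖entries (S.filtered g L j)‖ ≤ 2 * √n * (R1 * RTheta ^ 2 * RPsi) := by
        intro j
        rw [LDS.filtered]
        refine (norm_entries_sum_le _ _).trans ?_
        have hX : RTheta ^ 2 * RPsi + √n * RTheta ≤ 2 * √n * (RTheta ^ 2 * RPsi) := by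
          have k1 : RTheta ≤ RTheta ^ 2 * RPsi := by nlinarith
          have k2 : 0 ≤ RTheta ^ 2 * RPsi := by positivity
          nlinarith
        calc _ ≤ ∑ u ∈ range (L + 1), |g.coeff (L - u)| * (2 * √n * (RTheta ^ 2 * RPsi)) := by
              refine sum_le_sum fun u _ => ?_
              rw [entries_smul, norm_smul, Real.norm_eq_abs]
              refine mul_le_mul_of_nonneg_left ?_ (abs_nonneg _)
              split_ifs
              · exact (norm_entries_response_le h (by linarith) _).trans hX
              · rw [entries_zero, norm_zero]
                positivity
          _ = (∑ i ∈ range (L + 1), |g.coeff i|) * (2 * √n * (RTheta ^ 2 * RPsi)) := by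
              rw [← sum_mul, ← sum_range_reflect (fun i => |g.coeff i|)]
              rfl
          _ ≤ R1 * (2 * √n * (RTheta ^ 2 * RPsi)) :=
              mul_le_mul_of_nonneg_right hgsum (by positivity)
          _ = _ := by ring
      refine Real.sqrt_le_iff.2 ⟨by positivity, ?_⟩
      have hb2 : ∀ j ∈ (univ : Finset (Fin (L + 1))), frobSq (S.filtered g L j) ≤
          (2 * √n * (R1 * RTheta ^ 2 * RPsi)) ^ 2 := fun j _ => by
        rw [← Real.sq_sqrt (frobSq_nonneg _), sqrt_frobSq]
        exact pow_le_pow_left₀ (norm_nonneg _) (hb j) 2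
      refine (sum_le_card_nsmul _ _ _ hb2).trans ?_
      rw [card_univ, Fintype.card_fin, nsmul_eq_mul, mul_pow ((L : ℝ) + 1)]
      push_cast
      refine mul_le_mul_of_nonneg_right ?_ (sq_nonneg _)
      nlinarith [(Nat.cast_nonneg L : (0 : ℝ) ≤ L)]
    have h1n : (1 : ℝ) ≤ √n := Real.one_le_sqrt.2 (by exact_mod_cast hn)
    set X := R1 * RTheta ^ 2 * RPsi with hX
    have hR1X : R1 ≤ X := by
      rw [hX, mul_assoc]
      exact le_mul_of_one_le_right (by linarith) (one_le_mul_of_one_le_of_one_le (one_le_pow₀ hR) hRP)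
    have hX0 : 0 ≤ X := by linarith
    have hLc : (L : ℝ) = τ + 8 := by rw [hL]; push_cast; ring
    have hXn : X ≤ √n * X := le_mul_of_one_le_left hX0 h1n
    have hτ : (0 : ℝ) ≤ τ := Nat.cast_nonneg _
    simp only [PseudoLDS.compNorm]
    rw [hLc] at hM hN hP
    have : (τ : ℝ) * X ≤ τ * (√n * X) := mul_le_mul_of_nonneg_left hXn hτ
    nlinarith
  · intro x t ht htT
    conv_rhs => rw [S.output_eq_filtered hgL x ht htT]
    rw [PseudoLDS.predict]
    congr 1
    have e : ∀ u : Fin T, S.filtered g L (L + ((u : ℕ) + 1)) = ∑ ph : Fin W, ∑ k : Fin T,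
        (σ k ^ (1 / 4 : ℝ) * φ k u) •
          (Real.cos (2 * Real.pi * ((u : ℕ) + 1 : ℝ) * (ph : ℕ) / W) •
              (Matrix.of fun a b => (K ph k a b).re : Matrix (Fin m) (Fin n) ℝ) +
            Real.sin (2 * Real.pi * ((u : ℕ) + 1 : ℝ) * (ph : ℕ) / W) •
              (Matrix.of fun a b => -(K ph k a b).im : Matrix (Fin m) (Fin n) ℝ)) := by
      intro u
      ext a b
      have h1 := congrArg Complex.re (hfilt u a b)
      rw [Complex.ofReal_re] at h1
      rw [h1, Matrix.sum_apply, Complex.re_sum]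
      refine sum_congr rfl fun ph _ => ?_
      rw [Matrix.sum_apply, Complex.re_sum]
      refine sum_congr rfl fun k _ => ?_
      rw [mul_assoc, Complex.re_ofReal_mul, Complex.mul_re, Complex.exp_ofReal_mul_I_re,
        Complex.exp_ofReal_mul_I_im]
      simp only [Matrix.smul_apply, Matrix.add_apply, Matrix.of_apply, smul_eq_mul]
      ring
    simp only [e, sum_mulE, smul_mulE, Fin.castLE_rfl, id]
    symm
    exact sum_comm.trans (sum_congr rfl fun ph _ => sum_comm)

end SpectralFiltering

namespace SpectralFiltering

open Finset

/-! ### The space of pseudo-LDS -/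

/-- The parameters of a pseudo-LDS as a normed space. -/
abbrev Params (n m W k L : ℕ) : Type :=
  (Fin W → EuclideanSpace ℝ (Fin k × Fin m × Fin n)) ×
    (Fin W → EuclideanSpace ℝ (Fin k × Fin m × Fin n)) × (Fin L → ℝ) ×
      EuclideanSpace ℝ (Fin (L + 1) × Fin m × Fin n)

variable {n m W k L T : ℕ}

/-- The pseudo-LDS with the given parameters. -/
def ofParams (v : Params n m W k L) : PseudoLDS n m W k L where
  M p h := Matrix.of fun a b => v.1 p (h, a, b)
  N p h := Matrix.of fun a b => v.2.1 p (h, a, b)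
  β := v.2.2.1
  P j := Matrix.of fun a b => v.2.2.2 (j, a, b)

/-- The parameters of a pseudo-LDS. -/
def toParams (Q : PseudoLDS n m W k L) : Params n m W k L :=
  (fun p => WithLp.toLp 2 fun i => Q.M p i.1 i.2.1 i.2.2,
    fun p => WithLp.toLp 2 fun i => Q.N p i.1 i.2.1 i.2.2, Q.β,
    WithLp.toLp 2 fun i => Q.P i.1 i.2.1 i.2.2)

/-- The norm `‖·‖_{2,q}` on a block of parameters. -/
noncomputable def blockNorm {ι E : Type*} [Fintype ι] [Norm E] (q : ℝ) (v : ι → E) : ℝ :=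
  lqNorm q fun i => ‖v i‖

lemma blockNorm_nonneg {ι E : Type*} [Fintype ι] [Norm E] (q : ℝ) (v : ι → E) :
    0 ≤ blockNorm q v := lqNorm_nonneg _ _

lemma sqrt_sum_three {ι ι' ι'' : Type*} [Fintype ι] [Fintype ι'] [Fintype ι'']
    (v : EuclideanSpace ℝ (ι × ι' × ι'')) : √(∑ h, ∑ a, ∑ b, v (h, a, b) ^ 2) = ‖v‖ := by
  rw [EuclideanSpace.norm_eq]
  simp only [Fintype.sum_prod_type, Real.norm_eq_abs, sq_abs]

lemma lqNorm_eq_blockNorm {ι : Type*} [Fintype ι] (q : ℝ) (v : ι → ℝ) :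
    lqNorm q v = blockNorm q v := by
  simp [blockNorm, lqNorm]

lemma compNorm_ofParams (v : Params n m W k L) : (ofParams v).compNorm =
    blockNorm 1 v.1 + blockNorm 1 v.2.1 + blockNorm 1 v.2.2.1 + ‖v.2.2.2‖ := by
  simp only [PseudoLDS.compNorm, mixedNorm, ofParams, Matrix.of_apply, frobSq, sqrt_sum_three,
    lqNorm_eq_blockNorm 1 v.2.2.1]
  rfl

lemma reg_ofParams (v : Params n m W k L) : (ofParams v).reg =
    blockNorm (expo W) v.1 ^ 2 + blockNorm (expo W) v.2.1 ^ 2 + blockNorm (expo L) v.2.2.1 ^ 2 +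
      ‖v.2.2.2‖ ^ 2 := by
  have e : ∑ j, frobSq ((ofParams v).P j) = ‖v.2.2.2‖ ^ 2 := by
    rw [← sqrt_sum_three, Real.sq_sqrt (sum_nonneg fun _ _ => sum_nonneg fun _ _ =>
      sum_nonneg fun _ _ => sq_nonneg _)]
    rfl
  rw [PseudoLDS.reg, e]
  simp only [mixedNorm, ofParams, Matrix.of_apply, sqrt_sum_three,
    lqNorm_eq_blockNorm _ v.2.2.1]
  rfl

lemma reg_ofParams_nonneg (v : Params n m W k L) : 0 ≤ (ofParams v).reg := by
  rw [reg_ofParams]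
  positivity

lemma blockNorm_zero {ι E : Type*} [Fintype ι] [NormedAddCommGroup E] {q : ℝ} (hq : 0 < q) :
    blockNorm q (0 : ι → E) = 0 := by
  simp [blockNorm, lqNorm, Real.zero_rpow hq.ne', hq.ne']

lemma blockNorm_one_add_le {ι E : Type*} [Fintype ι] [NormedAddCommGroup E] (v w : ι → E) :
    blockNorm 1 (v + w) ≤ blockNorm 1 v + blockNorm 1 w := by
  simp only [blockNorm, lqNorm_one, abs_norm, ← sum_add_distrib]
  exact sum_le_sum fun i _ => norm_add_le _ _

lemma blockNorm_smul {ι E : Type*} [Fintype ι] [NormedAddCommGroup E] [NormedSpace ℝ E] {q : ℝ}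
    (hq : 0 < q) {c : ℝ} (hc : 0 ≤ c) (v : ι → E) : blockNorm q (c • v) = c * blockNorm q v := by
  rw [blockNorm, blockNorm, ← lqNorm_smul hq hc]
  simp [norm_smul, abs_of_nonneg hc]

lemma continuous_blockNorm {ι E : Type*} [Fintype ι] [NormedAddCommGroup E] {q : ℝ} (hq : 0 < q) :
    Continuous (blockNorm q : (ι → E) → ℝ) := by
  unfold blockNorm lqNorm
  refine Continuous.rpow_const ?_ fun _ => Or.inr (by positivity)
  refine continuous_finsetSum _ fun i _ => ?_
  exact Continuous.rpow_const (by fun_prop) fun _ => Or.inr hq.le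

lemma norm_le_blockNorm_one {ι E : Type*} [Fintype ι] [NormedAddCommGroup E] (v : ι → E) :
    ‖v‖ ≤ blockNorm 1 v := by
  refine (pi_norm_le_iff_of_nonneg (blockNorm_nonneg _ _)).2 fun i => ?_
  simp only [blockNorm, lqNorm_one, abs_norm]
  exact single_le_sum (f := fun i => ‖v i‖) (fun _ _ => norm_nonneg _) (mem_univ i)

/-- The decision set as a set of parameters. -/
def paramSet (n m W k L : ℕ) (ρ : ℝ) : Set (Params n m W k L) :=
  {v | (ofParams v).compNorm ≤ ρ}

lemma zero_mem_paramSet {ρ : ℝ} (hρ : 0 ≤ ρ) : 0 ∈ paramSet n m W k L ρ := by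
  simp only [paramSet, Set.mem_ofPred_eq, compNorm_ofParams, Prod.fst_zero, Prod.snd_zero,
    blockNorm_zero one_pos, norm_zero]
  linarith

lemma midpoint_mem_paramSet {ρ : ℝ} {v w : Params n m W k L} (hv : v ∈ paramSet n m W k L ρ)
    (hw : w ∈ paramSet n m W k L ρ) : (1 / 2 : ℝ) • (v + w) ∈ paramSet n m W k L ρ := by
  simp only [paramSet, Set.mem_ofPred_eq, compNorm_ofParams, Prod.smul_fst, Prod.smul_snd,
    Prod.fst_add, Prod.snd_add] at *
  rw [blockNorm_smul one_pos (by norm_num), blockNorm_smul one_pos (by norm_num),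
    blockNorm_smul one_pos (by norm_num), norm_smul, Real.norm_of_nonneg (by norm_num)]
  have h1 := blockNorm_one_add_le v.1 w.1
  have h2 := blockNorm_one_add_le v.2.1 w.2.1
  have h3 := blockNorm_one_add_le v.2.2.1 w.2.2.1
  have h4 := norm_add_le v.2.2.2 w.2.2.2
  linarith

lemma isCompact_paramSet (ρ : ℝ) : IsCompact (paramSet n m W k L ρ) := by
  refine Metric.isCompact_of_isClosed_isBounded ?_ ?_
  · have : Continuous fun v : Params n m W k L => (ofParams v).compNorm := by
      simp only [compNorm_ofParams]
      have h1 := continuous_blockNorm (ι := Fin W) (E := EuclideanSpace ℝ (Fin k × Fin m × Fin n))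
        one_pos
      have h2 := continuous_blockNorm (ι := Fin L) (E := ℝ) one_pos
      fun_prop
    exact isClosed_le this continuous_const
  · refine (Metric.isBounded_closedBall (x := 0) (r := ρ)).subset fun v hv => ?_
    simp only [paramSet, Set.mem_ofPred_eq, compNorm_ofParams] at hv
    rw [mem_closedBall_zero_iff]
    have h1 := norm_le_blockNorm_one v.1
    have h2 := norm_le_blockNorm_one v.2.1
    have h3 := norm_le_blockNorm_one v.2.2.1
    have k1 := norm_nonneg v.1
    have k2 := norm_nonneg v.2.1
    have k3 := norm_nonneg v.2.2.1
    have k4 := norm_nonneg v.2.2.2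
    exact max_le (by linarith) (max_le (by linarith) (max_le (by linarith) (by linarith)))

lemma continuous_reg (hW : 8 ≤ W) (hL : 8 ≤ L) :
    Continuous fun v : Params n m W k L => (ofParams v).reg := by
  simp only [reg_ofParams]
  have h1 := continuous_blockNorm (ι := Fin W) (E := EuclideanSpace ℝ (Fin k × Fin m × Fin n))
    (one_pos.trans (one_lt_expo hW))
  have h2 := continuous_blockNorm (ι := Fin L) (E := ℝ) (one_pos.trans (one_lt_expo hL))
  fun_prop

/-- Strong convexity of the squared norm of a block. -/
lemma blockNorm_midpoint {N : ℕ} {E : Type*} [NormedAddCommGroup E] [InnerProductSpace ℝ E]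
    (hN : 8 ≤ N) {c : ℝ} (hc : Real.log N ≤ c) (v w : Fin N → E) :
    blockNorm (expo N) ((1 / 2 : ℝ) • (v + w)) ^ 2 +
      1 / (4 * c) * blockNorm (expo N) (v - w) ^ 2 ≤
      (blockNorm (expo N) v ^ 2 + blockNorm (expo N) w ^ 2) / 2 := by
  have hq := one_lt_expo hN
  have h := lqNorm_sq_add_le hq (expo_le_two hN) ((1 / 2 : ℝ) • (v + w)) ((1 / 2 : ℝ) • (v - w))
  have e1 : ∀ i, ((1 / 2 : ℝ) • (v + w)) i + ((1 / 2 : ℝ) • (v - w)) i = v i := fun i => by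
    simp only [Pi.smul_apply, Pi.add_apply, Pi.sub_apply]
    module
  have e2 : ∀ i, ((1 / 2 : ℝ) • (v + w)) i - ((1 / 2 : ℝ) • (v - w)) i = w i := fun i => by
    simp only [Pi.smul_apply, Pi.add_apply, Pi.sub_apply]
    module
  simp only [e1, e2] at h
  change blockNorm _ _ ^ 2 + _ * blockNorm _ _ ^ 2 ≤ (blockNorm _ v ^ 2 + blockNorm _ w ^ 2) / 2 at h
  refine le_trans ?_ h
  rw [blockNorm_smul (by linarith) (by norm_num) (v - w), mul_pow, ← mul_assoc]
  have hlog := two_lt_log hN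
  have h1 : 1 / (4 * c) ≤ (expo N - 1) * (1 / 2) ^ 2 := by
    have h2 := one_div_log_le_expo_sub_one hN
    have h3 : 1 / c ≤ 1 / Real.log N := one_div_le_one_div_of_le (by linarith) hc
    have h4 : 1 / (4 * c) = 1 / 4 * (1 / c) := by ring
    linarith
  have := mul_le_mul_of_nonneg_right h1 (sq_nonneg (blockNorm (expo N) (v - w)))
  linarith

lemma reg_midpoint (hW : 8 ≤ W) (hL : 8 ≤ L) {c : ℝ} (hcW : Real.log W ≤ c)
    (hcL : Real.log L ≤ c) (v w : Params n m W k L) :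
    (ofParams ((1 / 2 : ℝ) • (v + w))).reg + 1 / (4 * c) * (ofParams (v - w)).reg ≤
      ((ofParams v).reg + (ofParams w).reg) / 2 := by
  simp only [reg_ofParams, Prod.smul_fst, Prod.smul_snd, Prod.fst_add, Prod.snd_add, Prod.fst_sub,
    Prod.snd_sub]
  have h1 := blockNorm_midpoint hW hcW v.1 w.1
  have h2 := blockNorm_midpoint hW hcW v.2.1 w.2.1
  have h3 := blockNorm_midpoint hL hcL v.2.2.1 w.2.2.1
  have h4 : ‖(1 / 2 : ℝ) • (v.2.2.2 + w.2.2.2)‖ ^ 2 + 1 / (4 * c) * ‖v.2.2.2 - w.2.2.2‖ ^ 2 ≤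
      (‖v.2.2.2‖ ^ 2 + ‖w.2.2.2‖ ^ 2) / 2 := by
    have hc : 1 ≤ c := by linarith [two_lt_log hW]
    have h5 : 1 / (4 * c) ≤ 1 / 4 := one_div_le_one_div_of_le (by norm_num) (by linarith)
    have h6 := mul_le_mul_of_nonneg_right h5 (sq_nonneg ‖v.2.2.2 - w.2.2.2‖)
    rw [norm_smul, Real.norm_of_nonneg (by norm_num : (0 : ℝ) ≤ 1 / 2), mul_pow]
    have := parallelogram_law_with_norm ℝ v.2.2.2 w.2.2.2
    nlinarith
  linarith

lemma blockNorm_le_one {ι E : Type*} [Fintype ι] [Norm E] {q : ℝ} (hq : 1 ≤ q) (v : ι → E) :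
    blockNorm q v ≤ blockNorm 1 v := lqNorm_le_lqNorm_one hq _

lemma reg_le_compNorm_sq (hW : 8 ≤ W) (hL : 8 ≤ L) (v : Params n m W k L) :
    (ofParams v).reg ≤ (ofParams v).compNorm ^ 2 := by
  rw [reg_ofParams, compNorm_ofParams]
  have h1 := pow_le_pow_left₀ (blockNorm_nonneg _ _) (blockNorm_le_one (one_lt_expo hW).le v.1) 2
  have h2 := pow_le_pow_left₀ (blockNorm_nonneg _ _) (blockNorm_le_one (one_lt_expo hW).le v.2.1) 2
  have h3 := pow_le_pow_left₀ (blockNorm_nonneg _ _)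
    (blockNorm_le_one (one_lt_expo hL).le v.2.2.1) 2
  have k1 := blockNorm_nonneg 1 v.1
  have k2 := blockNorm_nonneg 1 v.2.1
  have k3 := blockNorm_nonneg 1 v.2.2.1
  have k4 := norm_nonneg v.2.2.2
  nlinarith [mul_nonneg k1 k2, mul_nonneg k1 k3, mul_nonneg k1 k4, mul_nonneg k2 k3,
    mul_nonneg k2 k4, mul_nonneg k3 k4]

/-- Predictions are bounded in the composite norm, while curvature is measured by the regularizer.
The constant is `3² · 4`: `lqNorm_one_le` on the blocks and Cauchy-Schwarz over four blocks. -/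
lemma compNorm_sq_le_reg (hW : 8 ≤ W) (hL : 8 ≤ L) (v : Params n m W k L) :
    (ofParams v).compNorm ^ 2 ≤ 36 * (ofParams v).reg := by
  rw [reg_ofParams, compNorm_ofParams]
  have h1 : blockNorm 1 v.1 ≤ _ := lqNorm_one_le hW fun i => ‖v.1 i‖
  have h2 : blockNorm 1 v.2.1 ≤ _ := lqNorm_one_le hW fun i => ‖v.2.1 i‖
  have h3 : blockNorm 1 v.2.2.1 ≤ _ := lqNorm_one_le hL fun i => ‖v.2.2.1 i‖
  change _ ≤ 3 * blockNorm _ v.1 at h1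
  change _ ≤ 3 * blockNorm _ v.2.1 at h2
  change _ ≤ 3 * blockNorm _ v.2.2.1 at h3
  have k1 := blockNorm_nonneg 1 v.1
  have k2 := blockNorm_nonneg 1 v.2.1
  have k3 := blockNorm_nonneg 1 v.2.2.1
  have k4 := norm_nonneg v.2.2.2
  set a := blockNorm (expo W) v.1
  set b := blockNorm (expo W) v.2.1
  set c := blockNorm (expo L) v.2.2.1
  set e := ‖v.2.2.2‖
  have h4 : blockNorm 1 v.1 + blockNorm 1 v.2.1 + blockNorm 1 v.2.2.1 + e ≤
    3 * (a + b + c + e) := by linarith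
  refine (pow_le_pow_left₀ (by linarith) h4 2).trans ?_
  nlinarith [sq_nonneg (a - b), sq_nonneg (a - c), sq_nonneg (a - e), sq_nonneg (b - c),
    sq_nonneg (b - e), sq_nonneg (c - e)]

/-! ### Linearity and size of the predictions -/

lemma norm_mulE_le_entries {a b : ℕ} (X : Matrix (Fin a) (Fin b) ℝ)
    (v : EuclideanSpace ℝ (Fin b)) : ‖mulE X v‖ ≤ √(frobSq X) * ‖v‖ := by
  refine abs_le_of_sq_le_sq' ?_ (by positivity) |>.2
  rw [mul_pow, Real.sq_sqrt (frobSq_nonneg X), EuclideanSpace.norm_sq_eq, frobSq, sum_mul]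
  refine sum_le_sum fun i _ => ?_
  rw [Real.norm_eq_abs, sq_abs, EuclideanSpace.norm_sq_eq]
  simp only [Real.norm_eq_abs, sq_abs]
  exact sum_mul_sq_le_sq_mul_sq univ (fun j => X i j) fun j => v j

lemma norm_sum_mulE_le {k : ℕ} (X : Fin k → Matrix (Fin m) (Fin n) ℝ)
    (z : Fin k → EuclideanSpace ℝ (Fin n)) {A : ℝ} (hA : 0 ≤ A) (hz : ∑ h, ‖z h‖ ^ 2 ≤ A ^ 2) :
    ‖∑ h, mulE (X h) (z h)‖ ≤ √(∑ h, frobSq (X h)) * A := by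
  refine (norm_sum_le _ _).trans ((sum_le_sum fun h _ => norm_mulE_le_entries _ _).trans ?_)
  refine abs_le_of_sq_le_sq' ((sum_mul_sq_le_sq_mul_sq _ _ _).trans ?_) (by positivity) |>.2
  rw [mul_pow, Real.sq_sqrt (sum_nonneg fun _ _ => frobSq_nonneg _)]
  simp only [Real.sq_sqrt (frobSq_nonneg _)]
  exact mul_le_mul_of_nonneg_left hz (sum_nonneg fun _ _ => frobSq_nonneg _)

lemma PseudoLDS.predict_ofParams_add (hk : k ≤ T) (σ : Fin T → ℝ) (φ : Fin T → Fin T → ℝ)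
    (x : ℕ → EuclideanSpace ℝ (Fin n)) (y : ℕ → EuclideanSpace ℝ (Fin m)) (t : ℕ)
    (v w : Params n m W k L) : (ofParams (v + w)).predict hk σ φ x y t =
      (ofParams v).predict hk σ φ x y t + (ofParams w).predict hk σ φ x y t := by
  have hβ : (ofParams (v + w)).β = (ofParams v).β + (ofParams w).β := rfl
  have hP : ∀ j, (ofParams (v + w)).P j = (ofParams v).P j + (ofParams w).P j := fun _ => rfl
  have hM : ∀ p h, (ofParams (v + w)).M p h = (ofParams v).M p h + (ofParams w).M p h :=
    fun _ _ => rfl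
  have hN : ∀ p h, (ofParams (v + w)).N p h = (ofParams v).N p h + (ofParams w).N p h :=
    fun _ _ => rfl
  simp only [PseudoLDS.predict, hβ, hP, hM, hN, Pi.add_apply, add_smul, smul_add, add_mulE,
    sum_add_distrib]
  abel

lemma PseudoLDS.predict_ofParams_smul (hk : k ≤ T) (σ : Fin T → ℝ) (φ : Fin T → Fin T → ℝ)
    (x : ℕ → EuclideanSpace ℝ (Fin n)) (y : ℕ → EuclideanSpace ℝ (Fin m)) (t : ℕ) (c : ℝ)
    (v : Params n m W k L) : (ofParams (c • v)).predict hk σ φ x y t =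
      c • (ofParams v).predict hk σ φ x y t := by
  have hβ : (ofParams (c • v)).β = c • (ofParams v).β := rfl
  have hP : ∀ j, (ofParams (c • v)).P j = c • (ofParams v).P j := fun _ => rfl
  have hM : ∀ p h, (ofParams (c • v)).M p h = c • (ofParams v).M p h := fun _ _ => rfl
  have hN : ∀ p h, (ofParams (c • v)).N p h = c • (ofParams v).N p h := fun _ _ => rfl
  simp only [PseudoLDS.predict, hβ, hP, hM, hN, Pi.smul_apply, smul_eq_mul, smul_add, add_mulE,
    smul_mulE, smul_sum, smul_smul]
  congr 1
  refine sum_congr rfl fun p _ => sum_congr rfl fun h _ => sum_congr rfl fun u _ => ?_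
  congr 2 <;> ring

/-- The prediction as a linear map of the parameters. -/
noncomputable def predictMap (hk : k ≤ T) (σ : Fin T → ℝ) (φ : Fin T → Fin T → ℝ)
    (x : ℕ → EuclideanSpace ℝ (Fin n)) (y : ℕ → EuclideanSpace ℝ (Fin m)) (t : ℕ) :
    Params n m W k L →ₗ[ℝ] EuclideanSpace ℝ (Fin m) where
  toFun v := (ofParams v).predict hk σ φ x y t
  map_add' := PseudoLDS.predict_ofParams_add hk σ φ x y t
  map_smul' := PseudoLDS.predict_ofParams_smul hk σ φ x y t

lemma sum_one_div_le (T : ℕ) : ∑ u : Fin T, 1 / ((u : ℕ) + 1 : ℝ) ≤ 1 + Real.log T := by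
  have h := harmonic_le_one_add_log T
  rw [harmonic] at h
  push_cast at h
  rw [sum_range] at h
  simpa [one_div] using h

/-- The size of the filtered inputs. -/
lemma IsHankelEigensystem.sum_norm_filtered_sq_le {σ : Fin T → ℝ} {φ : Fin T → Fin T → ℝ}
    (H : IsHankelEigensystem T σ φ) {z : Fin T → EuclideanSpace ℝ (Fin n)} {R : ℝ}
    (hz : ∀ u, ‖z u‖ ≤ R) :
    ∑ h, ‖∑ u, (σ h ^ (1 / 4 : ℝ) * φ h u) • z u‖ ^ 2 ≤ (1 + Real.log T) * R ^ 2 := by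
  have e : ∀ h, ‖∑ u, (σ h ^ (1 / 4 : ℝ) * φ h u) • z u‖ ^ 2 = √(σ h) * ‖∑ u, φ h u • z u‖ ^ 2 := by
    intro h
    simp only [mul_smul]
    rw [← smul_sum, norm_smul, mul_pow, Real.norm_eq_abs, sq_abs]
    congr 1
    rw [← Real.rpow_natCast, ← Real.rpow_mul (H.nonneg h), Real.sqrt_eq_rpow]
    norm_num
  simp only [e]
  refine (H.sum_sqrt_mul_norm_sq_le z).trans ?_
  calc _ ≤ ∑ u : Fin T, 1 / ((u : ℕ) + 1 : ℝ) * R ^ 2 := sum_le_sum fun u _ =>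
        mul_le_mul_of_nonneg_left (pow_le_pow_left₀ (norm_nonneg _) (hz u) 2) (by positivity)
    _ ≤ _ := by
        rw [← sum_mul]
        exact mul_le_mul_of_nonneg_right (sum_one_div_le T) (sq_nonneg R)

/-- Lags `j ≥ t` contribute nothing. `IsFTRLRun.regret_le` uses both bounds on the minimum, which is
how `√((L + 1) T)` arises. -/
lemma sum_norm_lag_sq_le {x : ℕ → EuclideanSpace ℝ (Fin n)} {R : ℝ} (hR : 0 ≤ R)
    (hx : ∀ t, 1 ≤ t → t ≤ T → ‖x t‖ ≤ R) {t : ℕ} (ht : t ≤ T) (L : ℕ) :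
    ∑ j : Fin L, ‖lag x t j‖ ^ 2 ≤ (min L T : ℕ) * R ^ 2 := by
  rw [← sum_range fun j => ‖lag x t j‖ ^ 2]
  have h1 : ∑ j ∈ range L, ‖lag x t j‖ ^ 2 = ∑ j ∈ range (min L T), ‖lag x t j‖ ^ 2 := by
    refine (sum_subset (range_subset_range.2 (min_le_left _ _)) fun j hj hj' => ?_).symm
    rw [mem_range] at hj hj'
    rw [lag_of_le x (by omega), norm_zero]
    norm_num
  rw [h1]
  refine (sum_le_card_nsmul _ _ (R ^ 2) fun j _ => ?_).trans_eq (by simp)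
  exact pow_le_pow_left₀ (norm_nonneg _) (norm_lag_le hR hx ht j) 2

/-- `ℓ¹` over phases against the supremum over phases, with Cauchy-Schwarz over filters at each
phase. Since `z` may depend on the phase, cosines and sines can be absorbed into the inputs. -/
lemma norm_sum_filtered_le {σ : Fin T → ℝ} {φ : Fin T → Fin T → ℝ}
    (H : IsHankelEigensystem T σ φ) (X : Fin W → Fin T → Matrix (Fin m) (Fin n) ℝ)
    {z : Fin W → Fin T → EuclideanSpace ℝ (Fin n)} {A R : ℝ} (hA : 0 ≤ A)
    (hAR : (1 + Real.log T) * R ^ 2 ≤ A ^ 2) (hz : ∀ p u, ‖z p u‖ ≤ R) :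
    ‖∑ p, ∑ h, ∑ u, (σ h ^ (1 / 4 : ℝ) * φ h u) • mulE (X p h) (z p u)‖ ≤
      mixedNorm 1 X * A := by
  rw [mixedNorm, lqNorm_one, sum_mul]
  refine (norm_sum_le _ _).trans (sum_le_sum fun p _ => ?_)
  rw [abs_of_nonneg (Real.sqrt_nonneg _)]
  have e : ∀ h, ∑ u, (σ h ^ (1 / 4 : ℝ) * φ h u) • mulE (X p h) (z p u) =
      mulE (X p h) (∑ u, (σ h ^ (1 / 4 : ℝ) * φ h u) • z p u) := fun h => by
    rw [mulE_sum]
    refine sum_congr rfl fun u _ => ?_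
    ext i
    simp only [PiLp.smul_apply, mulE_apply, smul_eq_mul, mul_sum]
    exact sum_congr rfl fun j _ => by ring
  simp only [e]
  exact norm_sum_mulE_le _ _ hA ((H.sum_norm_filtered_sq_le (hz p)).trans hAR)

/-- The predictions are bounded by the composite norm. -/
lemma IsHankelEigensystem.norm_predict_le {σ : Fin T → ℝ} {φ : Fin T → Fin T → ℝ}
    (H : IsHankelEigensystem T σ φ) {x : ℕ → EuclideanSpace ℝ (Fin n)}
    {y : ℕ → EuclideanSpace ℝ (Fin m)} {Rx Ry A : ℝ} (hRx : 0 ≤ Rx) (hRy : 0 ≤ Ry) (hA : 0 ≤ A)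
    (hx : ∀ t, 1 ≤ t → t ≤ T → ‖x t‖ ≤ Rx) (hy : ∀ t, 1 ≤ t → t ≤ T → ‖y t‖ ≤ Ry)
    (hA1 : (1 + Real.log T) * Rx ^ 2 ≤ A ^ 2) (hA2 : Ry ≤ A)
    (hA3 : (min (L + 1) T : ℕ) * Rx ^ 2 ≤ A ^ 2) {t : ℕ} (ht : t ≤ T)
    (Q : PseudoLDS n m W T L) : ‖Q.predict le_rfl σ φ x y t‖ ≤ Q.compNorm * A := by
  rw [PseudoLDS.predict, PseudoLDS.compNorm]
  have h1 : ‖∑ u : Fin L, Q.β u • lag y t ((u : ℕ) + 1)‖ ≤ lqNorm 1 Q.β * A := by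
    rw [lqNorm_one, sum_mul]
    refine (norm_sum_le _ _).trans (sum_le_sum fun u _ => ?_)
    rw [norm_smul, Real.norm_eq_abs]
    exact mul_le_mul_of_nonneg_left ((norm_lag_le hRy hy ht _).trans hA2) (abs_nonneg _)
  have h2 : ‖∑ j : Fin (L + 1), mulE (Q.P j) (lag x t (j : ℕ))‖ ≤ √(∑ j, frobSq (Q.P j)) * A :=
    norm_sum_mulE_le _ _ hA ((sum_norm_lag_sq_le hRx hx ht (L + 1)).trans hA3)
  have htrig : ∀ (c : ℝ) (j : ℕ), |c| ≤ 1 → ‖c • lag x t j‖ ≤ Rx := fun c j hc => by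
    rw [norm_smul, Real.norm_eq_abs]
    exact (mul_le_of_le_one_left (norm_nonneg _) hc).trans (norm_lag_le hRx hx ht j)
  have h3 := norm_sum_filtered_le H Q.M
    (z := fun p u => Real.cos (2 * Real.pi * ((u : ℕ) + 1 : ℝ) * (p : ℕ) / W) •
      lag x t (L + ((u : ℕ) + 1))) hA hA1 (fun p u => htrig _ _ (Real.abs_cos_le_one _))
  have h4 := norm_sum_filtered_le H Q.N
    (z := fun p u => Real.sin (2 * Real.pi * ((u : ℕ) + 1 : ℝ) * (p : ℕ) / W) •
      lag x t (L + ((u : ℕ) + 1))) hA hA1 (fun p u => htrig _ _ (Real.abs_sin_le_one _))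
  have e : ∑ p : Fin W, ∑ h : Fin T, ∑ u : Fin T,
      (σ (Fin.castLE le_rfl h) ^ (1 / 4 : ℝ) * φ (Fin.castLE le_rfl h) u) •
        mulE (Real.cos (2 * Real.pi * ((u : ℕ) + 1 : ℝ) * (p : ℕ) / W) • Q.M p h +
          Real.sin (2 * Real.pi * ((u : ℕ) + 1 : ℝ) * (p : ℕ) / W) • Q.N p h)
          (lag x t (L + ((u : ℕ) + 1))) =
      ∑ p : Fin W, ∑ h : Fin T, ∑ u : Fin T, (σ h ^ (1 / 4 : ℝ) * φ h u) • mulE (Q.M p h)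
        (Real.cos (2 * Real.pi * ((u : ℕ) + 1 : ℝ) * (p : ℕ) / W) • lag x t (L + ((u : ℕ) + 1))) +
      ∑ p : Fin W, ∑ h : Fin T, ∑ u : Fin T, (σ h ^ (1 / 4 : ℝ) * φ h u) • mulE (Q.N p h)
        (Real.sin (2 * Real.pi * ((u : ℕ) + 1 : ℝ) * (p : ℕ) / W) •
          lag x t (L + ((u : ℕ) + 1))) := by
    have hs : ∀ (c : ℝ) (X : Matrix (Fin m) (Fin n) ℝ) (z : EuclideanSpace ℝ (Fin n)),
        mulE X (c • z) = c • mulE X z := fun c X z => by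
      ext i
      simp only [PiLp.smul_apply, mulE_apply, smul_eq_mul, mul_sum]
      exact sum_congr rfl fun j _ => by ring
    simp only [← sum_add_distrib, ← smul_add, add_mulE, smul_mulE, hs, Fin.castLE_rfl, id]
  rw [e]
  refine (norm_add_le _ _).trans ?_
  have h5 := norm_add_le (∑ u : Fin L, Q.β u • lag y t ((u : ℕ) + 1))
    (∑ j : Fin (L + 1), mulE (Q.P j) (lag x t (j : ℕ)))
  have h6 := (norm_add_le _ _).trans (add_le_add h3 h4)
  refine (add_le_add (h5.trans (add_le_add h1 h2)) h6).trans_eq ?_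
  ring

end SpectralFiltering

namespace SpectralFiltering

open Finset

variable {n m W k L T : ℕ}

/-! ### Regret -/

lemma isMinOn_ofParams_iff {ρ : ℝ} {f : PseudoLDS n m W k L → ℝ} {Q : PseudoLDS n m W k L} :
    IsMinOn f (decisionSet n m W k L ρ) Q ↔
      IsMinOn (fun v => f (ofParams v)) (paramSet n m W k L ρ) (toParams Q) := by
  rw [isMinOn_iff, isMinOn_iff]
  exact ⟨fun h v hv => h (ofParams v) hv, fun h Q' hQ' => h (toParams Q') hQ'⟩

lemma exists_isFTRLRun (hk : k ≤ T) (σ : Fin T → ℝ) (φ : Fin T → Fin T → ℝ) (hW : 8 ≤ W)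
    (hL : 8 ≤ L) {ρ : ℝ} (hρ : 0 ≤ ρ) (η : ℝ) (x : ℕ → EuclideanSpace ℝ (Fin n))
    (y : ℕ → EuclideanSpace ℝ (Fin m)) :
    ∃ Q : ℕ → PseudoLDS n m W k L, IsFTRLRun hk σ φ ρ η x y Q := by
  have hmin : ∀ t, ∃ v ∈ paramSet n m W k L ρ,
      IsMinOn (fun v => ∑ u ∈ Icc 1 t, (ofParams v).loss hk σ φ x y u + (ofParams v).reg / η)
        (paramSet n m W k L ρ) v := by
    intro t
    refine (isCompact_paramSet ρ).exists_isMinOn ⟨0, zero_mem_paramSet hρ⟩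
      (Continuous.continuousOn ?_)
    refine Continuous.add (continuous_finsetSum _ fun u _ => ?_)
      ((continuous_reg hW hL).div_const η)
    have := LinearMap.continuous_of_finiteDimensional
      (predictMap (W := W) (L := L) hk σ φ x y u)
    exact ((this.sub continuous_const).norm).pow 2
  choose v hv hvmin using hmin
  -- At `t = 1` this is the minimizer of the regularizer alone; any element would do.
  refine ⟨fun t => ofParams (v (t - 1)), hv 0, fun t ht _ => ?_⟩
  rw [isMinOn_ofParams_iff]
  exact ⟨hv t, hvmin t⟩

/-- The regret bound before the choice of the parameters. -/
theorem IsFTRLRun.regret_le {σ : Fin T → ℝ} {φ : Fin T → Fin T → ℝ}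
    (H : IsHankelEigensystem T σ φ) (hT : 2 ≤ T) (hW : 8 ≤ W) (hL : 8 ≤ L) {c G Rx Ry ρ : ℝ}
    (hcW : Real.log W ≤ c) (hcL : Real.log L ≤ c) (hRx : 1 ≤ Rx) (hRy : 1 ≤ Ry) (hρ : 1 ≤ ρ)
    (hG : G = (1 + Real.log T) * (Rx ^ 2 * Ry ^ 2)) {x : ℕ → EuclideanSpace ℝ (Fin n)}
    {y : ℕ → EuclideanSpace ℝ (Fin m)} (hx : ∀ t, 1 ≤ t → t ≤ T → ‖x t‖ ≤ Rx)
    (hy : ∀ t, 1 ≤ t → t ≤ T → ‖y t‖ ≤ Ry) {Q : ℕ → PseudoLDS n m W T L}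
    (hQ : IsFTRLRun le_rfl σ φ ρ (1 / (288 * c * G * √((L + 1) * T))) x y Q)
    {Qstar : PseudoLDS n m W T L} (hQs : Qstar ∈ decisionSet n m W T L ρ) :
    ∑ t ∈ Icc 1 T, (Q t).loss le_rfl σ φ x y t - ∑ t ∈ Icc 1 T, Qstar.loss le_rfl σ φ x y t ≤
      305 * c * G * ρ ^ 2 * √((L + 1) * T) := by
  set s := √(((L : ℝ) + 1) * T) with hs
  set μ : ℝ := ((min (L + 1) T : ℕ) : ℝ) with hμ
  have hlogT : 0 ≤ Real.log T := Real.log_natCast_nonneg T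
  have hT2 : (2 : ℝ) ≤ T := by exact_mod_cast hT
  have hL8 : (8 : ℝ) ≤ L := by exact_mod_cast hL
  have hRx2 : 1 ≤ Rx ^ 2 := one_le_pow₀ hRx
  have hRy2 : 1 ≤ Ry ^ 2 := one_le_pow₀ hRy
  have hRR : Rx ^ 2 ≤ Rx ^ 2 * Ry ^ 2 := le_mul_of_one_le_right (by linarith) hRy2
  have hRR' : Ry ^ 2 ≤ Rx ^ 2 * Ry ^ 2 := le_mul_of_one_le_left (by linarith) hRx2
  have hGR : Rx ^ 2 * Ry ^ 2 ≤ G := by rw [hG]; nlinarith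
  have hG1 : 1 ≤ G := by linarith
  have hG0 : 0 < G := by linarith
  have hc1 : 1 ≤ c := by linarith [two_lt_log hW]
  have hc0 : 0 < c := by linarith
  have hμ1 : 1 ≤ μ := by
    rw [hμ]
    exact_mod_cast (by omega : 1 ≤ min (L + 1) T)
  have hμL : μ ≤ L + 1 := by
    rw [hμ]
    exact_mod_cast min_le_left (L + 1) T
  have hμT : μ ≤ T := by
    rw [hμ]
    exact_mod_cast min_le_right (L + 1) T
  have hμs : μ ≤ s := Real.le_sqrt_of_sq_le (by nlinarith)
  have hs1 : 1 ≤ s := hμ1.trans hμs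
  have hs0 : 0 < s := by linarith
  have hss : s ^ 2 = ((L : ℝ) + 1) * T := Real.sq_sqrt (by positivity)
  set A := √(G * μ) with hA
  have hA2 : A ^ 2 = G * μ := Real.sq_sqrt (by positivity)
  have hA0 : 0 ≤ A := Real.sqrt_nonneg _
  have hpred : ∀ t, t ≤ T → ∀ v : Params n m W T L,
      ‖predictMap le_rfl σ φ x y t v‖ ≤ (ofParams v).compNorm * A := by
    intro t ht v
    refine H.norm_predict_le (by linarith) (by linarith) hA0 hx hy ?_ ?_ ?_ ht (ofParams v)
    · rw [hA2]
      calc (1 + Real.log T) * Rx ^ 2 ≤ G := by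
            rw [hG]
            exact mul_le_mul_of_nonneg_left hRR (by linarith)
        _ ≤ _ := le_mul_of_one_le_right hG0.le hμ1
    · refine Real.le_sqrt_of_sq_le ?_
      nlinarith
    · rw [hA2, ← hμ, mul_comm G]
      exact mul_le_mul_of_nonneg_left (hRR.trans hGR) (by linarith)
  have hcomp0 : ∀ v : Params n m W T L, 0 ≤ (ofParams v).compNorm := fun v => by
    rw [compNorm_ofParams]
    have h1 := blockNorm_nonneg 1 v.1
    have h2 := blockNorm_nonneg 1 v.2.1
    have h3 := blockNorm_nonneg 1 v.2.2.1
    have h4 := norm_nonneg v.2.2.2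
    linarith
  -- `lam` is the curvature `1 / (4 c)` divided by the 36 of `compNorm_sq_le_reg` and by `A² = G μ`.
  -- The choice of `η` makes `η / lam = μ / (2 s)`, at most `1/2`.
  set η := 1 / (288 * c * G * s) with hη
  set lam := 1 / (144 * c * (G * μ)) with hlam
  have hη0 : 0 < η := by positivity
  have hlam0 : 0 < lam := by positivity
  have hηlam : η / lam = μ / (2 * s) := by
    rw [hη, hlam]
    field_simp
    norm_num
  have key := ftrl_regret (K := paramSet n m W T L ρ)
    (fun a ha b hb => midpoint_mem_paramSet ha hb) (zero_mem_paramSet (by linarith)) hT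
    (g := fun t => predictMap le_rfl σ φ x y t) (y := y) (reg := fun v => (ofParams v).reg)
    (lam := lam) (η := η) (b := 4 * (G * ρ ^ 2 * s)) (Ry := Ry) (D := ρ ^ 2)
    reg_ofParams_nonneg ?_ hlam0 hη0 ?_ ?_ hy ?_ ?_ (Q := fun t => toParams (Q t)) hQ.1 ?_
    (v := toParams Qstar) hQs
  · change ∑ t ∈ Icc 1 T, (Q t).loss le_rfl σ φ x y t -
      ∑ t ∈ Icc 1 T, Qstar.loss le_rfl σ φ x y t ≤ _ at key
    refine key.trans ?_
    -- The three terms of `ftrl_regret` are at most 16, 1 and `288 c` times `G ρ² s`; with `c ≥ 1`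
    -- they add up to `305 c`.
    have h1 : 2 * (η / lam) * (T * Ry ^ 2) ≤ G * ρ ^ 2 * s := by
      have h2 : μ * T ≤ s ^ 2 := by
        rw [hss]
        exact mul_le_mul_of_nonneg_right hμL (by linarith)
      have h3 : 2 * (η / lam) * (T * Ry ^ 2) = μ * T / s * Ry ^ 2 := by
        rw [hηlam]
        field_simp
      have h4 : μ * T / s ≤ s := by
        rw [div_le_iff₀ hs0, ← sq]
        exact h2
      rw [h3]
      have h5 : Ry ^ 2 ≤ G * ρ ^ 2 :=
        (hRR'.trans hGR).trans (le_mul_of_one_le_right hG0.le (one_le_pow₀ hρ))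
      calc μ * T / s * Ry ^ 2 ≤ s * (G * ρ ^ 2) :=
            mul_le_mul h4 h5 (sq_nonneg _) hs0.le
        _ = _ := by ring
    have h2 : ρ ^ 2 / η = 288 * c * (G * ρ ^ 2 * s) := by
      rw [hη]
      field_simp
    have h3 : 0 ≤ G * ρ ^ 2 * s := by positivity
    rw [h2]
    nlinarith
  · change (ofParams (0 : Params n m W T L)).reg = 0
    refine le_antisymm ?_ (reg_ofParams_nonneg _)
    refine (reg_le_compNorm_sq hW hL _).trans ?_
    have := zero_mem_paramSet (n := n) (m := m) (W := W) (k := T) (L := L) le_rfl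
    simp only [paramSet, Set.mem_ofPred_eq] at this
    rw [le_antisymm this (hcomp0 _)]
    norm_num
  · rw [hηlam, div_le_iff₀ (by positivity)]
    linarith
  · intro t _ ht v w
    refine le_trans (add_le_add_right ?_ _) (reg_midpoint hW hL hcW hcL v w)
    have h1 := pow_le_pow_left₀ (norm_nonneg _) (hpred t ht (v - w)) 2
    rw [mul_pow, hA2] at h1
    have h2 := compNorm_sq_le_reg hW hL (v - w)
    calc lam * ‖predictMap le_rfl σ φ x y t (v - w)‖ ^ 2
        ≤ lam * (36 * (ofParams (v - w)).reg * (G * μ)) :=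
          mul_le_mul_of_nonneg_left
            (h1.trans (mul_le_mul_of_nonneg_right h2 (by positivity))) hlam0.le
      _ = _ := by
          rw [hlam]
          field_simp
          ring
  · intro t ht1 ht v hv
    have h1 : ‖predictMap le_rfl σ φ x y t v - y t‖ ≤ ρ * A + Ry :=
      (norm_sub_le _ _).trans (add_le_add ((hpred t ht v).trans
        (mul_le_mul_of_nonneg_right hv hA0)) (hy t ht1 ht))
    refine (pow_le_pow_left₀ (norm_nonneg _) h1 2).trans ?_
    have h2 : (ρ * A + Ry) ^ 2 ≤ 2 * (ρ ^ 2 * (G * μ)) + 2 * Ry ^ 2 := by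
      rw [← hA2]
      nlinarith [sq_nonneg (ρ * A - Ry)]
    have h3 : ρ ^ 2 * (G * μ) ≤ G * ρ ^ 2 * s := by
      calc ρ ^ 2 * (G * μ) = G * ρ ^ 2 * μ := by ring
        _ ≤ _ := mul_le_mul_of_nonneg_left hμs (by positivity)
    have h4 : Ry ^ 2 ≤ G * ρ ^ 2 * s :=
      ((hRR'.trans hGR).trans (le_mul_of_one_le_right hG0.le (one_le_pow₀ hρ))).trans
        (le_mul_of_one_le_right (by positivity) hs1)
    linarith
  · intro v hv
    exact (reg_le_compNorm_sq hW hL v).trans (pow_le_pow_left₀ (hcomp0 v) hv 2)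
  · intro t ht1 htT
    obtain ⟨h1, h2⟩ := hQ.2 t ht1 htT
    exact ⟨h1, isMinOn_ofParams_iff.1 h2⟩

/-! ### Numerical bounds -/

lemma half_le_log {T : ℕ} (hT : 2 ≤ T) : 1 / 2 ≤ Real.log T := by
  have : Real.log 2 ≤ Real.log T := Real.log_le_log (by norm_num) (by exact_mod_cast hT)
  linarith [Real.log_two_gt_d9]

lemma log_mul_one_add_log_le {T d τ : ℕ} {K l : ℝ} (hT : 2 ≤ T) (hd : 1 ≤ d) (hK : 1 ≤ K)
    (hτ : (τ : ℝ) + 9 ≤ K * d) (hl : 1 ≤ l) (hdl : Real.log d ≤ l) :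
    (Real.log (8 * T : ℕ) + Real.log (τ + 8 : ℕ)) * (1 + Real.log T) ≤
      192 * (5 + Real.log K) * (l * Real.log T ^ 7) := by
  set t := Real.log T with ht
  have ht2 : 1 / 2 ≤ t := half_le_log hT
  have hK0 : 0 ≤ Real.log K := Real.log_nonneg hK
  have h8 : Real.log (8 * T : ℕ) ≤ 8 * t := by
    have : Real.log (8 * T : ℕ) = 3 * Real.log 2 + t := by
      push_cast
      rw [Real.log_mul (by norm_num) (by positivity), show (8 : ℝ) = 2 ^ 3 by norm_num,
        Real.log_pow]
      norm_num
      rfl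
    linarith [Real.log_two_lt_d9]
  have hd0 : (0 : ℝ) < d := by exact_mod_cast hd
  have h9 : Real.log (τ + 8 : ℕ) ≤ Real.log K + l := by
    calc Real.log (τ + 8 : ℕ) ≤ Real.log (K * d) :=
          Real.log_le_log (by positivity) (by push_cast; linarith)
      _ = Real.log K + Real.log d := Real.log_mul (by linarith) hd0.ne'
      _ ≤ _ := by linarith
  have h10 : Real.log (8 * T : ℕ) + Real.log (τ + 8 : ℕ) ≤ 2 * (5 + Real.log K) * (l * t) := by
    have k1 : t ≤ l * t := le_mul_of_one_le_left (by linarith) hl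
    have k2 : l ≤ 2 * (l * t) := by nlinarith
    have k3 : Real.log K ≤ Real.log K * (2 * (l * t)) :=
      le_mul_of_one_le_right hK0 (by linarith)
    nlinarith
  have h11 : 1 + t ≤ 3 * t := by linarith
  -- Only two logarithms of `T` arise; `2 ln T ≥ 1` raises the power to 7.
  have h12 : t ^ 2 ≤ 32 * t ^ 7 := by
    have h1 : 1 ≤ (2 * t) ^ 5 := one_le_pow₀ (by linarith)
    calc t ^ 2 ≤ (2 * t) ^ 5 * t ^ 2 := le_mul_of_one_le_left (sq_nonneg t) h1
      _ = _ := by ring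
  calc _ ≤ 2 * (5 + Real.log K) * (l * t) * (3 * t) :=
        mul_le_mul h10 h11 (by linarith) (by positivity)
    _ = 6 * (5 + Real.log K) * l * t ^ 2 := by ring
    _ ≤ 6 * (5 + Real.log K) * l * (32 * t ^ 7) :=
        mul_le_mul_of_nonneg_left h12 (by positivity)
    _ = _ := by ring

/-- The source of `d^(5/2) n`: with `a = L + 1`, the squared radius contributes `a² n` and the
balanced weight `√a`. -/
lemma sq_mul_sqrt_le {a b n : ℝ} {T : ℕ} (ha : 0 ≤ a) (hab : a ≤ b) (hn : 0 ≤ n) (X : ℝ) :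
    (50 * a * √n * X) ^ 2 * √(a * T) ≤ 2500 * (b ^ (5 / 2 : ℝ) * n * X ^ 2 * √T) := by
  have hb : 0 ≤ b := ha.trans hab
  have e : b ^ (5 / 2 : ℝ) = b ^ 2 * √b := by
    rw [Real.sqrt_eq_rpow, ← Real.rpow_natCast, ← Real.rpow_add_of_nonneg hb (by norm_num)
      (by norm_num)]
    norm_num
  rw [e, Real.sqrt_mul ha, mul_pow, mul_pow, mul_pow, Real.sq_sqrt hn]
  have h : a ^ 2 * √a ≤ b ^ 2 * √b :=
    mul_le_mul (pow_le_pow_left₀ ha hab 2) (Real.sqrt_le_sqrt hab) (Real.sqrt_nonneg _)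
      (sq_nonneg _)
  calc _ = 2500 * (n * X ^ 2 * √T) * (a ^ 2 * √a) := by ring
    _ ≤ 2500 * (n * X ^ 2 * √T) * (b ^ 2 * √b) := mul_le_mul_of_nonneg_left h (by positivity)
    _ = _ := by ring

end SpectralFiltering
-- Choice of the parameters
theorem mainTheorem3 (κ s : ℝ) :
    ∃ (C : ℝ) (a : ℕ),
      ∀ (n m d τ T : ℕ) (RTheta Rx Ry RPsi R1 R : ℝ),
        1 ≤ n → 1 ≤ m → 1 ≤ d → (τ : ℝ) ≤ κ * d → 2 ≤ T →
        1 ≤ RTheta → 1 ≤ Rx → 1 ≤ Ry → 1 ≤ RPsi → 1 ≤ R1 →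
        R1 ^ 3 * Rx ^ 2 * RTheta ^ 4 * RPsi ^ 2 * Ry ^ 2 ≤ R →
        ∃ (W k L : ℕ) (hk : k ≤ T) (ρ η : ℝ),
          3 ≤ W ∧ 3 ≤ L ∧ (L : ℝ) ≤ C * d ∧ 0 < ρ ∧ 0 < η ∧
          ∀ (σ : Fin T → ℝ) (φ : Fin T → Fin T → ℝ),
            SpectralFiltering.IsHankelEigensystem T σ φ →
            -- every admissible LDS is represented in the decision set, up to error `T ^ (-s)`
            (∀ S : SpectralFiltering.LDS n m d, S.Obeys RTheta RPsi R1 τ →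
              ∃ Q ∈ SpectralFiltering.decisionSet n m W k L ρ,
                ∀ x : ℕ → EuclideanSpace ℝ (Fin n),
                  (∀ t, 1 ≤ t → t ≤ T → ‖x t‖ ≤ Rx) →
                  ∀ t, 1 ≤ t → t ≤ T →
                    ‖Q.predict hk σ φ x (S.output x) t - S.output x t‖ ≤ (T : ℝ) ^ (-s)) ∧
            -- the regret bound
            (∀ (x : ℕ → EuclideanSpace ℝ (Fin n)) (y : ℕ → EuclideanSpace ℝ (Fin m)),
              (∀ t, 1 ≤ t → t ≤ T → ‖x t‖ ≤ Rx) →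
              (∀ t, 1 ≤ t → t ≤ T → ‖y t‖ ≤ Ry) →
              (∃ Q : ℕ → SpectralFiltering.PseudoLDS n m W k L,
                SpectralFiltering.IsFTRLRun hk σ φ ρ η x y Q) ∧
              ∀ Q : ℕ → SpectralFiltering.PseudoLDS n m W k L,
                SpectralFiltering.IsFTRLRun hk σ φ ρ η x y Q →
                ∀ Qstar ∈ SpectralFiltering.decisionSet n m W k L ρ,
                  ∑ t ∈ Finset.Icc 1 T, (Q t).loss hk σ φ x y t -
                    ∑ t ∈ Finset.Icc 1 T, Qstar.loss hk σ φ x y t ≤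
                  C * Real.log (n + m + d + RTheta + Rx + Ry) ^ a *
                    (R * (d : ℝ) ^ (5 / 2 : ℝ) * n * Real.log T ^ 7 * √T)) := by
  -- Chosen so that `τ + 9 ≤ K d`, using `d ≥ 1`.
  set K : ℝ := 9 + |κ| with hK
  have hK1 : 1 ≤ K := by rw [hK]; linarith [abs_nonneg κ]
  set C0 : ℝ := 305 * 2500 * 192 * (5 + Real.log K) * K ^ (5 / 2 : ℝ) with hC0
  have hC00 : 0 ≤ C0 := by
    have := Real.log_nonneg hK1
    positivity
  refine ⟨C0 + K, 1, ?_⟩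
  intro n m d τ T RTheta Rx Ry RPsi R1 R hn hm hd hτ hT hRT hRx hRy hRP hR1 hR
  have hd1 : (1 : ℝ) ≤ d := by exact_mod_cast hd
  have hn1 : (1 : ℝ) ≤ n := by exact_mod_cast hn
  have hm1 : (1 : ℝ) ≤ m := by exact_mod_cast hm
  have hτd : (τ : ℝ) + 9 ≤ K * d := by
    rw [hK]
    nlinarith [le_abs_self κ, abs_nonneg κ]
  have hτ0 : (0 : ℝ) ≤ τ := Nat.cast_nonneg τ
  have hT1 : (1 : ℝ) ≤ T := by exact_mod_cast (by omega : 1 ≤ T)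
  have hT8 : 8 ≤ 8 * T := by omega
  have hL8 : 8 ≤ τ + 8 := by omega
  set X := R1 * RTheta ^ 2 * RPsi with hX
  have hX1 : 1 ≤ X :=
    one_le_mul_of_one_le_of_one_le (one_le_mul_of_one_le_of_one_le hR1 (one_le_pow₀ hRT)) hRP
  set ρ := 50 * ((τ : ℝ) + 9) * √n * X with hρ
  have hρ1 : 1 ≤ ρ := by
    have h1 : (1 : ℝ) ≤ √n := Real.one_le_sqrt.2 hn1
    exact one_le_mul_of_one_le_of_one_le (one_le_mul_of_one_le_of_one_le (by linarith) h1) hX1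
  set c := Real.log (8 * T : ℕ) + Real.log (τ + 8 : ℕ) with hc
  have hlogL : 0 ≤ Real.log (τ + 8 : ℕ) := Real.log_natCast_nonneg _
  have hlogW := SpectralFiltering.two_lt_log hT8
  have hcW : Real.log (8 * T : ℕ) ≤ c := by linarith
  have hcL : Real.log (τ + 8 : ℕ) ≤ c := by linarith
  have hc0 : 0 < c := by linarith
  set G := (1 + Real.log T) * (Rx ^ 2 * Ry ^ 2) with hG
  have hlogT := SpectralFiltering.half_le_log hT
  have hG0 : 0 < G := by positivity
  -- All `T` filters are kept. `W = 8 T` satisfies both `3 T ≤ W` for the phase combination and `8 ≤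
  -- W` for the convexity exponent.
  refine ⟨8 * T, T, τ + 8, le_rfl, ρ, 1 / (288 * c * G * √((((τ + 8 : ℕ) : ℝ) + 1) * T)),
    by omega, by omega, ?_, by linarith, by positivity, ?_⟩
  · push_cast
    nlinarith
  intro σ φ H
  refine ⟨fun S hS => ?_, fun x y hx hy => ⟨?_, fun Q hQ Qstar hQs => ?_⟩⟩
  · obtain ⟨Q, hQ, hpred⟩ := hS.exists_pseudoLDS H hn (by omega) (W := 8 * T) (by omega)
      hRT hRP hR1
    refine ⟨Q, hQ, fun x _ t ht1 htT => ?_⟩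
    -- The error is exactly zero, so every `s` is admissible.
    rw [hpred x t ht1 htT, sub_self, norm_zero]
    positivity
  · exact SpectralFiltering.exists_isFTRLRun le_rfl σ φ hT8 hL8 (by linarith) _ x y
  · refine (SpectralFiltering.IsFTRLRun.regret_le H hT hT8 hL8 hcW hcL hRx hRy hρ1 hG hx hy hQ
      hQs).trans ?_
    set l := Real.log (n + m + d + RTheta + Rx + Ry) with hl
    have hl1 : 1 ≤ l := by
      rw [hl, Real.le_log_iff_exp_le (by linarith)]
      linarith [Real.exp_one_lt_d9]
    have hdl : Real.log d ≤ l := Real.log_le_log (by linarith) (by linarith)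
    have h1 := SpectralFiltering.log_mul_one_add_log_le hT hd hK1 hτd hl1 hdl
    have h2 := SpectralFiltering.sq_mul_sqrt_le (T := T) (by linarith : (0 : ℝ) ≤ τ + 9) hτd
      (by linarith : (0 : ℝ) ≤ n) X
    have e1 : ((τ + 8 : ℕ) : ℝ) + 1 = τ + 9 := by push_cast; ring
    have hXR : X ^ 2 * (Rx ^ 2 * Ry ^ 2) ≤ R := by
      refine le_trans ?_ hR
      calc X ^ 2 * (Rx ^ 2 * Ry ^ 2) = R1 ^ 2 * Rx ^ 2 * RTheta ^ 4 * RPsi ^ 2 * Ry ^ 2 := by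
            rw [hX]
            ring
        _ ≤ _ := by
            have : R1 ^ 2 ≤ R1 ^ 3 := pow_le_pow_right₀ hR1 (by norm_num)
            gcongr
    have e2 : (K * d) ^ (5 / 2 : ℝ) = K ^ (5 / 2 : ℝ) * (d : ℝ) ^ (5 / 2 : ℝ) :=
      Real.mul_rpow (by linarith) (by linarith)
    rw [e1]
    have hlK := Real.log_nonneg hK1
    have hZ : 0 ≤ l ^ 1 * (R * (d : ℝ) ^ (5 / 2 : ℝ) * n * Real.log T ^ 7 * √T) := by
      have hR0 : 0 ≤ R := le_trans (by positivity) hXR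
      positivity
    calc 305 * c * G * ρ ^ 2 * √((τ + 9) * T)
        = 305 * (Rx ^ 2 * Ry ^ 2) * (c * (1 + Real.log T)) * (ρ ^ 2 * √((τ + 9) * T)) := by
          rw [hG]
          ring
      _ ≤ 305 * (Rx ^ 2 * Ry ^ 2) * (192 * (5 + Real.log K) * (l * Real.log T ^ 7)) *
            (2500 * ((K * d) ^ (5 / 2 : ℝ) * n * X ^ 2 * √T)) := by
          refine mul_le_mul (mul_le_mul_of_nonneg_left h1 (by positivity)) h2 (by positivity) ?_
          positivity
      _ = C0 * (l * ((d : ℝ) ^ (5 / 2 : ℝ) * n * Real.log T ^ 7 * √T)) *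
            (X ^ 2 * (Rx ^ 2 * Ry ^ 2)) := by
          rw [e2, hC0]
          ring
      _ ≤ C0 * (l * ((d : ℝ) ^ (5 / 2 : ℝ) * n * Real.log T ^ 7 * √T)) * R :=
          mul_le_mul_of_nonneg_left hXR (by positivity)
      _ = C0 * (l ^ 1 * (R * (d : ℝ) ^ (5 / 2 : ℝ) * n * Real.log T ^ 7 * √T)) := by ring
      _ ≤ (C0 + K) * (l ^ 1 * (R * (d : ℝ) ^ (5 / 2 : ℝ) * n * Real.log T ^ 7 * √T)) :=
          mul_le_mul_of_nonneg_right (by linarith) hZ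
      _ = _ := by ring
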